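/- Let $\Bbbk$ be an algebraically closed field of characteristic $0$. For $m\ge 0$ let $\mathcal H_m$ be the $0$-Hecke algebra over $\Bbbk$ with generators $T_1,\dots,T_{m-1}$ and relations $T_i^2=-T_i$, $T_iT_j=T_jT_i$ ($|i-j|>1$), $T_iT_{i+1}T_i=T_{i+1}T_iT_{i+1}$. Let $\mathcal{HC}_m$ be the $0$-Hecke-Clifford algebra, generated by $T_1,\dots,T_{m-1}$ with these relations and $c_1,\dots,c_m$ with $c_i^2=-1$, $c_ic_j=-c_jc_i$ ($i\ne j$), subject to $T_ic_j=c_jT_i$ ($j\neq i,i+1$), $T_ic_i=c_{i+1}T_i$, $(T_i+1)c_{i+1}=c_i(T_i+1)$; it is a superalgebra with $T_i$ even and $c_j$ odd. For a composition $\beta=(\beta_1,\dots,\beta_s)$ of $m$ let $D(\beta)=\{\beta_1,\beta_1+\beta_2,\dots,\beta_1+\cdots+\beta_{s-1}\}$, let $S_\beta=\Bbbk\eta_\beta$ be the simple $\mathcal H_m$-module with $T_i\eta_\beta=-\eta_\beta$ for $i\in D(\beta)$ and $T_i\eta_\beta=0$ otherwise, let $P_\beta$ be the projective cover of $S_\beta$,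 and let $\tilde P_\beta=\mathcal{HC}_m\otimes_{\mathcal H_m}P_\beta$ be the induced $\mathcal{HC}_m$-supermodule, where $P_\beta$ is placed in even degree. (For $m=0$ the only composition is the empty one, and $\mathcal H_0=\mathcal{HC}_0=\Bbbk$.) A morphism $f:M\to N$ of supermodules over a superalgebra $A$ is a sum of an even and an odd one, where a homogeneous linear map $f$ is a morphism if $f(am)=(-1)^{|f||a|}af(m)$ for all homogeneous $a\in A$ and all $m\in M$; isomorphisms are the invertible morphisms. Let $n\ge1$, let $\alpha=(\alpha_1,\dots,\alpha_r)$ be a composition of $n$, and let ${}^{\tilde\mu_n}\tilde P_\alpha$ be the restriction of $\tilde P_\alpha$ along the homomorphism $\tilde\mu_n:\mathcal{HC}_{n-1}\to\mathcal{HC}_n$, $T_i\mapsto T_i$, $c_j\mapsto c_j$. Then there is an isomorphism of $\mathcal{HC}_{n-1}$-supermodules \[ {}^{\tilde\mu_n}\tilde P_\alpha\;\cong\;\Bigl(\bigoplus_{1\le i\le r,\ \alpha_i>1}\tilde P_{\alpha_{(i)}}\Bigr)^{\oplus 2}\oplus\Bigl(\bigoplus_{1\le i\le r-1,\ \alpha_i>1}\tilde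 P_{\alpha'_{(i)}}\Bigr)^{\oplus 2}\oplus\tilde P_{(\alpha_2,\dots,\alpha_r)}^{\oplus 2\delta_{\alpha_1,1}}, \] where $\alpha_{(i)}=(\alpha_1,\dots,\alpha_{i-1},\alpha_i-1,\alpha_{i+1},\dots,\alpha_r)$ and $\alpha'_{(i)}=(\alpha_1,\dots,\alpha_{i-1},\alpha_i+\alpha_{i+1}-1,\alpha_{i+2},\dots,\alpha_r)$. For $n\ge2$ the isomorphism can be chosen even. -/

import Mathlib

open scoped TensorProduct DirectSum

noncomputable section

namespace HeckeClifford

universe u v w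

/-! ### The 0-Hecke algebra and the 0-Hecke-Clifford algebra

Indices are 0-based: `T i` (`i + 1 < n`) and `c j` (`j < n`) are the generators usually
written `T_{i+1}` and `c_{j+1}`. -/

/-- Index set of the generators `T_1, …, T_{n-1}`. -/
abbrev TIdx (n : ℕ) : Type := {i : ℕ // i + 1 < n}

section Algebras

variable (k : Type u) [Field k] (n : ℕ)

/-- Defining relations of the 0-Hecke algebra `H_n(0)`. -/
inductive HeckeRel : FreeAlgebra k (TIdx n) → FreeAlgebra k (TIdx n) → Prop
  | sq (i : TIdx n) :
      HeckeRel (FreeAlgebra.ι k i * FreeAlgebra.ι k i) (-FreeAlgebra.ι k i)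
  | comm (i j : TIdx n) (h : i.1 + 1 < j.1 ∨ j.1 + 1 < i.1) :
      HeckeRel (FreeAlgebra.ι k i * FreeAlgebra.ι k j) (FreeAlgebra.ι k j * FreeAlgebra.ι k i)
  | braid (i j : TIdx n) (h : j.1 = i.1 + 1) :
      HeckeRel (FreeAlgebra.ι k i * FreeAlgebra.ι k j * FreeAlgebra.ι k i)
        (FreeAlgebra.ι k j * FreeAlgebra.ι k i * FreeAlgebra.ι k j)

/-- The 0-Hecke algebra `H_n(0)` of type A. -/
def Hecke : Type u := RingQuot (HeckeRel k n)

instance : Ring (Hecke k n) := inferInstanceAs (Ring (RingQuot (HeckeRel k n)))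
instance : Algebra k (Hecke k n) := inferInstanceAs (Algebra k (RingQuot (HeckeRel k n)))

/-- Generators of the 0-Hecke-Clifford algebra: `inl i` for `T i`, `inr j` for `c j`. -/
abbrev HCGen (n : ℕ) : Type := TIdx n ⊕ Fin n

/-- Free generator for `T i`. -/
abbrev freeT (i : TIdx n) : FreeAlgebra k (HCGen n) := FreeAlgebra.ι k (Sum.inl i)

/-- Free generator for `c j`. -/
abbrev freeC (j : Fin n) : FreeAlgebra k (HCGen n) := FreeAlgebra.ι k (Sum.inr j)

/-- Defining relations of the 0-Hecke-Clifford algebra `HCl_n(0)`. -/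
inductive HCRel : FreeAlgebra k (HCGen n) → FreeAlgebra k (HCGen n) → Prop
  | sq (i : TIdx n) : HCRel (freeT k n i * freeT k n i) (-freeT k n i)
  | comm (i j : TIdx n) (h : i.1 + 1 < j.1 ∨ j.1 + 1 < i.1) :
      HCRel (freeT k n i * freeT k n j) (freeT k n j * freeT k n i)
  | braid (i j : TIdx n) (h : j.1 = i.1 + 1) :
      HCRel (freeT k n i * freeT k n j * freeT k n i) (freeT k n j * freeT k n i * freeT k n j)
  | cliffSq (j : Fin n) : HCRel (freeC k n j * freeC k n j) (-1)
  | cliffAnti (i j : Fin n) (h : i ≠ j) :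
      HCRel (freeC k n i * freeC k n j) (-(freeC k n j * freeC k n i))
  | crossComm (i : TIdx n) (j : Fin n) (h : j.1 ≠ i.1) (h' : j.1 ≠ i.1 + 1) :
      HCRel (freeT k n i * freeC k n j) (freeC k n j * freeT k n i)
  | crossUp (i : TIdx n) :
      HCRel (freeT k n i * freeC k n ⟨i.1, Nat.lt_of_succ_lt i.2⟩)
        (freeC k n ⟨i.1 + 1, i.2⟩ * freeT k n i)
  | crossDown (i : TIdx n) :
      HCRel ((freeT k n i + 1) * freeC k n ⟨i.1 + 1, i.2⟩)
        (freeC k n ⟨i.1, Nat.lt_of_succ_lt i.2⟩ * (freeT k n i + 1))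

/-- The 0-Hecke-Clifford algebra `HCl_n(0)` of type A. -/
def HC : Type u := RingQuot (HCRel k n)

instance : Ring (HC k n) := inferInstanceAs (Ring (RingQuot (HCRel k n)))
instance : Algebra k (HC k n) := inferInstanceAs (Algebra k (RingQuot (HCRel k n)))

variable {n}

/-- The image of a generator in `HCl_n(0)`. -/
def HC.gen (g : HCGen n) : HC k n := RingQuot.mkAlgHom k (HCRel k n) (FreeAlgebra.ι k g)

/-- The generator `T i` of `HCl_n(0)`. -/
abbrev HC.T (i : TIdx n) : HC k n := HC.gen k (Sum.inl i)

/-- The generator `c j` of `HCl_n(0)`. -/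
abbrev HC.c (j : Fin n) : HC k n := HC.gen k (Sum.inr j)

theorem HC.rel {x y : FreeAlgebra k (HCGen n)} (h : HCRel k n x y) :
    FreeAlgebra.lift k (HC.gen k) x = FreeAlgebra.lift k (HC.gen k) y := by
  have e : FreeAlgebra.lift k (HC.gen k (n := n)) = RingQuot.mkAlgHom k (HCRel k n) := by
    apply FreeAlgebra.hom_ext
    ext g
    simp only [Function.comp_apply, FreeAlgebra.lift_ι_apply]
    rfl
  rw [e]
  exact RingQuot.mkAlgHom_rel k h

variable (n)

/-- The `ℤ/2`-grading of `HCl_n(0)` with `deg T_i = 0` and `deg c_j = 1`: the component of degree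
`d` is spanned by the words in the generators whose number of letters `c_j` is `d` modulo 2. -/
def HC.grading (d : ZMod 2) : Submodule k (HC k n) :=
  Submodule.span k
    {x | ∃ l : List (HCGen n), (l.map (HC.gen k)).prod = x ∧ ((l.countP Sum.isRight : ℕ) : ZMod 2) = d}

/-- The inclusion `H_n(0) → HCl_n(0)`, `T_i ↦ T_i`. -/
def heckeToHC : Hecke k n →ₐ[k] HC k n :=
  RingQuot.liftAlgHom k ⟨FreeAlgebra.lift k (HC.T k), by
    intro x y h
    cases h with
    | sq i => simpa using HC.rel k (HCRel.sq i)
    | comm i j h => simpa using HC.rel k (HCRel.comm i j h)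
    | braid i j h => simpa using HC.rel k (HCRel.braid i j h)⟩

/-- The embedding `HCl_n(0) → HCl_{n+1}(0)`, `T_i ↦ T_i`, `c_j ↦ c_j`. -/
def towerMap : HC k n →ₐ[k] HC k (n + 1) :=
  RingQuot.liftAlgHom k ⟨FreeAlgebra.lift k
      (Sum.elim (fun i : TIdx n => HC.T k (⟨i.1, Nat.lt_succ_of_lt i.2⟩ : TIdx (n + 1)))
        (fun j : Fin n => HC.c k j.castSucc)), by
    intro x y h
    cases h with
    | sq i => simpa using HC.rel k (HCRel.sq (⟨i.1, Nat.lt_succ_of_lt i.2⟩ : TIdx (n + 1)))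
    | comm i j h =>
      simpa using HC.rel k (HCRel.comm (⟨i.1, Nat.lt_succ_of_lt i.2⟩ : TIdx (n + 1))
        ⟨j.1, Nat.lt_succ_of_lt j.2⟩ h)
    | braid i j h =>
      simpa using HC.rel k (HCRel.braid (⟨i.1, Nat.lt_succ_of_lt i.2⟩ : TIdx (n + 1))
        ⟨j.1, Nat.lt_succ_of_lt j.2⟩ h)
    | cliffSq j => simpa using HC.rel k (HCRel.cliffSq j.castSucc)
    | cliffAnti i j h =>
      simpa using HC.rel k (HCRel.cliffAnti i.castSucc j.castSucc
        (fun e => h (Fin.castSucc_injective n e)))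
    | crossComm i j h h' =>
      simpa using HC.rel k (HCRel.crossComm (⟨i.1, Nat.lt_succ_of_lt i.2⟩ : TIdx (n + 1))
        j.castSucc h h')
    | crossUp i =>
      simpa using HC.rel k (HCRel.crossUp (⟨i.1, Nat.lt_succ_of_lt i.2⟩ : TIdx (n + 1)))
    | crossDown i =>
      simpa using HC.rel k (HCRel.crossDown (⟨i.1, Nat.lt_succ_of_lt i.2⟩ : TIdx (n + 1)))⟩

end Algebras

/-! ### Compositions -/

section Compositions

/-- `D(α) = {α_1, α_1 + α_2, …, α_1 + ⋯ + α_{r-1}}`. -/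
def descentSet {n : ℕ} (α : Composition n) : Set ℕ :=
  {d | ∃ i, 0 < i ∧ i < α.length ∧ α.sizeUpTo i = d}

variable {n : ℕ} (α : Composition (n + 1))

/-- `(α_1, …, α_{i-1}, α_i - 1, α_{i+1}, …, α_r)`, where `α_i > 1`. -/
def decPart (i : ℕ) (hi : i < α.blocks.length) (h : 1 < α.blocks[i]) : Composition n where
  blocks := α.blocks.take i ++ (α.blocks[i] - 1) :: α.blocks.drop (i + 1)
  blocks_pos := by
    intro x hx
    simp only [List.mem_append, List.mem_cons] at hx
    rcases hx with hx | rfl | hx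
    · exact α.blocks_pos (List.mem_of_mem_take hx)
    · omega
    · exact α.blocks_pos (List.mem_of_mem_drop hx)
  blocks_sum := by
    have hs := α.blocks_sum
    rw [← List.take_append_drop i α.blocks, List.drop_eq_getElem_cons hi] at hs
    simp only [List.sum_append, List.sum_cons] at hs ⊢
    omega

/-- `(α_1, …, α_{i-1}, α_i + α_{i+1} - 1, α_{i+2}, …, α_r)`, where `i < r`, `α_i > 1`. -/
def mergePart (i : ℕ) (hi : i + 1 < α.blocks.length)
    (h : 1 < α.blocks[i]) : Composition n where
  blocks := α.blocks.take i ++ (α.blocks[i] + α.blocks[i + 1] - 1) :: α.blocks.drop (i + 2)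
  blocks_pos := by
    intro x hx
    simp only [List.mem_append, List.mem_cons] at hx
    rcases hx with hx | rfl | hx
    · exact α.blocks_pos (List.mem_of_mem_take hx)
    · omega
    · exact α.blocks_pos (List.mem_of_mem_drop hx)
  blocks_sum := by
    have hs := α.blocks_sum
    rw [← List.take_append_drop i α.blocks, List.drop_eq_getElem_cons (Nat.lt_of_succ_lt hi),
      List.drop_eq_getElem_cons hi] at hs
    simp only [List.sum_append, List.sum_cons, Nat.add_assoc, Nat.reduceAdd] at hs ⊢
    omega

/-- `(α_2, …, α_r)`, where `α_1 = 1`; the empty composition of `0` if `α = (1)`. -/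
def tailPart (h0 : 0 < α.blocks.length) (h : α.blocks[0] = 1) : Composition n where
  blocks := α.blocks.drop 1
  blocks_pos := fun hx => α.blocks_pos (List.mem_of_mem_drop hx)
  blocks_sum := by
    have hs := α.blocks_sum
    rw [← List.take_append_drop 0 α.blocks, List.drop_eq_getElem_cons h0] at hs
    simp only [List.take_zero, List.nil_append, List.sum_cons, zero_add] at hs
    omega

/-- Index set of the summands of the branching rule (each of which occurs twice). Part indices
are 0-based. -/
inductive Branch : Type
  | dec (i : ℕ) (hi : i < α.blocks.length) (h : 1 < α.blocks[i])
  | merge (i : ℕ) (hi : i + 1 < α.blocks.length) (h : 1 < α.blocks[i])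
  | tail (h0 : 0 < α.blocks.length) (h : α.blocks[0] = 1)

variable {α}

/-- The composition of `n` that belongs to a summand of the branching rule. -/
def Branch.comp : Branch α → Composition n
  | .dec i hi h => decPart α i hi h
  | .merge i hi h => mergePart α i hi h
  | .tail h0 h => tailPart α h0 h

end Compositions

/-! ### Simple modules of the 0-Hecke algebra and projective covers -/

section Simple

variable (k : Type u) [Field k] {n : ℕ} (α : Composition n)

open Classical in
/-- The character of `H_n(0)` with `T_i ↦ -1` for `i ∈ D(α)` and `T_i ↦ 0` otherwise. -/
def simpleChar : Hecke k n →ₐ[k] k :=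
  RingQuot.liftAlgHom k ⟨FreeAlgebra.lift k
      (fun i : TIdx n => if i.1 + 1 ∈ descentSet α then (-1 : k) else 0), by
    intro x y h
    cases h with
    | sq i => simp only [map_mul, map_neg, FreeAlgebra.lift_ι_apply]; split_ifs <;> simp
    | comm i j h => simp only [map_mul]; ring
    | braid i j h =>
      simp only [map_mul, FreeAlgebra.lift_ι_apply]; split_ifs <;> simp⟩

/-- The one-dimensional simple `H_n(0)`-module `S_α`. -/
def SimpleMod (_α : Composition n) : Type u := k

instance : AddCommGroup (SimpleMod k α) := inferInstanceAs (AddCommGroup k)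
instance : Module (Hecke k n) (SimpleMod k α) :=
  Module.compHom k (simpleChar k α).toRingHom

end Simple

/-- `p : P → S` is a projective cover: `P` is projective, `p` is surjective, and the kernel of `p`
is superfluous. -/
def IsProjectiveCover {A : Type u} [Ring A] {P : Type v} [AddCommGroup P] [Module A P]
    {S : Type w} [AddCommGroup S] [Module A S] (p : P →ₗ[A] S) : Prop :=
  Module.Projective A P ∧ Function.Surjective p ∧
    ∀ N : Submodule A P, N ⊔ LinearMap.ker p = ⊤ → N = ⊤

/-! ### Induction and restriction along an algebra homomorphism -/

section IndRes

variable {k : Type u} [Field k] {B A : Type u} [Ring B] [Ring A] [Algebra k B] [Algebra k A]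
variable (f : B →ₐ[k] A)

/-- The relations `x f(b) ⊗ p = x ⊗ b p` in `A ⊗_k P`. -/
def indRel (P : Type v) [AddCommGroup P] [Module k P] [Module B P] : Submodule A (A ⊗[k] P) :=
  Submodule.span A {z | ∃ (x : A) (b : B) (p : P), z = (x * f b) ⊗ₜ[k] p - x ⊗ₜ[k] (b • p)}

/-- The induced module `A ⊗_B P`, where `B` acts on `A` from the right through `f`. -/
def Ind (P : Type v) [AddCommGroup P] [Module k P] [Module B P] : Type (max u v) :=
  (A ⊗[k] P) ⧸ indRel f P

section

variable (P : Type v) [AddCommGroup P] [Module k P] [Module B P]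

instance : AddCommGroup (Ind f P) := inferInstanceAs (AddCommGroup ((A ⊗[k] P) ⧸ indRel f P))
instance : Module A (Ind f P) := inferInstanceAs (Module A ((A ⊗[k] P) ⧸ indRel f P))
instance : Module k (Ind f P) := inferInstanceAs (Module k ((A ⊗[k] P) ⧸ indRel f P))

variable {P}

/-- The class of `a ⊗ p` in `A ⊗_B P`. -/
def Ind.tmul (a : A) (p : P) : Ind f P := (indRel f P).mkQ (a ⊗ₜ[k] p)

variable (P)

/-- The `ℤ/2`-grading on `A ⊗_B P` for a `ℤ/2`-grading `𝓐` of `A`, where `P` is purely even. -/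
def Ind.grading (𝓐 : ZMod 2 → Submodule k A) (d : ZMod 2) : Submodule k (Ind f P) :=
  Submodule.span k {z | ∃ a ∈ 𝓐 d, ∃ p : P, z = Ind.tmul f a p}

end

/-- The `A`-module `M` with the action of `B` through `f`: `b • m = f(b) m`. -/
def Res (_f : B →ₐ[k] A) (M : Type v) : Type v := M

section

variable (M : Type v) [AddCommGroup M]

instance : AddCommGroup (Res f M) := inferInstanceAs (AddCommGroup M)
instance [Module k M] : Module k (Res f M) := inferInstanceAs (Module k M)
instance [Module A M] : Module B (Res f M) := Module.compHom M f.toRingHom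

variable {M}

/-- The same grading on the restricted module. -/
def Res.grading [Module k M] (𝓜 : ZMod 2 → Submodule k M) : ZMod 2 → Submodule k (Res f M) := 𝓜

end

end IndRes

/-! ### Supermodules and their morphisms -/

section Super

variable {k : Type u} [Field k]

/-- The direct sum of graded spaces, graded componentwise. -/
def directSumGrading {ι : Type*} {M : ι → Type v} [∀ i, AddCommGroup (M i)] [∀ i, Module k (M i)]
    (𝓜 : ∀ i, ZMod 2 → Submodule k (M i)) (d : ZMod 2) : Submodule k (⨁ i, M i) where
  carrier := {x | ∀ i, x i ∈ 𝓜 i d}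
  add_mem' := fun {x y} hx hy i => by
    rw [DirectSum.add_apply]; exact (𝓜 i d).add_mem (hx i) (hy i)
  zero_mem' := fun i => by rw [DirectSum.zero_apply]; exact (𝓜 i d).zero_mem
  smul_mem' := fun c x hx i => by
    rw [DirectSum.smul_apply]; exact (𝓜 i d).smul_mem c (hx i)

variable {A : Type u} [Ring A] [Algebra k A] (𝓐 : ZMod 2 → Submodule k A)
variable {M : Type v} [AddCommGroup M] [Module k M] [Module A M] (𝓜 : ZMod 2 → Submodule k M)
variable {N : Type w} [AddCommGroup N] [Module k N] [Module A N] (𝓝 : ZMod 2 → Submodule k N)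

/-- `f` is a homogeneous morphism of `A`-supermodules of degree `d`: it maps `M_j` to `N_{d+j}`,
and `f(am) = (-1)^{d|a|} a f(m)`. -/
def IsHomogeneousHom (d : ZMod 2) (f : M →ₗ[k] N) : Prop :=
  (∀ j, ∀ m ∈ 𝓜 j, f m ∈ 𝓝 (d + j)) ∧
    ∀ j, ∀ a ∈ 𝓐 j, ∀ m, f (a • m) = (-1 : k) ^ (d * j).val • (a • f m)

/-- `f` is a morphism of `A`-supermodules: a sum of an even and an odd one. -/
def IsSuperHom (f : M →ₗ[k] N) : Prop :=
  ∃ f₀ f₁ : M →ₗ[k] N,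
    IsHomogeneousHom 𝓐 𝓜 𝓝 0 f₀ ∧ IsHomogeneousHom 𝓐 𝓜 𝓝 1 f₁ ∧ f = f₀ + f₁

/-- `e` is an isomorphism of `A`-supermodules (not necessarily homogeneous). -/
def IsSuperIso (e : M ≃ₗ[k] N) : Prop :=
  IsSuperHom 𝓐 𝓜 𝓝 e.toLinearMap ∧ IsSuperHom 𝓐 𝓝 𝓜 e.symm.toLinearMap

/-- `e` is an even isomorphism of `A`-supermodules. -/
def IsEvenIso (e : M ≃ₗ[k] N) : Prop :=
  IsHomogeneousHom 𝓐 𝓜 𝓝 0 e.toLinearMap ∧ IsHomogeneousHom 𝓐 𝓝 𝓜 0 e.symm.toLinearMap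

end Super

/-! ### The induced projective supermodules -/

section Projective

variable (k : Type u) [Field k] (n : ℕ)
variable (P : Type v) [AddCommGroup P] [Module k P] [Module (Hecke k n) P]

/-- `HCl_n(0) ⊗_{H_n(0)} P`. -/
abbrev IndHC : Type (max u v) := Ind (heckeToHC k n) P

/-- The `ℤ/2`-grading of `HCl_n(0) ⊗_{H_n(0)} P`, with `P` purely even. -/
abbrev IndHC.grading : ZMod 2 → Submodule k (IndHC k n P) :=
  Ind.grading (heckeToHC k n) P (HC.grading k n)

end Projective

end HeckeClifford

end

/-! Throughout, the number of strands goes from `n + 1` down to `n`. The argument separates the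
Clifford generators from the Hecke algebra.

Clifford side. The space underlying an induced module is Cl ⊗ P (`ofModel_bijective`): the
generators act on it by explicit operators, and the defining relations have to be tested only on 1 ⊗
P. The Clifford algebra of rank n + 1 is Cl_n ⊕ Cl_n c with c the last generator, and c commutes
with H_n. Hence the restriction of Ind P is the sum of two copies of Ind (Res P), embedded by x ⊗ p
↦ x ⊗ p and x ⊗ p ↦ xc ⊗ p (`indResPair_bijective`). The second embedding is odd.

Hecke side. It remains to decompose Res P_α over H_n (`IsProjectiveCover.exists_res_equiv`). This
module is projective and finitely generated, so its maps to the simple modules determine it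
(`exists_equiv_directSum_covers`). By Frobenius reciprocity, maps Res P_α → S_β are maps from P_α to
the coinduced module of S_β. That module is filtered with one-dimensional layers, indexed by the
positions l = 0, …, n; layer l has the descents of a permutation with descent composition β into
which the letter n + 1 is inserted at position l. So the maps are counted by the pairs (β, l) whose
insertion yields α, and these pairs are the summands of the rule (`Branch.isInsertion`,
`IsInsertion.exists_branch`, `Branch.ext_of_pos`).

Parity. For n > 0 an induced projective cover has an odd linear automorphism (`exists_odd_equiv`),
and twisting the second copies by it makes the isomorphism even. The automorphism exists because
Norton's generator, a product of two longest elements, generates the projective cover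
(`exists_norton_section`, by counting dimensions) and can be moved past a Clifford generator
(`exists_norton_mul_c`). For n = 0 the algebra is the field, and the isomorphism is a sum of an even
and an odd map (`isSuperIso_of_purely_even`). -/

noncomputable section

namespace HeckeClifford

universe u v w

/-! ### Families satisfying the braid relations -/

section Braid

/-- The braid relations of type A for a sequence of elements of a monoid. -/
structure IsBraid {R : Type*} [Monoid R] (a : ℕ → R) : Prop where
  comm : ∀ i j, i + 1 < j → a i * a j = a j * a i
  braid : ∀ i, a i * a (i + 1) * a i = a (i + 1) * a i * a (i + 1)

variable {R : Type*} [Monoid R] (a : ℕ → R)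

/-- The ascending product `a_j a_{j+1} ⋯ a_{j+l-1}`. -/
def asc (j : ℕ) : ℕ → R
  | 0 => 1
  | l + 1 => asc j l * a (j + l)

/-- The descending product `a_{j+l-1} ⋯ a_{j+1} a_j`. -/
def desc (j : ℕ) : ℕ → R
  | 0 => 1
  | l + 1 => a (j + l) * desc j l

@[simp] theorem asc_zero (j : ℕ) : asc a j 0 = 1 := rfl
@[simp] theorem desc_zero (j : ℕ) : desc a j 0 = 1 := rfl
theorem asc_succ (j l : ℕ) : asc a j (l + 1) = asc a j l * a (j + l) := rfl
theorem desc_succ (j l : ℕ) : desc a j (l + 1) = a (j + l) * desc a j l := rfl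

theorem asc_succ_left (j l : ℕ) : asc a j (l + 1) = a j * asc a (j + 1) l := by
  induction l with
  | zero => simp [asc_succ]
  | succ l ih => rw [asc_succ, ih, asc_succ, mul_assoc]; congr 3; omega

/-- Passing to the opposite monoid turns every identity for ascending products into one for
descending products. -/
theorem desc_eq_unop (j l : ℕ) :
    desc a j l = (asc (fun i => MulOpposite.op (a i)) j l).unop := by
  induction l with
  | zero => simp
  | succ l ih => simp [asc_succ, desc_succ, ih]

theorem desc_succ_right (j l : ℕ) : desc a j (l + 1) = desc a (j + 1) l * a j := by
  rw [desc_eq_unop, desc_eq_unop, asc_succ_left]; rfl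

theorem map_desc {S F : Type*} [Monoid S] [FunLike F R S] [MonoidHomClass F R S] (f : F)
    (j l : ℕ) : f (desc a j l) = desc (fun i => f (a i)) j l := by
  induction l with
  | zero => simp
  | succ l ih => simp [desc_succ, ih]

variable {a}

theorem commute_asc {x : R} {j l : ℕ} (h : ∀ i, j ≤ i → i < j + l → x * a i = a i * x) :
    x * asc a j l = asc a j l * x := by
  induction l with
  | zero => simp
  | succ l ih =>
    rw [asc_succ, ← mul_assoc, ih fun i h1 h2 => h i h1 (by omega), mul_assoc,
      h (j + l) (by omega) (by omega), mul_assoc]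

theorem commute_desc {x : R} {j l : ℕ} (h : ∀ i, j ≤ i → i < j + l → x * a i = a i * x) :
    x * desc a j l = desc a j l * x := by
  induction l with
  | zero => simp
  | succ l ih =>
    rw [desc_succ, ← mul_assoc, h (j + l) (by omega) (by omega), mul_assoc,
      ih fun i h1 h2 => h i h1 (by omega), mul_assoc]

theorem IsBraid.op (ha : IsBraid a) : IsBraid (fun i => MulOpposite.op (a i)) where
  comm i j h := by simp only [← MulOpposite.op_mul, ha.comm i j h]
  braid i := by simp only [← MulOpposite.op_mul, ← mul_assoc, ha.braid i]

theorem IsBraid.mul_asc_of_lt (ha : IsBraid a) {i j l : ℕ} (h : i + 1 < j) :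
    a i * asc a j l = asc a j l * a i :=
  commute_asc fun m h1 _ => ha.comm i m (by omega)

/-- The factor a_{i+1} commutes with everything before a_i, the braid relation turns a_{i+1} a_i
a_{i+1} into a_i a_{i+1} a_i, and the last a_i commutes with the remaining factors. -/
theorem IsBraid.mul_asc (ha : IsBraid a) {i j l : ℕ} (h : j ≤ i) (h' : i + 1 < j + l) :
    a (i + 1) * asc a j l = asc a j l * a i := by
  induction l with
  | zero => omega
  | succ l ih =>
    by_cases hl : i + 1 < j + l
    · rw [asc_succ, ← mul_assoc, ih hl, mul_assoc, ha.comm i _ hl, mul_assoc]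
    · obtain ⟨m, rfl⟩ : ∃ m, l = m + 1 := ⟨l - 1, by omega⟩
      obtain rfl : i = j + m := by omega
      have hc : a (j + m + 1) * asc a j m = asc a j m * a (j + m + 1) :=
        commute_asc fun r h1 h2 => (ha.comm r _ (by omega)).symm
      rw [asc_succ, asc_succ, ← mul_assoc, ← mul_assoc, hc]
      rw [mul_assoc, mul_assoc, mul_assoc, mul_assoc]
      congr 1
      rw [← mul_assoc, ← mul_assoc]
      exact (ha.braid (j + m)).symm

theorem IsBraid.desc_mul_of_lt (ha : IsBraid a) {i j l : ℕ} (h : i + 1 < j) :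
    desc a j l * a i = a i * desc a j l := by
  have := congrArg MulOpposite.unop (ha.op.mul_asc_of_lt (l := l) h)
  simpa [desc_eq_unop] using this

theorem IsBraid.desc_mul (ha : IsBraid a) {i j l : ℕ} (h : j ≤ i) (h' : i + 1 < j + l) :
    desc a j l * a (i + 1) = a i * desc a j l := by
  have := congrArg MulOpposite.unop (ha.op.mul_asc (l := l) h h')
  simpa [desc_eq_unop] using this

end Braid

/-! ### The 0-Hecke algebra -/

section Hecke

variable (k : Type u) [Field k]

/-- The generator `T_i` of the 0-Hecke algebra, and `0` when the index is out of range. -/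
def Hecke.T (n i : ℕ) : Hecke k n :=
  if h : i + 1 < n then RingQuot.mkAlgHom k (HeckeRel k n) (FreeAlgebra.ι k ⟨i, h⟩) else 0

variable {k} {n : ℕ}

theorem Hecke.T_of_lt {i : ℕ} (h : i + 1 < n) :
    Hecke.T k n i = RingQuot.mkAlgHom k (HeckeRel k n) (FreeAlgebra.ι k ⟨i, h⟩) := dif_pos h

theorem Hecke.T_of_le {i : ℕ} (h : n ≤ i + 1) : Hecke.T k n i = 0 := dif_neg (by omega)

theorem Hecke.T_mul_self (i : ℕ) : Hecke.T k n i * Hecke.T k n i = -Hecke.T k n i := by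
  by_cases h : i + 1 < n
  · rw [T_of_lt h]
    have := RingQuot.mkAlgHom_rel k (HeckeRel.sq (k := k) ⟨i, h⟩)
    rw [map_mul, map_neg] at this
    exact this
  · rw [T_of_le (by omega)]; simp

theorem Hecke.isBraid : IsBraid (Hecke.T k n) where
  comm i j h := by
    by_cases hj : j + 1 < n
    · have hi : i + 1 < n := by omega
      rw [T_of_lt hj, T_of_lt hi]
      have := RingQuot.mkAlgHom_rel k (HeckeRel.comm (k := k) ⟨i, hi⟩ ⟨j, hj⟩ (Or.inl h))
      rw [map_mul, map_mul] at this
      exact this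
    · rw [T_of_le (i := j) (by omega)]; simp
  braid i := by
    by_cases hj : i + 1 + 1 < n
    · have hi : i + 1 < n := by omega
      rw [T_of_lt hj, T_of_lt hi]
      have := RingQuot.mkAlgHom_rel k (HeckeRel.braid (k := k) ⟨i, hi⟩ ⟨i + 1, hj⟩ rfl)
      rw [map_mul, map_mul, map_mul, map_mul] at this
      exact this
    · rw [T_of_le (i := i + 1) (by omega)]; simp

/-- The universal property of the 0-Hecke algebra. -/
def Hecke.lift {A : Type*} [Ring A] [Algebra k A] (n : ℕ) (a : ℕ → A)
    (sq : ∀ i, i + 1 < n → a i * a i = -a i)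
    (comm : ∀ i j, i + 1 < j → j + 1 < n → a i * a j = a j * a i)
    (braid : ∀ i, i + 1 + 1 < n → a i * a (i + 1) * a i = a (i + 1) * a i * a (i + 1)) :
    Hecke k n →ₐ[k] A :=
  RingQuot.liftAlgHom k ⟨FreeAlgebra.lift k (fun i : TIdx n => a i.1), by
    intro x y h
    cases h with
    | sq i => simpa using sq i.1 i.2
    | comm i j h =>
      rcases h with h | h
      · simpa using comm i.1 j.1 h j.2
      · simpa using (comm j.1 i.1 h i.2).symm
    | braid i j h =>
      obtain ⟨j, hj⟩ := j
      obtain rfl : j = i.1 + 1 := h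
      simpa using braid i.1 hj⟩

theorem Hecke.lift_T {A : Type*} [Ring A] [Algebra k A] {a : ℕ → A} {sq comm braid} {i : ℕ}
    (h : i + 1 < n) : Hecke.lift (k := k) n a sq comm braid (Hecke.T k n i) = a i := by
  rw [T_of_lt h]
  exact (RingQuot.liftAlgHom_mkAlgHom_apply k _ _ _).trans (by simp)

theorem simpleChar_T_mem {α : Composition n} {i : ℕ} (h : i + 1 < n) (hd : i + 1 ∈ descentSet α) :
    simpleChar k α (Hecke.T k n i) = -1 := by
  rw [Hecke.T_of_lt h]
  exact (RingQuot.liftAlgHom_mkAlgHom_apply k _ _ _).trans (by simp [hd])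

theorem simpleChar_T_not_mem {α : Composition n} {i : ℕ} (hd : i + 1 ∉ descentSet α) :
    simpleChar k α (Hecke.T k n i) = 0 := by
  by_cases h : i + 1 < n
  · rw [Hecke.T_of_lt h]
    exact (RingQuot.liftAlgHom_mkAlgHom_apply k _ _ _).trans (by simp [hd])
  · rw [Hecke.T_of_le (by omega), map_zero]

theorem heckeToHC_T {i : ℕ} (h : i + 1 < n) :
    heckeToHC k n (Hecke.T k n i) = HC.T k ⟨i, h⟩ := by
  rw [Hecke.T_of_lt h]
  exact (RingQuot.liftAlgHom_mkAlgHom_apply k _ _ _).trans (by simp)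

theorem Hecke.adjoin_T : Algebra.adjoin k {x | ∃ i, i + 1 < n ∧ Hecke.T k n i = x} = ⊤ := by
  rw [eq_top_iff]
  rintro x -
  obtain ⟨y, rfl⟩ := RingQuot.mkAlgHom_surjective k (HeckeRel k n) x
  induction y using FreeAlgebra.induction with
  | grade0 r => rw [AlgHom.commutes]; exact Subalgebra.algebraMap_mem _ r
  | grade1 i => exact Algebra.subset_adjoin ⟨i.1, i.2, T_of_lt i.2⟩
  | mul a b ha hb => rw [map_mul]; exact Subalgebra.mul_mem _ ha hb
  | add a b ha hb => rw [map_add]; exact Subalgebra.add_mem _ ha hb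

theorem Hecke.algHom_ext {A : Type*} [Ring A] [Algebra k A] {f g : Hecke k n →ₐ[k] A}
    (h : ∀ i, i + 1 < n → f (Hecke.T k n i) = g (Hecke.T k n i)) : f = g := by
  apply AlgHom.ext_of_adjoin_eq_top Hecke.adjoin_T
  rintro _ ⟨i, hi, rfl⟩
  exact h i hi

/-- A subspace of a module that is stable under the generators is stable under the algebra. -/
theorem Hecke.smul_mem {V : Type*} [AddCommGroup V] [Module k V] [Module (Hecke k n) V]
    [IsScalarTower k (Hecke k n) V] (N : Submodule k V)
    (h : ∀ i, i + 1 < n → ∀ x ∈ N, Hecke.T k n i • x ∈ N) (a : Hecke k n) {x : V} (hx : x ∈ N) :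
    a • x ∈ N := by
  have ha : a ∈ Algebra.adjoin k {x | ∃ i, i + 1 < n ∧ Hecke.T k n i = x} := by
    rw [adjoin_T]; trivial
  induction ha using Algebra.adjoin_induction generalizing x with
  | mem a ha => obtain ⟨i, hi, rfl⟩ := ha; exact h i hi x hx
  | algebraMap r => rw [algebraMap_smul]; exact N.smul_mem r hx
  | add a b _ _ ha hb => rw [add_smul]; exact N.add_mem (ha hx) (hb hx)
  | mul a b _ _ ha hb => rw [mul_smul]; exact ha (hb hx)

/-- A `k`-linear map that commutes with the generators is linear over the 0-Hecke algebra. -/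
theorem Hecke.map_smul_of_T {V W : Type*} [AddCommGroup V] [Module k V] [Module (Hecke k n) V]
    [IsScalarTower k (Hecke k n) V] [AddCommGroup W] [Module k W] [Module (Hecke k n) W]
    [IsScalarTower k (Hecke k n) W] (f : V →ₗ[k] W)
    (h : ∀ i, i + 1 < n → ∀ x, f (Hecke.T k n i • x) = Hecke.T k n i • f x) (a : Hecke k n)
    (x : V) : f (a • x) = a • f x := by
  have ha : a ∈ Algebra.adjoin k {x | ∃ i, i + 1 < n ∧ Hecke.T k n i = x} := by
    rw [adjoin_T]; trivial
  induction ha using Algebra.adjoin_induction generalizing x with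
  | mem a ha => obtain ⟨i, hi, rfl⟩ := ha; exact h i hi x
  | algebraMap r => rw [algebraMap_smul, algebraMap_smul, map_smul]
  | add a b _ _ ha hb => rw [add_smul, add_smul, map_add, ha, hb]
  | mul a b _ _ ha hb => rw [mul_smul, mul_smul, ha, hb]

variable (k n)

/-- The embedding `H_n(0) → H_{n+1}(0)`, `T_i ↦ T_i`. -/
def heckeTower : Hecke k n →ₐ[k] Hecke k (n + 1) :=
  Hecke.lift n (Hecke.T k (n + 1)) (fun i _ => Hecke.T_mul_self i)
    (fun i j h _ => Hecke.isBraid.comm i j h) (fun i _ => Hecke.isBraid.braid i)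

variable {k n}

theorem heckeTower_T {i : ℕ} (h : i + 1 < n) :
    heckeTower k n (Hecke.T k n i) = Hecke.T k (n + 1) i := Hecke.lift_T h

end Hecke

/-! ### Common eigenvectors -/

/-- Induction on the number of generators. Given an eigenvector v of a_0, …, a_{N-1}, take the least
j such that w = a_j ⋯ a_N v is nonzero; the empty product j = N + 1 qualifies. If i + 1 < j, then
a_i moves past the product to v; a_{j-1} w = 0 by minimality; a_j w = -w by the quadratic relation;
for i > j the braid relations turn a_i into a_{i-1} acting on v. -/
theorem IsBraid.exists_eigenvector {R : Type*} [Ring R] {a : ℕ → R} (ha : IsBraid a)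
    (hsq : ∀ i, a i * a i = -a i) {V : Type*} [AddCommGroup V] [Module R V] [Nontrivial V]
    (n : ℕ) : ∃ v : V, v ≠ 0 ∧ ∀ i < n, a i • v = 0 ∨ a i • v = -v := by
  classical
  induction n with
  | zero =>
    obtain ⟨v, hv⟩ := exists_ne (0 : V)
    exact ⟨v, hv, by simp⟩
  | succ N ih =>
    obtain ⟨v, hv, hev⟩ := ih
    have hex : ∃ j, j ≤ N + 1 ∧ asc a j (N + 1 - j) • v ≠ 0 := ⟨N + 1, le_rfl, by simpa using hv⟩
    obtain ⟨hj, hne⟩ := Nat.find_spec hex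
    have hmin := fun m (hm : m < Nat.find hex) => Nat.find_min hex hm
    set j := Nat.find hex with hjdef
    clear_value j
    refine ⟨_, hne, fun i hi => ?_⟩
    have key : ∀ m < N, a i * asc a j (N + 1 - j) = asc a j (N + 1 - j) * a m →
        a i • asc a j (N + 1 - j) • v = 0 ∨
          a i • asc a j (N + 1 - j) • v = -(asc a j (N + 1 - j) • v) := by
      intro m hm h
      rw [← mul_smul, h, mul_smul]
      rcases hev m hm with h0 | h0
      · left; rw [h0, smul_zero]
      · right; rw [h0, smul_neg]
    rcases lt_trichotomy i j with h | h | h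
    · by_cases h2 : i + 1 < j
      · exact key i (by omega) (ha.mul_asc_of_lt h2)
      · obtain rfl : j = i + 1 := by omega
        left
        have := hmin i (by omega)
        simp only [not_and, not_not] at this
        rw [← mul_smul, ← asc_succ_left]
        have h3 := this (by omega)
        rwa [show N + 1 - i = N + 1 - (i + 1) + 1 by omega] at h3
    · subst h
      right
      obtain ⟨l, hl⟩ : ∃ l, N + 1 - i = l + 1 := ⟨N - i, by omega⟩
      rw [hl, asc_succ_left, ← mul_smul, ← mul_assoc, hsq, neg_mul, neg_smul]
    · obtain ⟨m, rfl⟩ : ∃ m, i = m + 1 := ⟨i - 1, by omega⟩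
      exact key m (by omega) (ha.mul_asc (by omega) (by omega))

/-! ### Descent sets of compositions -/

section PartialSums

/-- The partial sums of a list, the empty one and the full one included. -/
def partialSums : List ℕ → Set ℕ
  | [] => {0}
  | a :: L => {d | d = 0 ∨ ∃ e ∈ partialSums L, d = a + e}

@[simp] theorem mem_partialSums_nil {d : ℕ} : d ∈ partialSums [] ↔ d = 0 := Iff.rfl

@[simp] theorem mem_partialSums_cons {a d : ℕ} {L : List ℕ} :
    d ∈ partialSums (a :: L) ↔ d = 0 ∨ ∃ e ∈ partialSums L, d = a + e := Iff.rfl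

theorem zero_mem_partialSums (L : List ℕ) : 0 ∈ partialSums L := by cases L <;> simp

theorem sum_mem_partialSums (L : List ℕ) : L.sum ∈ partialSums L := by
  induction L with
  | nil => simp
  | cons a L ih => exact Or.inr ⟨_, ih, by simp⟩

theorem le_sum_of_mem_partialSums {L : List ℕ} {d : ℕ} (h : d ∈ partialSums L) : d ≤ L.sum := by
  induction L generalizing d with
  | nil => simp_all
  | cons a L ih =>
    rcases h with rfl | ⟨e, he, rfl⟩
    · simp
    · simpa using ih he

theorem mem_partialSums_append {A B : List ℕ} {d : ℕ} :
    d ∈ partialSums (A ++ B) ↔ d ∈ partialSums A ∨ ∃ e ∈ partialSums B, d = A.sum + e := by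
  induction A generalizing d with
  | nil =>
    simp only [List.nil_append, mem_partialSums_nil, List.sum_nil, zero_add, exists_eq_right']
    exact ⟨Or.inr, fun h => h.elim (fun h => h ▸ zero_mem_partialSums B) id⟩
  | cons a A ih =>
    simp only [List.cons_append, mem_partialSums_cons, ih, List.sum_cons]
    constructor
    · rintro (h | ⟨e, h | ⟨e', h', rfl⟩, rfl⟩)
      · exact Or.inl (Or.inl h)
      · exact Or.inl (Or.inr ⟨e, h, rfl⟩)
      · exact Or.inr ⟨e', h', by omega⟩
    · rintro ((h | ⟨e, h, rfl⟩) | ⟨e, h, rfl⟩)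
      · exact Or.inl h
      · exact Or.inr ⟨e, Or.inl h, rfl⟩
      · exact Or.inr ⟨A.sum + e, Or.inr ⟨e, h, rfl⟩, by omega⟩

theorem mem_partialSums_iff_take {L : List ℕ} {d : ℕ} :
    d ∈ partialSums L ↔ ∃ t ≤ L.length, (L.take t).sum = d := by
  induction L generalizing d with
  | nil => simp [eq_comm]
  | cons a L ih =>
    rw [mem_partialSums_cons]
    constructor
    · rintro (rfl | ⟨e, he, rfl⟩)
      · exact ⟨0, by simp, by simp⟩
      · obtain ⟨t, ht, rfl⟩ := ih.1 he
        exact ⟨t + 1, by simpa using ht, by simp⟩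
    · rintro ⟨t, ht, rfl⟩
      cases t with
      | zero => simp
      | succ t => exact Or.inr ⟨_, ih.2 ⟨t, by simpa using ht, rfl⟩, by simp⟩

/-- For positive entries the head is the least positive partial sum. -/
theorem list_eq_of_partialSums {L M : List ℕ} (hL : ∀ x ∈ L, 0 < x) (hM : ∀ x ∈ M, 0 < x)
    (h : partialSums L = partialSums M) : L = M := by
  induction L generalizing M with
  | nil =>
    cases M with
    | nil => rfl
    | cons b M =>
      have : b ∈ partialSums [] := h ▸ Or.inr ⟨0, zero_mem_partialSums M, rfl⟩
      have h2 := hM b (by simp)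
      simp at this; omega
  | cons a L ih =>
    cases M with
    | nil =>
      have : a ∈ partialSums [] := h ▸ Or.inr ⟨0, zero_mem_partialSums L, rfl⟩
      have h2 := hL a (by simp)
      simp at this; omega
    | cons b M =>
      have ha := hL a (by simp)
      have hb := hM b (by simp)
      have h1 : a ∈ partialSums (b :: M) := h ▸ Or.inr ⟨0, zero_mem_partialSums L, rfl⟩
      have h2 : b ∈ partialSums (a :: L) := h ▸ Or.inr ⟨0, zero_mem_partialSums M, rfl⟩
      obtain rfl : a = b := by
        rcases h1 with h1 | ⟨e, -, h1⟩ <;> rcases h2 with h2 | ⟨e', -, h2⟩ <;> omega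
      congr 1
      apply ih (fun x hx => hL x (by simp [hx])) (fun x hx => hM x (by simp [hx]))
      have key : ∀ K : List ℕ, ∀ d, d ∈ partialSums K ↔ a + d ∈ partialSums (a :: K) := by
        intro K d
        constructor
        · exact fun hd => Or.inr ⟨d, hd, rfl⟩
        · rintro (h0 | ⟨e, he, h0⟩)
          · omega
          · obtain rfl : d = e := by omega
            exact he
      ext d
      rw [key, h, ← key]

/-- Induction on n with D shifted by one: a cut at 1 puts a new part 1 in front, no cut at 1
lengthens the first part by one. For n = 0 there is no part to lengthen. -/
theorem exists_partialSums (D : ℕ → Prop) (n : ℕ) : ∃ L : List ℕ, (∀ x ∈ L, 0 < x) ∧ L.sum = n ∧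
    ∀ d, 0 < d → d < n → (d ∈ partialSums L ↔ D d) := by
  induction n generalizing D with
  | zero => exact ⟨[], by simp, rfl, by omega⟩
  | succ n ih =>
    obtain ⟨L, hpos, hsum, hL⟩ := ih (fun d => D (d + 1))
    by_cases h1 : D 1 ∨ n = 0
    · refine ⟨1 :: L, by simpa using hpos, by simp [hsum, add_comm], fun d hd hdn => ?_⟩
      rw [mem_partialSums_cons]
      rcases Nat.lt_or_ge 1 d with h | h
      · obtain ⟨e, rfl⟩ : ∃ e, d = e + 1 := ⟨d - 1, by omega⟩
        rw [← hL e (by omega) (by omega)]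
        constructor
        · rintro (h0 | ⟨e', he', h0⟩)
          · omega
          · obtain rfl : e = e' := by omega
            exact he'
        · exact fun he => Or.inr ⟨e, he, by omega⟩
      · obtain rfl : d = 1 := by omega
        simp only [one_ne_zero, false_or]
        refine iff_of_true ⟨0, zero_mem_partialSums L, rfl⟩ (h1.resolve_right (by omega))
    · push Not at h1
      cases L with
      | nil => simp at hsum; omega
      | cons a B =>
        refine ⟨(a + 1) :: B, ?_, by simp at hsum ⊢; omega, fun d hd hdn => ?_⟩
        · intro x hx
          rcases List.mem_cons.1 hx with rfl | hx
          · omega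
          · exact hpos x (by simp [hx])
        · have ha := hpos a (by simp)
          obtain ⟨e, rfl⟩ : ∃ e, d = e + 1 := ⟨d - 1, by omega⟩
          rw [mem_partialSums_cons]
          rcases Nat.eq_zero_or_pos e with rfl | he
          · refine iff_of_false ?_ h1.1
            rintro (h0 | ⟨e', he', h0⟩) <;> omega
          · rw [← hL e he (by omega), mem_partialSums_cons]
            constructor
            · rintro (h0 | ⟨e', he', h0⟩)
              · omega
              · exact Or.inr ⟨e', he', by omega⟩
            · rintro (h0 | ⟨e', he', h0⟩)
              · omega
              · exact Or.inr ⟨e', he', by omega⟩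

end PartialSums

/-! ### Descent sets and the insertion of the largest letter -/

section Descents

variable {n : ℕ}

theorem mem_descentSet {α : Composition n} {d : ℕ} :
    d ∈ descentSet α ↔ d ∈ partialSums α.blocks ∧ 0 < d ∧ d < n := by
  rw [mem_partialSums_iff_take]
  constructor
  · rintro ⟨i, h0, hi, rfl⟩
    refine ⟨⟨i, hi.le, rfl⟩, ?_, ?_⟩
    · have := α.sizeUpTo_strict_mono (i := 0) (by omega)
      have h2 := α.monotone_sizeUpTo (show 0 + 1 ≤ i by omega)
      omega
    · have := α.sizeUpTo_strict_mono hi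
      have h2 := α.sizeUpTo_le (i + 1)
      omega
  · rintro ⟨⟨t, ht, rfl⟩, h0, hn⟩
    refine ⟨t, ?_, ?_, rfl⟩
    · rcases Nat.eq_zero_or_pos t with rfl | h
      · simp at h0
      · exact h
    · rcases lt_or_eq_of_le ht with h | rfl
      · exact h
      · rw [List.take_length, α.blocks_sum] at hn; omega

theorem composition_ext {β γ : Composition n}
    (h : ∀ d, 0 < d → d < n → (d ∈ descentSet β ↔ d ∈ descentSet γ)) : β = γ := by
  apply Composition.ext
  apply list_eq_of_partialSums (fun x hx => β.blocks_pos hx) (fun x hx => γ.blocks_pos hx)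
  have key : ∀ (β : Composition n) d, d ∈ partialSums β.blocks ↔
      d = 0 ∨ d = n ∨ (d ∈ descentSet β) := by
    intro β d
    rw [mem_descentSet]
    constructor
    · intro hd
      have := le_sum_of_mem_partialSums hd
      rw [β.blocks_sum] at this
      by_cases h0 : d = 0
      · exact Or.inl h0
      · by_cases h1 : d = n
        · exact Or.inr (Or.inl h1)
        · exact Or.inr (Or.inr ⟨hd, by omega, by omega⟩)
    · rintro (rfl | rfl | hd)
      · exact zero_mem_partialSums _
      · have := sum_mem_partialSums β.blocks
        rwa [β.blocks_sum] at this
      · exact hd.1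
  ext d
  rw [key, key]
  by_cases h0 : d = 0
  · simp [h0]
  by_cases h1 : d = n
  · simp [h1]
  by_cases h2 : d < n
  · rw [h d (by omega) h2]
  · have : ∀ β : Composition n, d ∉ descentSet β := fun β hd => by
      rw [mem_descentSet] at hd; omega
    simp [this]

theorem exists_composition (D : ℕ → Prop) (n : ℕ) : ∃ β : Composition n,
    ∀ d, 0 < d → d < n → (d ∈ descentSet β ↔ D d) := by
  obtain ⟨L, hpos, hsum, h⟩ := exists_partialSums D n
  refine ⟨⟨L, fun hx => hpos _ hx, hsum⟩, fun d hd hn => ?_⟩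
  rw [mem_descentSet, ← h d hd hn]
  simp [hd, hn]

/-- `α` has the descents of a permutation that is obtained by inserting the letter `n + 1` at
position `l` (counted from `0`) into a permutation with descent composition `β`. -/
def IsInsertion (α : Composition (n + 1)) (β : Composition n) (l : ℕ) : Prop :=
  ∀ d, 0 < d → d < n + 1 →
    (d ∈ descentSet α ↔ (d < l ∧ d ∈ descentSet β) ∨ d = l + 1 ∨ (l + 1 < d ∧ d - 1 ∈ descentSet β))

/-- Inserting the largest letter at position l forgets a single bit of β, namely whether l is a
descent. -/
theorem IsInsertion.composition_eq {α : Composition (n + 1)} {β γ : Composition n} {l : ℕ}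
    (hβ : IsInsertion α β l) (hγ : IsInsertion α γ l)
    (h : 0 < l → l < n → (l ∈ descentSet β ↔ l ∈ descentSet γ)) : β = γ := by
  apply composition_ext
  intro d h0 hn
  rcases lt_trichotomy d l with hd | rfl | hd
  · have h1 := hβ d h0 (by omega)
    have h2 := hγ d h0 (by omega)
    have e1 : d ≠ l + 1 := by omega
    have e2 : ¬ l + 1 < d := by omega
    simp only [hd, e1, e2, true_and, false_and, or_false] at h1 h2
    rw [← h1, h2]
  · exact h h0 hn
  · have h1 := hβ (d + 1) (by omega) (by omega)
    have h2 := hγ (d + 1) (by omega) (by omega)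
    have e1 : ¬ d + 1 < l := by omega
    have e2 : d ≠ l := by omega
    simp only [hd, e1, e2, true_and, false_and, false_or, Nat.add_right_cancel_iff,
      Nat.add_lt_add_iff_right, Nat.add_sub_cancel] at h1 h2
    rw [← h1, h2]

variable {α : Composition (n + 1)}

/-- The position (counted from `0`) of the letter `n + 1` that belongs to a summand of the
branching rule. -/
def Branch.pos : Branch α → ℕ
  | .dec i _ _ => α.sizeUpTo (i + 1) - 1
  | .merge i _ _ => α.sizeUpTo (i + 1) - 1
  | .tail _ _ => 0

theorem sizeUpTo_succ_ge {i : ℕ} (hi : i < α.blocks.length) :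
    α.sizeUpTo (i + 1) = (α.blocks.take i).sum + α.blocks[i] := α.sizeUpTo_succ hi

theorem blocks_eq {i : ℕ} (hi : i < α.blocks.length) :
    α.blocks = α.blocks.take i ++ α.blocks[i] :: α.blocks.drop (i + 1) := by
  rw [← List.drop_eq_getElem_cons hi, List.take_append_drop]

theorem Branch.pos_lt (b : Branch α) : b.pos < n + 1 := by
  cases b with
  | dec i hi h =>
    have := α.sizeUpTo_le (i + 1)
    simp only [pos]; omega
  | merge i hi h =>
    have := α.sizeUpTo_le (i + 1)
    simp only [pos]; omega
  | tail h0 h => simp [pos]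

/-- The largest letter stands at the end of a run of α. If the run has more than one letter,
removing it leaves a descent at that place (`dec`) or joins the run to the next one (`merge`), so
both have the same position. A run of one letter ends in its only letter, which can be the largest
one only at the very beginning (`tail`). -/
theorem Branch.isInsertion (b : Branch α) : IsInsertion α b.comp b.pos := by
  cases b with
  | dec i hi h =>
    have hpos : pos (.dec i hi h) = (α.blocks.take i).sum + α.blocks[i] - 1 := by
      rw [← sizeUpTo_succ_ge]; rfl
    have hα := fun d => congrArg (fun L => d ∈ partialSums L) (blocks_eq hi)
    have hs := (congrArg List.sum (blocks_eq hi)).symm.trans α.blocks_sum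
    have hβ : (comp (.dec i hi h)).blocks =
        α.blocks.take i ++ (α.blocks[i] - 1) :: α.blocks.drop (i + 1) := rfl
    intro d h0 hd
    rw [mem_descentSet, mem_descentSet, mem_descentSet, hpos, hβ, hα]
    clear hα hβ hpos
    -- What remains is a comparison of the partial sums of A ++ a :: B and A ++ (a - 1) :: B.
    generalize α.blocks[i] = a at *
    generalize α.blocks.take i = A at *
    generalize α.blocks.drop (i + 1) = B at *
    simp only [List.sum_append, List.sum_cons] at hs
    simp only [mem_partialSums_append, mem_partialSums_cons]
    constructor
    · rintro ⟨h1 | ⟨e, rfl | ⟨e', he', rfl⟩, rfl⟩, -, -⟩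
      · have := le_sum_of_mem_partialSums h1
        exact Or.inl ⟨by omega, Or.inl h1, by omega, by omega⟩
      · exact Or.inl ⟨by omega, Or.inl (sum_mem_partialSums A), by omega, by omega⟩
      · rcases Nat.eq_zero_or_pos e' with rfl | h2
        · right; left; omega
        · right; right
          exact ⟨by omega, Or.inr ⟨a - 1 + e', Or.inr ⟨e', he', rfl⟩, by omega⟩, by omega, by omega⟩
    · rintro (⟨h1, h2 | ⟨e, rfl | ⟨e', he', rfl⟩, rfl⟩, h3, h4⟩ | h1 |
        ⟨h1, h2 | ⟨e, rfl | ⟨e', he', rfl⟩, h5⟩, h3, h4⟩)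
      · exact ⟨Or.inl h2, by omega, by omega⟩
      · exact ⟨Or.inl (sum_mem_partialSums A), by omega, by omega⟩
      · omega
      · exact ⟨Or.inr ⟨a, Or.inr ⟨0, zero_mem_partialSums B, rfl⟩, by omega⟩, by omega, by omega⟩
      · have := le_sum_of_mem_partialSums h2
        omega
      · omega
      · exact ⟨Or.inr ⟨a + e', Or.inr ⟨e', he', rfl⟩, by omega⟩, by omega, by omega⟩
  | merge i hi h =>
    have hi0 : i < α.blocks.length := Nat.lt_of_succ_lt hi
    have hpos : pos (.merge i hi h) = (α.blocks.take i).sum + α.blocks[i] - 1 := by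
      rw [← sizeUpTo_succ_ge]; rfl
    have hbl : α.blocks =
        α.blocks.take i ++ α.blocks[i] :: α.blocks[i + 1] :: α.blocks.drop (i + 2) := by
      rw [← List.drop_eq_getElem_cons hi]
      exact blocks_eq (Nat.lt_of_succ_lt hi)
    have hα := fun d => congrArg (fun L => d ∈ partialSums L) hbl
    have hs := (congrArg List.sum hbl).symm.trans α.blocks_sum
    have h1 : 1 < α.blocks[i] := h
    clear hbl
    have hβ : (comp (.merge i hi h)).blocks =
        α.blocks.take i ++ (α.blocks[i] + α.blocks[i + 1] - 1) :: α.blocks.drop (i + 2) := rfl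
    have hb : 0 < α.blocks[i + 1] := α.blocks_pos (List.getElem_mem hi)
    intro d h0 hd
    rw [mem_descentSet, mem_descentSet, mem_descentSet, hpos, hβ, hα]
    clear hα hβ hpos h
    generalize α.blocks[i] = a at *
    generalize α.blocks[i + 1] = b at *
    generalize α.blocks.take i = A at *
    generalize α.blocks.drop (i + 2) = B at *
    simp only [List.sum_append, List.sum_cons] at hs
    simp only [mem_partialSums_append, mem_partialSums_cons]
    constructor
    · rintro ⟨h1 | ⟨e, rfl | ⟨e', rfl | ⟨e'', he'', rfl⟩, rfl⟩, rfl⟩, -, -⟩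
      · have := le_sum_of_mem_partialSums h1
        exact Or.inl ⟨by omega, Or.inl h1, by omega, by omega⟩
      · exact Or.inl ⟨by omega, Or.inl (sum_mem_partialSums A), by omega, by omega⟩
      · right; left; omega
      · right; right
        exact ⟨by omega, Or.inr ⟨a + b - 1 + e'', Or.inr ⟨e'', he'', rfl⟩, by omega⟩, by omega,
          by omega⟩
    · rintro (⟨h1, h2 | ⟨e, rfl | ⟨e', he', rfl⟩, rfl⟩, h3, h4⟩ | h1 |
        ⟨h1, h2 | ⟨e, rfl | ⟨e', he', rfl⟩, h5⟩, h3, h4⟩)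
      · exact ⟨Or.inl h2, by omega, by omega⟩
      · exact ⟨Or.inl (sum_mem_partialSums A), by omega, by omega⟩
      · omega
      · exact ⟨Or.inr ⟨a, Or.inr ⟨0, Or.inl rfl, rfl⟩, by omega⟩, by omega, by omega⟩
      · have := le_sum_of_mem_partialSums h2
        omega
      · omega
      · exact ⟨Or.inr ⟨a + (b + e'), Or.inr ⟨b + e', Or.inr ⟨e', he', rfl⟩, rfl⟩, by omega⟩,
          by omega, by omega⟩
  | tail hl h =>
    have hα := blocks_eq hl
    have hβ : (comp (.tail hl h)).blocks = α.blocks.drop 1 := rfl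
    intro d h0 hd
    rw [mem_descentSet, mem_descentSet, mem_descentSet, hβ, hα, h]
    simp only [pos, List.take_zero, List.nil_append, mem_partialSums_cons, zero_add]
    constructor
    · rintro ⟨h1 | ⟨e, he, rfl⟩, -, -⟩
      · omega
      · rcases Nat.eq_zero_or_pos e with rfl | h2
        · right; left; omega
        · right; right
          rw [Nat.add_sub_cancel_left]
          exact ⟨by omega, he, by omega, by omega⟩
    · rintro (h1 | h1 | ⟨h1, h2, h3, h4⟩)
      · omega
      · exact ⟨Or.inr ⟨0, zero_mem_partialSums _, by omega⟩, by omega, by omega⟩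
      · exact ⟨Or.inr ⟨d - 1, h2, by omega⟩, by omega, by omega⟩

theorem sizeUpTo_succ_sub_one_pos {i : ℕ} (hi : i < α.blocks.length) (h : 1 < α.blocks[i]) :
    0 < α.sizeUpTo (i + 1) - 1 := by
  rw [sizeUpTo_succ_ge hi]; omega

theorem sizeUpTo_succ_sub_one_inj {i j : ℕ} (hi : i < α.blocks.length) (hj : j < α.blocks.length)
    (h : 1 < α.blocks[i]) (h' : 1 < α.blocks[j])
    (e : α.sizeUpTo (i + 1) - 1 = α.sizeUpTo (j + 1) - 1) : i = j := by
  have h1 := sizeUpTo_succ_sub_one_pos hi h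
  have h2 := sizeUpTo_succ_sub_one_pos hj h'
  have key : ∀ i j, j < α.blocks.length → α.sizeUpTo (i + 1) = α.sizeUpTo (j + 1) → ¬ i < j := by
    intro i j hj e hij
    have a := α.monotone_sizeUpTo (show i + 1 ≤ j by omega)
    have b := α.sizeUpTo_strict_mono hj
    omega
  have k1 := key i j hj (by omega)
  have k2 := key j i hi (by omega)
  omega

/-- The position fixes the index of the part; `dec` and `merge` at equal positions differ in the
number of parts, and only `tail` has position 0. -/
theorem Branch.ext_of_pos {b b' : Branch α} (hp : b.pos = b'.pos) (hc : b.comp = b'.comp) :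
    b = b' := by
  have aux : ∀ (i j : ℕ) (hi : i < α.blocks.length) (h : 1 < α.blocks[i])
      (hj : j + 1 < α.blocks.length) (h' : 1 < α.blocks[j]),
      decPart α i hi h ≠ mergePart α j hj h' := by
    intro i j hi h hj h' e
    have := congrArg (fun c => c.blocks.length) e
    simp [decPart, mergePart] at this
    omega
  cases b with
  | dec i hi h =>
    cases b' with
    | dec j hj h' =>
      obtain rfl := sizeUpTo_succ_sub_one_inj hi hj h h' hp
      rfl
    | merge j hj h' => exact absurd hc (aux i j hi h hj h')
    | tail h0 h' => exact absurd hp (sizeUpTo_succ_sub_one_pos hi h).ne'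
  | merge i hi h =>
    cases b' with
    | dec j hj h' => exact absurd hc.symm (aux j i hj h' hi h)
    | merge j hj h' =>
      obtain rfl := sizeUpTo_succ_sub_one_inj (by omega) (by omega) h h' hp
      rfl
    | tail h0 h' => exact absurd hp (sizeUpTo_succ_sub_one_pos (by omega) h).ne'
  | tail h0 h =>
    cases b' with
    | dec j hj h' => exact absurd hp (sizeUpTo_succ_sub_one_pos hj h').ne
    | merge j hj h' => exact absurd hp (sizeUpTo_succ_sub_one_pos (by omega) h').ne
    | tail h0' h' => rfl

theorem IsInsertion.exists_branch {β : Composition n} {l : ℕ} (hl : l < n + 1)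
    (h : IsInsertion α β l) : ∃ b : Branch α, b.comp = β ∧ b.pos = l := by
  have hs := α.blocks_sum
  rcases Nat.eq_zero_or_pos l with rfl | hl0
  · have hlen : 0 < α.blocks.length := by
      rcases Nat.eq_zero_or_pos α.blocks.length with h0 | h0
      · rw [List.length_eq_zero_iff] at h0; simp [h0] at hs
      · exact h0
    have h1 : α.blocks[0] = 1 := by
      have hp : 0 < α.blocks[0] := α.blocks_pos (List.getElem_mem hlen)
      have hα := blocks_eq hlen
      rcases Nat.eq_zero_or_pos n with rfl | hn
      · rw [hα] at hs; simp at hs; omega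
      · have := (h 1 (by omega) (by omega)).2 (Or.inr (Or.inl rfl))
        rw [mem_descentSet, hα] at this
        rcases this.1 with h2 | ⟨e, -, h2⟩ <;> omega
    exact ⟨.tail hlen h1, (Branch.isInsertion (.tail hlen h1)).composition_eq h
      (fun h0 => by simp [Branch.pos] at h0), rfl⟩
  · have hmem : l + 1 ∈ partialSums α.blocks := by
      rcases Nat.lt_or_ge l n with h1 | h1
      · exact (mem_descentSet.1 ((h (l + 1) (by omega) (by omega)).2 (Or.inr (Or.inl rfl)))).1
      · have := sum_mem_partialSums α.blocks
        rw [hs] at this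
        obtain rfl : l = n := by omega
        exact this
    obtain ⟨t, ht, hsum⟩ := mem_partialSums_iff_take.1 hmem
    obtain ⟨i, rfl⟩ : ∃ i, t = i + 1 := by
      cases t with
      | zero => simp at hsum
      | succ i => exact ⟨i, rfl⟩
    have hi : i < α.blocks.length := by omega
    have hsz : α.sizeUpTo (i + 1) = l + 1 := hsum
    have hsz' := sizeUpTo_succ_ge hi
    have hp : 0 < α.blocks[i] := α.blocks_pos (List.getElem_mem hi)
    -- A part 1 ending at l + 1 would make l a descent of α, and no clause of `IsInsertion` allows d
    -- = l.
    have h1 : 1 < α.blocks[i] := by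
      by_contra hcon
      have hl' : (α.blocks.take i).sum = l := by omega
      have hld : l ∈ descentSet α :=
        mem_descentSet.2 ⟨mem_partialSums_iff_take.2 ⟨i, by omega, hl'⟩, hl0, by omega⟩
      rcases (h l hl0 (by omega)).1 hld with h2 | h2 | h2 <;> omega
    -- This is the one bit that α and l leave open. For l = n the part is the last one, so there is
    -- nothing to merge with.
    by_cases hcase : l ∈ descentSet β ∨ l = n
    · refine ⟨.dec i hi h1, ?_, by simp [Branch.pos, hsz]⟩
      have hpos : Branch.pos (.dec i hi h1) = l := by simp [Branch.pos, hsz]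
      have := Branch.isInsertion (.dec i hi h1)
      rw [hpos] at this
      refine this.composition_eq h fun _ hln => iff_of_true ?_ (hcase.resolve_right (by omega))
      rw [mem_descentSet]
      refine ⟨?_, hl0, hln⟩
      change l ∈ partialSums (α.blocks.take i ++ (α.blocks[i] - 1) :: α.blocks.drop (i + 1))
      rw [mem_partialSums_append]
      exact Or.inr ⟨α.blocks[i] - 1, Or.inr ⟨0, zero_mem_partialSums _, rfl⟩, by omega⟩
    · push Not at hcase
      have hi' : i + 1 < α.blocks.length := by
        by_contra hcon
        have : α.sizeUpTo (i + 1) = n + 1 := by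
          rw [Composition.sizeUpTo, List.take_of_length_le (by omega), hs]
        omega
      refine ⟨.merge i hi' h1, ?_, by simp [Branch.pos, hsz]⟩
      have hpos : Branch.pos (.merge i hi' h1) = l := by simp [Branch.pos, hsz]
      have := Branch.isInsertion (.merge i hi' h1)
      rw [hpos] at this
      refine this.composition_eq h fun _ hln => iff_of_false ?_ hcase.1
      rw [mem_descentSet]
      rintro ⟨h2, -, -⟩
      change l ∈ partialSums (α.blocks.take i ++ (α.blocks[i] + α.blocks[i + 1] - 1) ::
        α.blocks.drop (i + 2)) at h2
      have hb : 0 < α.blocks[i + 1] := α.blocks_pos (List.getElem_mem hi')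
      rw [mem_partialSums_append] at h2
      rcases h2 with h2 | ⟨e, h2 | ⟨e', -, h2⟩, h3⟩
      · have := le_sum_of_mem_partialSums h2
        omega
      · omega
      · omega

instance : Finite (Branch α) :=
  Finite.of_injective (fun b : Branch α => (b.comp, (⟨b.pos, b.pos_lt⟩ : Fin (n + 1)))) (by
    intro b b' h
    simp only [Prod.mk.injEq, Fin.mk.injEq] at h
    exact Branch.ext_of_pos h.2 h.1)

end Descents

/-! ### The simple modules of the 0-Hecke algebra -/

section SimpleModules

variable {k : Type u} [Field k] {n : ℕ}

instance (α : Composition n) : Module k (SimpleMod k α) := inferInstanceAs (Module k k)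

/-- The simple module `S_α` is the field with the action through a character. -/
def SimpleMod.val (α : Composition n) : SimpleMod k α ≃ₗ[k] k := LinearEquiv.refl k k

theorem SimpleMod.val_smul {α : Composition n} (h : Hecke k n) (x : SimpleMod k α) :
    SimpleMod.val α (h • x) = simpleChar k α h * SimpleMod.val α x := rfl

instance (α : Composition n) : IsScalarTower k (Hecke k n) (SimpleMod k α) where
  smul_assoc r h x := by
    apply (SimpleMod.val α).injective
    rw [SimpleMod.val_smul, map_smul, map_smul, SimpleMod.val_smul, smul_mul_assoc]

theorem SimpleMod.smul_eq {α : Composition n} (h : Hecke k n) (x : SimpleMod k α) :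
    h • x = simpleChar k α h • x := rfl

instance (α : Composition n) : IsSimpleModule (Hecke k n) (SimpleMod k α) := by
  rw [isSimpleModule_iff_toSpanSingleton_surjective]
  refine ⟨inferInstanceAs (Nontrivial k), fun x hx y => ?_⟩
  refine ⟨algebraMap k _ (SimpleMod.val α y / SimpleMod.val α x), ?_⟩
  rw [LinearMap.toSpanSingleton_apply, algebraMap_smul]
  apply (SimpleMod.val α).injective
  have : SimpleMod.val α x ≠ 0 := by simpa using hx
  rw [map_smul, smul_eq_mul, div_mul_cancel₀ _ this]

theorem simpleChar_injective : Function.Injective (simpleChar k (n := n)) := by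
  intro α β h
  apply composition_ext
  intro d h0 hn
  obtain ⟨i, rfl⟩ : ∃ i, d = i + 1 := ⟨d - 1, by omega⟩
  have h1 := congrArg (fun f => f (Hecke.T k n i)) h
  by_cases ha : i + 1 ∈ descentSet α <;> by_cases hb : i + 1 ∈ descentSet β
  · simp [ha, hb]
  · simp [simpleChar_T_mem hn ha, simpleChar_T_not_mem hb] at h1
  · simp [simpleChar_T_mem hn hb, simpleChar_T_not_mem ha] at h1
  · simp [ha, hb]

variable {X : Type*} [AddCommGroup X] [Module (Hecke k n) X]

/-- A simple module over the 0-Hecke algebra is isomorphic to some `S_α`. -/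
theorem exists_equiv_simpleMod [IsSimpleModule (Hecke k n) X] :
    ∃ α : Composition n, Nonempty (X ≃ₗ[Hecke k n] SimpleMod k α) := by
  let _ : Module k X := Module.compHom X (algebraMap k (Hecke k n))
  have : IsScalarTower k (Hecke k n) X := ⟨fun r h x => by
    rw [Algebra.smul_def, mul_smul]; rfl⟩
  have : Nontrivial X := IsSimpleModule.nontrivial (Hecke k n) X
  obtain ⟨v, hv, hev⟩ := (Hecke.isBraid (k := k) (n := n)).exists_eigenvector Hecke.T_mul_self
    (V := X) n
  -- The descents are the places with eigenvalue -1; the shift `d - 1` translates descents into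
  -- 0-based generators.
  obtain ⟨α, hα⟩ := exists_composition (fun d => Hecke.T k n (d - 1) • v = -v) n
  refine ⟨α, ?_⟩
  let f : SimpleMod k α →ₗ[k] X := (LinearMap.toSpanSingleton k X v) ∘ₗ (SimpleMod.val α).toLinearMap
  have hf : ∀ x, f x = SimpleMod.val α x • v := fun x => rfl
  have hT : ∀ i, i + 1 < n → Hecke.T k n i • v = simpleChar k α (Hecke.T k n i) • v := by
    intro i hi
    have h1 := hα (i + 1) (by omega) hi
    rw [Nat.add_sub_cancel] at h1
    by_cases h2 : i + 1 ∈ descentSet α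
    · rw [simpleChar_T_mem hi h2, h1.1 h2, neg_one_smul]
    · rw [simpleChar_T_not_mem h2, zero_smul]
      exact (hev i (by omega)).resolve_right fun h => h2 (h1.2 h)
  let g : SimpleMod k α →ₗ[Hecke k n] X :=
    { f with
      map_smul' := fun a x => Hecke.map_smul_of_T f (fun i hi x => by
        rw [hf, hf, SimpleMod.val_smul, smul_comm, hT i hi, ← mul_smul, mul_comm]) a x }
  have hg : g ≠ 0 := by
    intro h0
    have : g ((SimpleMod.val α).symm 1) = 0 := by rw [h0]; rfl
    apply hv
    have h2 : g ((SimpleMod.val α).symm 1) = v := by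
      change f _ = v
      rw [hf, LinearEquiv.apply_symm_apply, one_smul]
    rw [← h2, this]
  exact ⟨(LinearEquiv.ofBijective g (g.bijective_or_eq_zero.resolve_right hg)).symm⟩

theorem exists_simple_quotient [Module.Finite (Hecke k n) X] {N : Submodule (Hecke k n) X}
    (hN : N ≠ ⊤) :
    ∃ (α : Composition n) (f : X →ₗ[Hecke k n] SimpleMod k α), f ≠ 0 ∧ N ≤ LinearMap.ker f := by
  obtain ⟨m, hm, hNm⟩ := (eq_top_or_exists_le_coatom N).resolve_left hN
  have : IsSimpleModule (Hecke k n) (X ⧸ m) := isSimpleModule_iff_isCoatom.2 hm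
  obtain ⟨α, ⟨e⟩⟩ := exists_equiv_simpleMod (k := k) (n := n) (X := X ⧸ m)
  have hker : LinearMap.ker (e.toLinearMap ∘ₗ m.mkQ) = m := by
    rw [LinearEquiv.ker_comp, Submodule.ker_mkQ]
  refine ⟨α, e.toLinearMap ∘ₗ m.mkQ, fun h => hm.1 ?_, ?_⟩
  · rw [← hker, h, LinearMap.ker_zero]
  · rw [hker]; exact hNm

/-- A submodule that is killed by all maps to simple modules is superfluous. -/
theorem eq_top_of_sup_eq_top [Module.Finite (Hecke k n) X] {N K : Submodule (Hecke k n) X}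
    (hK : ∀ (α : Composition n) (f : X →ₗ[Hecke k n] SimpleMod k α), K ≤ LinearMap.ker f)
    (h : N ⊔ K = ⊤) : N = ⊤ := by
  by_contra hN
  obtain ⟨α, f, hf, hNf⟩ := exists_simple_quotient hN
  apply hf
  rw [← LinearMap.ker_eq_top, eq_top_iff, ← h]
  exact sup_le hNf (hK α f)

end SimpleModules

/-! ### Projective covers of the simple modules -/

section Covers

variable {k : Type u} [Field k] {n : ℕ}
variable {P : Type*} [AddCommGroup P] [Module (Hecke k n) P]
variable {α : Composition n} {p : P →ₗ[Hecke k n] SimpleMod k α}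

/-- Since S_α is one-dimensional, v and the kernel of p generate P, and the kernel is superfluous.
-/
theorem IsProjectiveCover.span_eq_top (hp : IsProjectiveCover p) {v : P} (hv : p v ≠ 0) :
    Submodule.span (Hecke k n) {v} = ⊤ := by
  apply hp.2.2
  rw [eq_top_iff]
  rintro x -
  let r := SimpleMod.val α (p x) / SimpleMod.val α (p v)
  have hr : p x = algebraMap k (Hecke k n) r • p v := by
    apply (SimpleMod.val α).injective
    have : SimpleMod.val α (p v) ≠ 0 := by simpa using hv
    rw [algebraMap_smul, map_smul, smul_eq_mul, div_mul_cancel₀ _ this]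
  rw [Submodule.mem_sup]
  refine ⟨algebraMap k (Hecke k n) r • v, Submodule.smul_mem _ _ (Submodule.mem_span_singleton_self v),
    x - algebraMap k (Hecke k n) r • v, ?_, by abel⟩
  rw [LinearMap.mem_ker, map_sub, map_smul, hr, sub_self]

theorem IsProjectiveCover.exists_val_eq_one (hp : IsProjectiveCover p) :
    ∃ v, SimpleMod.val α (p v) = 1 := by
  obtain ⟨v, hv⟩ := hp.2.1 ((SimpleMod.val α).symm 1)
  exact ⟨v, by rw [hv, LinearEquiv.apply_symm_apply]⟩

theorem IsProjectiveCover.finite (hp : IsProjectiveCover p) : Module.Finite (Hecke k n) P := by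
  obtain ⟨v, hv⟩ := hp.exists_val_eq_one
  refine ⟨⟨{v}, ?_⟩⟩
  rw [Finset.coe_singleton]
  exact hp.span_eq_top fun h => by simp [h] at hv

/-- Maps from the projective cover of `S_α` to a simple module are multiples of the covering map. -/
theorem IsProjectiveCover.hom_eq (hp : IsProjectiveCover p) {γ : Composition n}
    (f : P →ₗ[Hecke k n] SimpleMod k γ) (hf : f ≠ 0) :
    γ = α ∧ ∃ c : k, ∀ x, SimpleMod.val γ (f x) = c * SimpleMod.val α (p x) := by
  -- The kernel of f is maximal. If it did not contain the superfluous kernel of p, the two would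
  -- span P, and f would be zero.
  have hker : LinearMap.ker p ≤ LinearMap.ker f := by
    have hmax : IsCoatom (LinearMap.ker f) := LinearMap.isCoatom_ker_of_surjective
      (f.surjective_or_eq_zero.resolve_right hf)
    by_contra hle
    apply hf
    rw [← LinearMap.ker_eq_top]
    apply hp.2.2
    exact hmax.2 _ (lt_of_le_of_ne le_sup_left fun h => hle (h ▸ le_sup_right))
  obtain ⟨v, hv⟩ := hp.exists_val_eq_one
  have key : ∀ x, SimpleMod.val γ (f x) = SimpleMod.val γ (f v) * SimpleMod.val α (p x) := by
    intro x
    have h1 : x - algebraMap k (Hecke k n) (SimpleMod.val α (p x)) • v ∈ LinearMap.ker p := by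
      rw [LinearMap.mem_ker, map_sub, map_smul, algebraMap_smul]
      apply (SimpleMod.val α).injective
      rw [map_sub, map_smul, hv, smul_eq_mul, mul_one, sub_self, map_zero]
    have h2 := hker h1
    rw [LinearMap.mem_ker, map_sub, map_smul, algebraMap_smul, sub_eq_zero] at h2
    rw [h2, map_smul, smul_eq_mul, mul_comm]
  refine ⟨?_, _, key⟩
  have hc : SimpleMod.val γ (f v) ≠ 0 := by
    intro h0
    apply hf
    ext x
    apply (SimpleMod.val γ).injective
    rw [key x, h0, zero_mul, LinearMap.zero_apply, map_zero]
  apply simpleChar_injective (k := k)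
  ext h
  have h1 := key (h • v)
  rw [f.map_smul, p.map_smul, SimpleMod.val_smul, SimpleMod.val_smul, hv, mul_one, mul_comm] at h1
  exact mul_left_cancel₀ hc h1

variable {Q : Composition n → Type*} [∀ β, AddCommGroup (Q β)] [∀ β, Module (Hecke k n) (Q β)]

/-- A finitely generated projective module is the direct sum of the projective covers of a family
of simple quotients that is independent and that detects all maps to simple modules. -/
theorem exists_equiv_directSum_covers {q : ∀ β, Q β →ₗ[Hecke k n] SimpleMod k β}
    (hq : ∀ β, IsProjectiveCover (q β))
    {X : Type*} [AddCommGroup X] [Module (Hecke k n) X] [Module.Finite (Hecke k n) X]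
    [Module.Projective (Hecke k n) X] {B : Type*} [Fintype B] (β : B → Composition n)
    (π : ∀ b, X →ₗ[Hecke k n] SimpleMod k (β b))
    (hspan : ∀ (γ : Composition n) (f : X →ₗ[Hecke k n] SimpleMod k γ) (x : X), (∀ b, π b x = 0) → f x = 0)
    (hind : ∀ (γ : Composition n) (c : B → k), (∀ b, c b ≠ 0 → β b = γ) →
      (∀ x, ∑ b, c b * SimpleMod.val (β b) (π b x) = 0) → c = 0) :
    Nonempty (X ≃ₗ[Hecke k n] ⨁ b, Q (β b)) := by
  classical
  have : ∀ β, Module.Finite (Hecke k n) (Q β) := fun β => (hq β).finite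
  have : ∀ β, Module.Projective (Hecke k n) (Q β) := fun β => (hq β).1
  let S := ∀ b, SimpleMod k (β b)
  let πS : X →ₗ[Hecke k n] S := LinearMap.pi π
  have hkerπ : ∀ x, x ∈ LinearMap.ker πS ↔ ∀ b, π b x = 0 := fun x => by
    rw [LinearMap.mem_ker]; exact funext_iff
  -- Otherwise some nonzero map from the sum of simple modules to a simple S_γ kills the image. Its
  -- coefficients give a linear relation between the π b, and equivariance confines them to those b
  -- with β b = γ, against `hind`.
  have hπS : Function.Surjective πS := by
    rw [← LinearMap.range_eq_top]
    by_contra hne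
    obtain ⟨γ, f, hf, hle⟩ := exists_simple_quotient hne
    let c : B → k := fun b =>
      SimpleMod.val γ (f (Pi.single b ((SimpleMod.val (β b)).symm 1)))
    have hfc : ∀ y : S, SimpleMod.val γ (f y) = ∑ b, c b * SimpleMod.val (β b) (y b) := by
      intro y
      conv_lhs => rw [← Finset.univ_sum_single y]
      rw [map_sum, map_sum]
      refine Finset.sum_congr rfl fun b _ => ?_
      have : (Pi.single b (y b) : S) = algebraMap k (Hecke k n) (SimpleMod.val (β b) (y b)) •
          (Pi.single b ((SimpleMod.val (β b)).symm 1) : S) := by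
        rw [← Pi.single_smul, algebraMap_smul, ← map_smul, smul_eq_mul, mul_one,
          LinearEquiv.symm_apply_apply]
      rw [this, map_smul, algebraMap_smul, map_smul, smul_eq_mul, mul_comm]
    have hc0 : c = 0 := by
      apply hind γ c
      · intro b hb
        apply simpleChar_injective (k := k)
        ext h
        have h1 : SimpleMod.val γ (f (h • (Pi.single b ((SimpleMod.val (β b)).symm 1) : S))) =
            simpleChar k γ h * c b := by
          rw [map_smul, SimpleMod.val_smul]
        rw [← Pi.single_smul, SimpleMod.smul_eq, ← map_smul, smul_eq_mul, mul_one, hfc,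
          Finset.sum_eq_single b, Pi.single_eq_same, LinearEquiv.apply_symm_apply, mul_comm] at h1
        · exact mul_right_cancel₀ hb h1
        · intro b' _ hb'
          rw [Pi.single_eq_of_ne hb', map_zero, mul_zero]
        · simp
      · intro x
        have : f (πS x) = 0 := hle ⟨x, rfl⟩
        rw [← map_zero (SimpleMod.val γ), ← this, hfc]
        rfl
    apply hf
    refine LinearMap.ext fun y => ?_
    apply (SimpleMod.val γ).injective
    rw [hfc, hc0]
    simp
  let qS : (⨁ b, Q (β b)) →ₗ[Hecke k n] S :=
    LinearMap.pi fun b => q (β b) ∘ₗ DirectSum.component (Hecke k n) B (fun b => Q (β b)) b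
  have hqS : Function.Surjective qS := by
    intro y
    choose x hx using fun b => (hq (β b)).2.1 (y b)
    refine ⟨(DirectSum.linearEquivFunOnFintype (Hecke k n) B fun b => Q (β b)).symm x, ?_⟩
    funext b
    have : qS ((DirectSum.linearEquivFunOnFintype (Hecke k n) B fun b => Q (β b)).symm x) b =
      q (β b) ((DirectSum.linearEquivFunOnFintype (Hecke k n) B fun b => Q (β b))
        ((DirectSum.linearEquivFunOnFintype (Hecke k n) B fun b => Q (β b)).symm x) b) := rfl
    rw [this, LinearEquiv.apply_symm_apply, hx]
  -- On each summand a map to a simple module is a multiple of the covering map, so the kernel of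
  -- `qS` is superfluous.
  have hkerq : ∀ (γ : Composition n) (f : (⨁ b, Q (β b)) →ₗ[Hecke k n] SimpleMod k γ),
      LinearMap.ker qS ≤ LinearMap.ker f := by
    intro γ f y hy
    rw [LinearMap.mem_ker] at hy ⊢
    have hy' : ∀ b, q (β b) (y b) = 0 := fun b => congrFun hy b
    rw [← DirectSum.sum_support_of y, map_sum]
    refine Finset.sum_eq_zero fun b _ => ?_
    let g := f ∘ₗ DirectSum.lof (Hecke k n) B (fun b => Q (β b)) b
    change g (y b) = 0
    by_cases hg : g = 0
    · rw [hg, LinearMap.zero_apply]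
    · obtain ⟨-, c, hc⟩ := (hq (β b)).hom_eq g hg
      apply (SimpleMod.val γ).injective
      rw [hc, hy', map_zero, mul_zero, map_zero]
  -- Uniqueness of projective covers: both `πS` and `qS` are surjective with superfluous kernel. A
  -- lift f of `πS` is therefore onto, it splits because the target is projective, and its section s
  -- is onto for the same reason as f.
  obtain ⟨f, hf⟩ := Module.projective_lifting_property qS πS hqS
  have hfsurj : Function.Surjective f := by
    rw [← LinearMap.range_eq_top]
    apply eq_top_of_sup_eq_top hkerq
    rw [eq_top_iff]
    rintro y -
    obtain ⟨x, hx⟩ := hπS (qS y)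
    refine Submodule.mem_sup.2 ⟨f x, ⟨x, rfl⟩, y - f x, ?_, by abel⟩
    rw [LinearMap.mem_ker, map_sub, ← LinearMap.comp_apply, hf, hx, sub_self]
  obtain ⟨s, hs⟩ := Module.projective_lifting_property f LinearMap.id hfsurj
  have hssurj : Function.Surjective s := by
    rw [← LinearMap.range_eq_top]
    apply eq_top_of_sup_eq_top (K := LinearMap.ker πS)
    · intro γ g x hx
      exact hspan γ g x ((hkerπ x).1 hx)
    · rw [eq_top_iff]
      rintro x -
      refine Submodule.mem_sup.2 ⟨s (f x), ⟨f x, rfl⟩, x - s (f x), ?_, by abel⟩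
      rw [LinearMap.mem_ker, map_sub, sub_eq_zero, ← hf, LinearMap.comp_apply,
        LinearMap.comp_apply]
      congr 1
      exact (LinearMap.congr_fun hs (f x)).symm
  have hsinj : Function.Injective s := by
    apply Function.LeftInverse.injective (g := f)
    exact LinearMap.congr_fun hs
  exact ⟨(LinearEquiv.ofBijective s ⟨hsinj, hssurj⟩).symm⟩

end Covers

/-! ### Coinduction from `H_n(0)` to `H_{n+1}(0)` -/

section CoInd

variable (k : Type u) [Field k] (n : ℕ)

/-- The coinduced module `Hom_{H_n(0)}(H_{n+1}(0), V)`, where a homomorphism is given by its values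
at the elements `T_{n-1} ⋯ T_j` for `j = 0, …, n`. -/
def CoInd (_k : Type u) (n : ℕ) (V : Type v) : Type v := Fin (n + 1) → V

variable (V : Type v) [AddCommGroup V] [Module k V]

instance : AddCommGroup (CoInd k n V) := inferInstanceAs (AddCommGroup (Fin (n + 1) → V))
instance : Module k (CoInd k n V) := inferInstanceAs (Module k (Fin (n + 1) → V))

variable {k n V}

/-- The value at `T_{n-1} ⋯ T_j`. -/
def CoInd.ev (j : Fin (n + 1)) : CoInd k n V →ₗ[k] V := LinearMap.proj j

/-- The element of the coinduced module with given values. -/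
def CoInd.ofValues (k : Type u) {n : ℕ} {V : Type v} (x : Fin (n + 1) → V) : CoInd k n V := x

@[simp] theorem CoInd.ev_ofValues (x : Fin (n + 1) → V) (j : Fin (n + 1)) :
    ev j (ofValues k x) = x j := rfl

theorem CoInd.ext {f g : CoInd k n V} (h : ∀ j, ev j f = ev j g) : f = g := funext h

/-- The linear map to the coinduced module with given components. -/
def CoInd.pi {W : Type*} [AddCommGroup W] [Module k W] (g : Fin (n + 1) → W →ₗ[k] V) :
    W →ₗ[k] CoInd k n V := LinearMap.pi g

@[simp] theorem CoInd.ev_pi {W : Type*} [AddCommGroup W] [Module k W]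
    (g : Fin (n + 1) → W →ₗ[k] V) (x : W) (j : Fin (n + 1)) : ev j (pi g x) = g j x := rfl

variable [Module (Hecke k n) V] [IsScalarTower k (Hecke k n) V]

variable (k) in
/-- The action of `T_i` on the coinduced module. -/
def CoInd.op (i : ℕ) : Module.End k (CoInd k n V) :=
  CoInd.pi fun j =>
    -- The value of T_i f at w is f(w T_i). The four cases are the rewritings of T_{n-1} ⋯ T_j T_i
    -- in `Hecke.coset_mul_of_lt`, `Hecke.coset_mul_of_eq`, `Hecke.coset_mul_of_eq_succ` and
    -- `Hecke.coset_mul_of_gt`.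
    if j.1 < i then Module.toModuleEnd k V (Hecke.T k n (i - 1)) ∘ₗ ev j
    else if j.1 = i then -ev j
    else if j.1 = i + 1 then ev ⟨j.1 - 1, by omega⟩
    else Module.toModuleEnd k V (Hecke.T k n i) ∘ₗ ev j

theorem CoInd.op_of_lt {i : ℕ} {j : Fin (n + 1)} (h : j.1 < i) (f : CoInd k n V) :
    ev j (op k i f) = Hecke.T k n (i - 1) • ev j f := by
  rw [op, ev_pi, if_pos h]; rfl

theorem CoInd.op_of_eq {i : ℕ} {j : Fin (n + 1)} (h : j.1 = i) (f : CoInd k n V) :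
    ev j (op k i f) = -ev j f := by
  rw [op, ev_pi, if_neg (by omega), if_pos h]; rfl

theorem CoInd.op_of_eq_succ {i : ℕ} {j : Fin (n + 1)} (h : j.1 = i + 1) (f : CoInd k n V) :
    ev j (op k i f) = ev ⟨i, by omega⟩ f := by
  rw [op, ev_pi, if_neg (by omega), if_neg (by omega), if_pos h]
  congr 2; ext; simp [h]

theorem CoInd.op_of_gt {i : ℕ} {j : Fin (n + 1)} (h : i + 1 < j.1) (f : CoInd k n V) :
    ev j (op k i f) = Hecke.T k n i • ev j f := by
  rw [op, ev_pi, if_neg (by omega), if_neg (by omega), if_neg (by omega)]; rfl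

theorem CoInd.op_sq (i : ℕ) : op k i * op k i = -op k (n := n) (V := V) i := by
  refine LinearMap.ext fun f => CoInd.ext fun j => ?_
  rw [Module.End.mul_apply, LinearMap.neg_apply, map_neg]
  rcases lt_trichotomy j.1 i with h | h | h
  · rw [op_of_lt h, op_of_lt h, ← mul_smul, Hecke.T_mul_self, neg_smul]
  · rw [op_of_eq h, op_of_eq h]
  · rcases Nat.eq_or_lt_of_le (Nat.succ_le_of_lt h) with h' | h'
    · rw [op_of_eq_succ h'.symm, op_of_eq_succ h'.symm, op_of_eq rfl]
    · rw [op_of_gt h', op_of_gt h', ← mul_smul, Hecke.T_mul_self, neg_smul]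

theorem CoInd.op_comm (i l : ℕ) (hil : i + 1 < l) :
    op k i * op k l = op k l * op k (n := n) (V := V) i := by
  refine LinearMap.ext fun f => CoInd.ext fun j => ?_
  rw [Module.End.mul_apply, Module.End.mul_apply]
  rcases lt_trichotomy j.1 i with h | h | h
  · rw [op_of_lt h, op_of_lt (i := l) (by omega), op_of_lt (i := l) (by omega), op_of_lt h,
      ← mul_smul, ← mul_smul, Hecke.isBraid.comm (i - 1) (l - 1) (by omega)]
  · rw [op_of_eq h, op_of_lt (i := l) (by omega), op_of_lt (i := l) (by omega), op_of_eq h,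
      smul_neg]
  · rcases Nat.eq_or_lt_of_le (Nat.succ_le_of_lt h) with h' | h'
    · rw [op_of_eq_succ h'.symm, op_of_lt (by change i < l; omega),
        op_of_lt (i := l) (by omega), op_of_eq_succ h'.symm]
    · rw [op_of_gt h']
      rcases lt_trichotomy j.1 l with h2 | h2 | h2
      · rw [op_of_lt h2, op_of_lt h2, op_of_gt h', ← mul_smul, ← mul_smul,
          Hecke.isBraid.comm i (l - 1) (by omega)]
      · rw [op_of_eq h2, op_of_eq h2, op_of_gt h', smul_neg]
      · rcases Nat.eq_or_lt_of_le (Nat.succ_le_of_lt h2) with h3 | h3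
        · rw [op_of_eq_succ h3.symm, op_of_eq_succ h3.symm, op_of_gt (by exact hil)]
        · rw [op_of_gt h3, op_of_gt h3, op_of_gt h', ← mul_smul, ← mul_smul,
            Hecke.isBraid.comm i l hil]

/-- Position by position: away from i, i + 1, i + 2 this is a braid relation of H_n, at i it is the
quadratic relation of T_i, and at i + 1 and i + 2 both sides reduce to T_i applied to the value at
i, up to a common sign. -/
theorem CoInd.op_braid (i : ℕ) :
    op k i * op k (i + 1) * op k i = op k (i + 1) * op k i * op k (n := n) (V := V) (i + 1) := by
  refine LinearMap.ext fun f => CoInd.ext fun j => ?_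
  simp only [Module.End.mul_apply]
  rcases lt_trichotomy j.1 i with h | h | h
  · have h1 : j.1 < i + 1 := by omega
    obtain ⟨m, rfl⟩ : ∃ m, i = m + 1 := ⟨i - 1, by omega⟩
    simp only [op_of_lt h, op_of_lt h1, ← mul_smul, ← mul_assoc, Nat.add_sub_cancel]
    rw [Hecke.isBraid.braid m]
  · have h1 : j.1 < i + 1 := by omega
    simp only [op_of_eq h, op_of_lt h1, ← mul_smul, Nat.add_sub_cancel, smul_neg, neg_neg,
      Hecke.T_mul_self, neg_smul]
  · rcases Nat.eq_or_lt_of_le (Nat.succ_le_of_lt h) with h' | h'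
    · have h1 : j.1 = i + 1 := h'.symm
      have h2 : ((⟨i, by omega⟩ : Fin (n + 1)) : ℕ) < i + 1 := Nat.lt_succ_self i
      simp only [op_of_eq_succ h1, op_of_eq h1, op_of_lt h2, op_of_eq (j := (⟨i, by omega⟩ : Fin (n + 1))) rfl, smul_neg,
        Nat.add_sub_cancel]
    · rcases Nat.eq_or_lt_of_le (Nat.succ_le_of_lt h') with h3 | h3
      · have h1 : j.1 = i + 1 + 1 := h3.symm
        have h2 : ((⟨i + 1, by omega⟩ : Fin (n + 1)) : ℕ) = i + 1 := rfl
        have h4 : i + 1 < j.1 := h'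
        simp only [op_of_eq_succ h1, op_of_gt h4, op_of_eq_succ h2]
        rw [op_of_lt (Nat.lt_succ_self i), Nat.add_sub_cancel]
      · have h4 : i + 1 < j.1 := h'
        have h5 : i + 1 + 1 < j.1 := h3
        simp only [op_of_gt h4, op_of_gt h5, ← mul_smul, ← mul_assoc]
        rw [Hecke.isBraid.braid i]

variable (k) in
/-- The action of `H_{n+1}(0)` on the coinduced module. -/
def CoInd.action : Hecke k (n + 1) →ₐ[k] Module.End k (CoInd k n V) :=
  Hecke.lift (n + 1) (op k) (fun i _ => op_sq i) (fun i j h _ => op_comm i j h)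
    (fun i _ => op_braid i)

instance : Module (Hecke k (n + 1)) (CoInd k n V) :=
  Module.compHom (CoInd k n V) (CoInd.action k (n := n) (V := V)).toRingHom

theorem CoInd.smul_def (h : Hecke k (n + 1)) (f : CoInd k n V) : h • f = action k h f := rfl

theorem CoInd.T_smul {i : ℕ} (hi : i < n) (f : CoInd k n V) :
    Hecke.T k (n + 1) i • f = op k i f := by
  rw [smul_def, action, Hecke.lift_T (by omega)]

instance : IsScalarTower k (Hecke k (n + 1)) (CoInd k n V) where
  smul_assoc r h x := by rw [CoInd.smul_def, map_smul]; rfl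

/-- The value at the unit element. -/
def CoInd.last : CoInd k n V →ₗ[k] V := ev (Fin.last n)

theorem CoInd.last_apply (f : CoInd k n V) : last f = ev (Fin.last n) f := rfl

/-- Evaluation at the unit is the counit of the adjunction between restriction and coinduction. -/
theorem CoInd.last_tower_smul (h : Hecke k n) (f : CoInd k n V) :
    last (heckeTower k n h • f) = h • last f := by
  have ha : h ∈ Algebra.adjoin k {x | ∃ i, i + 1 < n ∧ Hecke.T k n i = x} := by
    rw [Hecke.adjoin_T]; trivial
  induction ha using Algebra.adjoin_induction generalizing f with
  | mem a ha =>
    obtain ⟨i, hi, rfl⟩ := ha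
    rw [heckeTower_T hi, T_smul (by omega), last_apply, op_of_gt (by simpa using hi), last_apply]
  | algebraMap r => rw [AlgHom.commutes, algebraMap_smul, algebraMap_smul, map_smul]
  | add a b _ _ ha hb => rw [map_add, add_smul, map_add, add_smul, ha, hb]
  | mul a b _ _ ha hb => rw [map_mul, mul_smul, mul_smul, ha, hb]

/-- The element `T_{n-1} ⋯ T_j` of `H_{n+1}(0)`. -/
def Hecke.coset (k : Type u) [Field k] (n j : ℕ) : Hecke k (n + 1) :=
  desc (Hecke.T k (n + 1)) j (n - j)

theorem Hecke.coset_last : Hecke.coset k n n = 1 := by simp [coset]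

theorem Hecke.coset_mul_of_lt {i j : ℕ} (h : j < i) (hi : i < n) :
    coset k n j * T k (n + 1) i = T k (n + 1) (i - 1) * coset k n j := by
  obtain ⟨m, rfl⟩ : ∃ m, i = m + 1 := ⟨i - 1, by omega⟩
  exact isBraid.desc_mul (by omega) (by omega)

theorem Hecke.coset_mul_of_eq {i : ℕ} (hi : i < n) :
    coset k n i * T k (n + 1) i = -coset k n i := by
  obtain ⟨l, hl⟩ : ∃ l, n - i = l + 1 := ⟨n - i - 1, by omega⟩
  rw [coset, hl, desc_succ_right, mul_assoc, T_mul_self, mul_neg]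

theorem Hecke.coset_mul_of_eq_succ {i : ℕ} (hi : i < n) :
    coset k n (i + 1) * T k (n + 1) i = coset k n i := by
  rw [coset, coset, show n - i = n - (i + 1) + 1 by omega, desc_succ_right]

theorem Hecke.coset_mul_of_gt {i j : ℕ} (h : i + 1 < j) :
    coset k n j * T k (n + 1) i = T k (n + 1) i * coset k n j := isBraid.desc_mul_of_lt h

/-- Justifies reading `ev j` as the value at T_{n-1} ⋯ T_j: each further factor T_j shifts the place
of evaluation from j + 1 to j. -/
theorem CoInd.coset_smul (f : CoInd k n V) (j : Fin (n + 1)) :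
    last (Hecke.coset k n j • f) = ev j f := by
  obtain ⟨j, hj⟩ := j
  change last (Hecke.coset k n j • f) = _
  induction h : n - j generalizing j f with
  | zero =>
    obtain rfl : j = n := by omega
    rw [Hecke.coset_last, one_smul]; rfl
  | succ l ih =>
    rw [← Hecke.coset_mul_of_eq_succ (by omega), mul_smul, ih _ _ (by omega) (by omega),
      T_smul (by omega), op_of_eq_succ rfl]

end CoInd

section Restriction

variable {k : Type u} [Field k] {n : ℕ}

instance {B A : Type u} [Ring B] [Ring A] [Algebra k B] [Algebra k A] (f : B →ₐ[k] A)
    (M : Type v) [AddCommGroup M] [Module k M] [Module A M] [IsScalarTower k A M] :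
    IsScalarTower k B (Res f M) where
  smul_assoc r b x := by
    change (show M from _) = _
    exact (congrArg (· • (show M from x)) (map_smul f r b)).trans (smul_assoc r (f b) (show M from x))

variable {P : Type*} [AddCommGroup P] [Module k P] [Module (Hecke k (n + 1)) P]
  [IsScalarTower k (Hecke k (n + 1)) P]

/-- The identity map to the restricted module. -/
def Res.mk {B A : Type u} [Ring B] [Ring A] [Algebra k B] [Algebra k A] (f : B →ₐ[k] A)
    (M : Type v) [AddCommGroup M] [Module k M] : M ≃ₗ[k] Res f M := LinearEquiv.refl k M

theorem Res.smul_mk {B A : Type u} [Ring B] [Ring A] [Algebra k B] [Algebra k A] (f : B →ₐ[k] A)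
    {M : Type v} [AddCommGroup M] [Module k M] [Module A M] (b : B) (x : M) :
    b • Res.mk f M x = Res.mk f M (f b • x) := rfl

variable {V : Type*} [AddCommGroup V] [Module k V] [Module (Hecke k n) V]
  [IsScalarTower k (Hecke k n) V]

/-- Frobenius reciprocity for restriction and coinduction. -/
def CoInd.curry (f : Res (heckeTower k n) P →ₗ[Hecke k n] V) :
    P →ₗ[Hecke k (n + 1)] CoInd k n V :=
  let g : P →ₗ[k] CoInd k n V :=
    CoInd.pi fun j : Fin (n + 1) => (f.restrictScalars k ∘ₗ
      (Res.mk (heckeTower k n) P).toLinearMap) ∘ₗ Module.toModuleEnd k P (Hecke.coset k n j)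
  { g with
    map_smul' := Hecke.map_smul_of_T g fun i hi x => by
      have hg : ∀ x j, CoInd.ev j (g x) = f (Res.mk _ P (Hecke.coset k n j • x)) := fun _ _ => rfl
      have hf : ∀ m, m + 1 < n → ∀ x,
          f (Res.mk _ P (Hecke.T k (n + 1) m • x)) = Hecke.T k n m • f (Res.mk _ P x) := by
        intro m hm x
        rw [← f.map_smul, Res.smul_mk, heckeTower_T hm]
      have hi : i < n := by omega
      refine CoInd.ext fun j => ?_
      rw [CoInd.T_smul hi, hg, ← mul_smul]
      rcases lt_trichotomy j.1 i with h | h | h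
      · rw [CoInd.op_of_lt h, Hecke.coset_mul_of_lt h hi, mul_smul, hf _ (by omega), hg]
      · rw [CoInd.op_of_eq h, ← h, Hecke.coset_mul_of_eq (by omega), neg_smul, map_neg, map_neg,
          hg]
      · rcases Nat.eq_or_lt_of_le (Nat.succ_le_of_lt h) with h' | h'
        · have h2 : j.1 = i + 1 := h'.symm
          rw [CoInd.op_of_eq_succ h2, hg, h2, Hecke.coset_mul_of_eq_succ hi]
        · rw [CoInd.op_of_gt h', Hecke.coset_mul_of_gt h', mul_smul, hf _ (by omega), hg] }

theorem CoInd.last_curry (f : Res (heckeTower k n) P →ₗ[Hecke k n] V) (x : P) :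
    last (curry f x) = f (Res.mk _ P x) := by
  change f (Res.mk _ P (Hecke.coset k n (Fin.last n).1 • x)) = _
  rw [Fin.val_last, Hecke.coset_last, one_smul]

/-- Frobenius reciprocity for restriction and coinduction. -/
def CoInd.uncurry (f : P →ₗ[Hecke k (n + 1)] CoInd k n V) :
    Res (heckeTower k n) P →ₗ[Hecke k n] V where
  toFun x := last (f ((Res.mk _ P).symm x))
  map_add' x y := by rw [map_add, map_add, map_add]
  map_smul' h x := by
    obtain ⟨x, rfl⟩ := (Res.mk (heckeTower k n) P).surjective x
    rw [Res.smul_mk, LinearEquiv.symm_apply_apply, LinearEquiv.symm_apply_apply, f.map_smul,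
      last_tower_smul, RingHom.id_apply]

theorem CoInd.uncurry_apply (f : P →ₗ[Hecke k (n + 1)] CoInd k n V) (x : P) :
    uncurry f (Res.mk _ P x) = last (f x) := rfl

/-- Restriction is left adjoint to coinduction, and coinduction preserves surjections because it
acts value by value. -/
theorem Res.projective [hP : Module.Projective (Hecke k (n + 1)) P] :
    Module.Projective (Hecke k n) (Res (heckeTower k n) P) := by
  apply Module.Projective.of_lifting_property''
  intro f hf
  let g : CoInd k n (Res (heckeTower k n) P →₀ Hecke k n) →ₗ[Hecke k (n + 1)]
      CoInd k n (Res (heckeTower k n) P) :=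
    let g0 : CoInd k n (Res (heckeTower k n) P →₀ Hecke k n) →ₗ[k]
        CoInd k n (Res (heckeTower k n) P) :=
      CoInd.pi fun j => f.restrictScalars k ∘ₗ CoInd.ev j
    { g0 with
      map_smul' := Hecke.map_smul_of_T g0 fun i hi x => by
        have hg : ∀ x j, CoInd.ev j (g0 x) = f (CoInd.ev j x) := fun _ _ => rfl
        have hi : i < n := by omega
        refine CoInd.ext fun j => ?_
        rw [CoInd.T_smul hi, CoInd.T_smul hi, hg]
        rcases lt_trichotomy j.1 i with h | h | h
        · rw [CoInd.op_of_lt h, CoInd.op_of_lt h, f.map_smul, hg]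
        · rw [CoInd.op_of_eq h, CoInd.op_of_eq h, map_neg, hg]
        · rcases Nat.eq_or_lt_of_le (Nat.succ_le_of_lt h) with h' | h'
          · rw [CoInd.op_of_eq_succ h'.symm, CoInd.op_of_eq_succ h'.symm, hg]
          · rw [CoInd.op_of_gt h', CoInd.op_of_gt h', f.map_smul, hg] }
  have hg : Function.Surjective g := by
    intro y
    choose x hx using fun j => hf (CoInd.ev j y)
    exact ⟨CoInd.ofValues k x, CoInd.ext hx⟩
  -- The unit P → CoInd (Res P) is lifted along the coinduced surjection; the adjoint of the lift
  -- splits f.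
  obtain ⟨s, hs⟩ := Module.projective_lifting_property g (CoInd.curry LinearMap.id) hg
  refine ⟨CoInd.uncurry s, LinearMap.ext fun x => ?_⟩
  obtain ⟨x, rfl⟩ := (Res.mk (heckeTower k n) P).surjective x
  rw [LinearMap.comp_apply, CoInd.uncurry_apply]
  have h1 := congrArg CoInd.last (LinearMap.congr_fun hs x)
  rw [CoInd.last_curry] at h1
  exact h1

/-- `H_{n+1}(0)` is generated over `H_n(0)` by the elements `T_{n-1} ⋯ T_j`. -/
theorem Res.span_coset_smul {v : P} (hv : Submodule.span (Hecke k (n + 1)) {v} = ⊤) :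
    Submodule.span (Hecke k n) (Set.range fun j : Fin (n + 1) =>
      Res.mk (heckeTower k n) P (Hecke.coset k n j • v)) = ⊤ := by
  set N := Submodule.span (Hecke k n) (Set.range fun j : Fin (n + 1) =>
      Res.mk (heckeTower k n) P (Hecke.coset k n j • v)) with hN
  have hmem : ∀ j ≤ n, Res.mk (heckeTower k n) P (Hecke.coset k n j • v) ∈ N := fun j hj =>
    Submodule.subset_span ⟨⟨j, by omega⟩, rfl⟩
  have hT : ∀ m, m + 1 < n → ∀ j ≤ n,
      Res.mk (heckeTower k n) P ((Hecke.T k (n + 1) m * Hecke.coset k n j) • v) ∈ N := by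
    intro m hm j hj
    rw [mul_smul, ← heckeTower_T hm, ← Res.smul_mk]
    exact N.smul_mem _ (hmem j hj)
  have key : ∀ a : Hecke k (n + 1), ∀ j ≤ n,
      Res.mk (heckeTower k n) P ((Hecke.coset k n j * a) • v) ∈ N := by
    intro a
    have ha : a ∈ Algebra.adjoin k {x | ∃ i, i + 1 < n + 1 ∧ Hecke.T k (n + 1) i = x} := by
      rw [Hecke.adjoin_T]; trivial
    have hk : ∀ (r : k) (x : Res (heckeTower k n) P), x ∈ N → r • x ∈ N := fun r x hx => by
      rw [← algebraMap_smul (Hecke k n) r x]; exact N.smul_mem _ hx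
    let K : Submodule k (Hecke k (n + 1)) :=
      { carrier := {b | Res.mk (heckeTower k n) P (b • v) ∈ N}
        add_mem' := fun {x y} hx hy => by
          change Res.mk (heckeTower k n) P ((x + y) • v) ∈ N
          rw [add_smul, map_add]; exact N.add_mem hx hy
        zero_mem' := by
          change Res.mk (heckeTower k n) P ((0 : Hecke k (n + 1)) • v) ∈ N
          rw [zero_smul, map_zero]; exact N.zero_mem
        smul_mem' := fun c x hx => by
          change Res.mk (heckeTower k n) P ((c • x) • v) ∈ N
          rw [smul_assoc, map_smul]; exact hk c _ hx }
    have hleft : ∀ (h : Hecke k n) x, x ∈ K → heckeTower k n h * x ∈ K := by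
      intro h x hx
      change Res.mk (heckeTower k n) P ((heckeTower k n h * x) • v) ∈ N
      rw [mul_smul, ← Res.smul_mk]
      exact N.smul_mem _ hx
    -- The span of H_n · T_{n-1} ⋯ T_j over all j is stable under right multiplication by the
    -- generators, by the rewriting rules for T_{n-1} ⋯ T_j T_i.
    let L : Submodule k (Hecke k (n + 1)) :=
      Submodule.span k {x | ∃ (h : Hecke k n) (j : ℕ), j ≤ n ∧ x = heckeTower k n h * Hecke.coset k n j}
    have hL : L ≤ K := Submodule.span_le.2 (by
      rintro _ ⟨h, j, hj, rfl⟩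
      exact hleft h _ (hmem j hj))
    have hLmul : ∀ x ∈ L, x * a ∈ L := by
      induction ha using Algebra.adjoin_induction with
      | mem a ha =>
        obtain ⟨i, hi, rfl⟩ := ha
        intro x hx
        refine Submodule.span_induction (p := fun x _ => x * Hecke.T k (n + 1) i ∈ L)
          ?_ ?_ ?_ ?_ hx
        · rintro _ ⟨h, j, hj, rfl⟩
          rw [mul_assoc]
          rcases lt_trichotomy j i with h1 | h1 | h1
          · rw [Hecke.coset_mul_of_lt h1 (by omega), ← heckeTower_T (by omega), ← mul_assoc,
              ← map_mul]
            exact Submodule.subset_span ⟨_, j, hj, rfl⟩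
          · subst h1
            rw [Hecke.coset_mul_of_eq (by omega), mul_neg]
            exact L.neg_mem (Submodule.subset_span ⟨_, j, hj, rfl⟩)
          · rcases Nat.eq_or_lt_of_le (Nat.succ_le_of_lt h1) with h2 | h2
            · subst h2
              rw [Nat.succ_eq_add_one, Hecke.coset_mul_of_eq_succ (by omega)]
              exact Submodule.subset_span ⟨_, i, by omega, rfl⟩
            · rw [Hecke.coset_mul_of_gt h2, ← heckeTower_T (by omega), ← mul_assoc, ← map_mul]
              exact Submodule.subset_span ⟨_, j, hj, rfl⟩
        · rw [zero_mul]; exact L.zero_mem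
        · intro x y _ _ hx hy
          rw [add_mul]; exact L.add_mem hx hy
        · intro c x _ hx
          rw [smul_mul_assoc]; exact L.smul_mem c hx
      | algebraMap r =>
        intro x hx
        rw [← Algebra.commutes, ← Algebra.smul_def]; exact L.smul_mem r hx
      | add a b _ _ ha hb => intro x hx; rw [mul_add]; exact L.add_mem (ha x hx) (hb x hx)
      | mul a b _ _ ha hb => intro x hx; rw [← mul_assoc]; exact hb _ (ha x hx)
    intro j hj
    exact hL (hLmul _ (Submodule.subset_span ⟨1, j, hj, by simp⟩))
  rw [eq_top_iff]
  rintro x -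
  obtain ⟨x, rfl⟩ := (Res.mk (heckeTower k n) P).surjective x
  have hx : x ∈ Submodule.span (Hecke k (n + 1)) {v} := by rw [hv]; trivial
  obtain ⟨a, rfl⟩ := Submodule.mem_span_singleton.1 hx
  have := key a n le_rfl
  rwa [Hecke.coset_last, one_mul] at this

end Restriction

/-! ### The branching rule for the 0-Hecke algebra -/

section Branching

variable {k : Type u} [Field k] {n : ℕ}

theorem simpleChar_T_congr {m m' : ℕ} {α : Composition m} {β : Composition m'} {i j : ℕ}
    (hi : i + 1 < m) (hj : j + 1 < m') (h : i + 1 ∈ descentSet α ↔ j + 1 ∈ descentSet β) :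
    simpleChar k α (Hecke.T k m i) = simpleChar k β (Hecke.T k m' j) := by
  by_cases ha : i + 1 ∈ descentSet α
  · rw [simpleChar_T_mem hi ha, simpleChar_T_mem hj (h.1 ha)]
  · rw [simpleChar_T_not_mem ha, simpleChar_T_not_mem fun hb => ha (h.2 hb)]

/-- The elements of the coinduced module of `S_β` that vanish below `l`. -/
def CoInd.filtration (k : Type u) [Field k] (β : Composition n) (l : Fin (n + 1)) :
    Submodule k (CoInd k n (SimpleMod k β)) :=
  ⨅ j : {j : Fin (n + 1) // j < l}, LinearMap.ker (ev j.1)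

theorem CoInd.mem_filtration {β : Composition n} {l : Fin (n + 1)}
    {f : CoInd k n (SimpleMod k β)} : f ∈ filtration k β l ↔ ∀ j < l, ev j f = 0 := by
  simp [filtration]

/-- The new value at j depends only on the old values at j and j - 1. -/
theorem CoInd.T_smul_mem_filtration {β : Composition n} {l : Fin (n + 1)}
    {f : CoInd k n (SimpleMod k β)} (hf : f ∈ filtration k β l) {i : ℕ} (hi : i < n) :
    Hecke.T k (n + 1) i • f ∈ filtration k β l := by
  rw [mem_filtration] at hf ⊢
  intro j hj
  rw [T_smul hi]
  rcases lt_trichotomy j.1 i with h | h | h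
  · rw [op_of_lt h, hf j hj, smul_zero]
  · rw [op_of_eq h, hf j hj, neg_zero]
  · rcases Nat.eq_or_lt_of_le (Nat.succ_le_of_lt h) with h' | h'
    · rw [op_of_eq_succ h'.symm]
      exact hf _ (lt_trans (by exact h) hj)
    · rw [op_of_gt h', hf j hj, smul_zero]

/-- Layer l of the filtration carries the character of α. Generators before and after position l act
through β, with indices shifted in the second case; T_l acts by -1, and T_{l-1} by 0 because it
reads the vanishing value at l - 1. -/
theorem CoInd.val_ev_T_smul {α : Composition (n + 1)} {β : Composition n} {l : Fin (n + 1)}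
    (hl : IsInsertion α β l) {f : CoInd k n (SimpleMod k β)} (hf : f ∈ filtration k β l) {i : ℕ}
    (hi : i < n) : SimpleMod.val β (ev l (Hecke.T k (n + 1) i • f)) =
      simpleChar k α (Hecke.T k (n + 1) i) * SimpleMod.val β (ev l f) := by
  rw [T_smul hi]
  have hins := hl (i + 1) (by omega) (by omega)
  rcases lt_trichotomy l.1 i with h | h | h
  · rw [op_of_lt h, SimpleMod.val_smul]
    congr 1
    refine simpleChar_T_congr (by omega) (by omega) ?_
    rw [hins, Nat.sub_add_cancel (by omega), Nat.add_sub_cancel]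
    constructor
    · exact fun h1 => Or.inr (Or.inr ⟨by omega, h1⟩)
    · rintro (h1 | h1 | h1)
      · omega
      · omega
      · exact h1.2
  · rw [op_of_eq h, simpleChar_T_mem (by omega) (hins.2 (Or.inr (Or.inl (by omega)))), map_neg,
      neg_one_mul]
  · rcases Nat.eq_or_lt_of_le (Nat.succ_le_of_lt h) with h' | h'
    · rw [op_of_eq_succ h'.symm, mem_filtration.1 hf _ (by exact h), map_zero, simpleChar_T_not_mem,
        zero_mul]
      rw [hins]
      omega
    · rw [op_of_gt h', SimpleMod.val_smul]
      congr 1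
      refine simpleChar_T_congr (by omega) (by omega) ?_
      rw [hins]
      constructor
      · exact fun h1 => Or.inl ⟨h', h1⟩
      · rintro (h1 | h1 | h1)
        · exact h1.2
        · omega
        · omega

/-- The leading coefficient of a map to a step of the filtration of the coinduced module. -/
def CoInd.leading {α : Composition (n + 1)} {β : Composition n} {l : Fin (n + 1)}
    (hl : IsInsertion α β l) {X : Type*} [AddCommGroup X] [Module k X]
    [Module (Hecke k (n + 1)) X] [IsScalarTower k (Hecke k (n + 1)) X]
    (f : X →ₗ[Hecke k (n + 1)] CoInd k n (SimpleMod k β)) (hf : ∀ x, f x ∈ filtration k β l) :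
    X →ₗ[Hecke k (n + 1)] SimpleMod k α :=
  let g : X →ₗ[k] SimpleMod k α :=
    ((SimpleMod.val β).trans (SimpleMod.val α).symm).toLinearMap ∘ₗ ev l ∘ₗ f.restrictScalars k
  { g with
    map_smul' := Hecke.map_smul_of_T g fun i hi x => by
      have hg : ∀ x, SimpleMod.val α (g x) = SimpleMod.val β (ev l (f x)) := fun x => rfl
      apply (SimpleMod.val α).injective
      rw [SimpleMod.val_smul, hg, hg, f.map_smul, val_ev_T_smul hl (hf x) (by omega)] }

theorem CoInd.val_leading {α : Composition (n + 1)} {β : Composition n} {l : Fin (n + 1)}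
    (hl : IsInsertion α β l) {X : Type*} [AddCommGroup X] [Module k X]
    [Module (Hecke k (n + 1)) X] [IsScalarTower k (Hecke k (n + 1)) X]
    (f : X →ₗ[Hecke k (n + 1)] CoInd k n (SimpleMod k β)) (hf : ∀ x, f x ∈ filtration k β l)
    (x : X) : SimpleMod.val α (leading hl f hf x) = SimpleMod.val β (ev l (f x)) := rfl

variable {P : Type*} [AddCommGroup P] [Module k P] [Module (Hecke k (n + 1)) P]
  [IsScalarTower k (Hecke k (n + 1)) P]
variable {α : Composition (n + 1)} {p : P →ₗ[Hecke k (n + 1)] SimpleMod k α}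

/-- The leading coefficient maps step l of the filtration onto S_α, and p lifts along it. -/
theorem IsProjectiveCover.exists_lift (hp : IsProjectiveCover p) {β : Composition n}
    {l : Fin (n + 1)} (hl : IsInsertion α β l) :
    ∃ g : P →ₗ[Hecke k (n + 1)] CoInd k n (SimpleMod k β),
      (∀ x, ∀ j < l, CoInd.ev j (g x) = 0) ∧
        ∀ x, SimpleMod.val β (CoInd.ev l (g x)) = SimpleMod.val α (p x) := by
  have := hp.1
  let F : Submodule (Hecke k (n + 1)) (CoInd k n (SimpleMod k β)) :=
    { (CoInd.filtration k β l).toAddSubmonoid with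
      smul_mem' := fun a x hx => Hecke.smul_mem (CoInd.filtration k β l)
        (fun i hi x hx => CoInd.T_smul_mem_filtration hx (by omega)) a hx }
  let r := CoInd.leading hl F.subtype (fun x => x.2)
  have hr : ∀ x, SimpleMod.val α (r x) = SimpleMod.val β (CoInd.ev l x.1) :=
    CoInd.val_leading hl F.subtype (fun x => x.2)
  have hsurj : Function.Surjective r := by
    intro y
    let f : CoInd k n (SimpleMod k β) := CoInd.ofValues k fun j =>
      if j = l then (SimpleMod.val β).symm (SimpleMod.val α y) else 0
    have hfF : f ∈ F := by
      change f ∈ CoInd.filtration k β l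
      rw [CoInd.mem_filtration]
      intro j hj
      simp [f, hj.ne]
    refine ⟨⟨f, hfF⟩, (SimpleMod.val α).injective ?_⟩
    rw [hr]
    simp [f]
  obtain ⟨g, hg⟩ := Module.projective_lifting_property r p hsurj
  refine ⟨F.subtype ∘ₗ g, fun x => CoInd.mem_filtration.1 (g x).2, fun x => ?_⟩
  rw [← hg, LinearMap.comp_apply, LinearMap.comp_apply, hr]; rfl

/-- Elimination of leading terms: the leading coefficient of f at l is a map from P to a simple
module, hence zero or a multiple of p. In the second case l is an insertion position for α, and
subtracting a multiple of `G l` pushes f one step down the filtration. -/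
theorem IsProjectiveCover.eq_sum_lifts (hp : IsProjectiveCover p) {β : Composition n}
    (G : Fin (n + 1) → P →ₗ[Hecke k (n + 1)] CoInd k n (SimpleMod k β))
    (hG : ∀ l, IsInsertion α β l.1 → (∀ x, ∀ j < l, CoInd.ev j (G l x) = 0) ∧
        ∀ x, SimpleMod.val β (CoInd.ev l (G l x)) = SimpleMod.val α (p x))
    (f : P →ₗ[Hecke k (n + 1)] CoInd k n (SimpleMod k β)) :
    ∃ c : Fin (n + 1) → k, ∀ x, f x = ∑ l, c l • G l x := by
  classical
  -- The induction runs over the number m of final positions at which f may be nonzero.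
  suffices H : ∀ m ≤ n + 1, ∀ f : P →ₗ[Hecke k (n + 1)] CoInd k n (SimpleMod k β),
      (∀ x, ∀ j : Fin (n + 1), j.1 + m < n + 1 → CoInd.ev j (f x) = 0) →
      ∃ c : Fin (n + 1) → k, ∀ x, f x = ∑ l, c l • G l x from
    H (n + 1) le_rfl f fun x j h => by omega
  intro m
  induction m with
  | zero =>
    intro _ f hf
    refine ⟨0, fun x => ?_⟩
    simp only [Pi.zero_apply, zero_smul, Finset.sum_const_zero]
    exact CoInd.ext fun j => by rw [hf x j (by omega), map_zero]
  | succ m ih =>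
    intro hm f hf
    let l : Fin (n + 1) := ⟨n - m, by omega⟩
    have hl : l.1 + m = n := Nat.sub_add_cancel (by omega)
    -- The composition δ is the insertion at l; it need not be α until `hom_eq` forces this.
    obtain ⟨δ, hδ⟩ := exists_composition (fun d => (d < l.1 ∧ d ∈ descentSet β) ∨ d = l.1 + 1 ∨
      (l.1 + 1 < d ∧ d - 1 ∈ descentSet β)) (n + 1)
    have hδ' : IsInsertion δ β l.1 := hδ
    have hfl : ∀ x, f x ∈ CoInd.filtration k β l := fun x =>
      CoInd.mem_filtration.2 fun j hj => hf x j (by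
        have : j.1 < l.1 := hj
        omega)
    by_cases h0 : CoInd.leading hδ' f hfl = 0
    · refine ih (by omega) f fun x j hj => ?_
      rcases Nat.lt_or_ge (j.1 + (m + 1)) (n + 1) with h1 | h1
      · exact hf x j h1
      · obtain rfl : j = l := Fin.ext (by omega)
        apply (SimpleMod.val β).injective
        rw [← CoInd.val_leading hδ' f hfl, h0, LinearMap.zero_apply, map_zero, map_zero]
    · obtain ⟨rfl, c, hc⟩ := hp.hom_eq _ h0
      obtain ⟨hG1, hG2⟩ := hG l hδ'
      obtain ⟨c', hsum⟩ := ih (by omega) (f - c • G l) fun x j hj => by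
        rw [LinearMap.sub_apply, LinearMap.smul_apply, map_sub, map_smul]
        rcases Nat.lt_or_ge (j.1 + (m + 1)) (n + 1) with h1 | h1
        · rw [hf x j h1, hG1 x j (by change j.1 < l.1; omega), smul_zero, sub_zero]
        · obtain rfl : j = l := Fin.ext (by omega)
          apply (SimpleMod.val β).injective
          rw [map_sub, map_smul, hG2, ← CoInd.val_leading hδ' f hfl, hc, smul_eq_mul, sub_self,
            map_zero]
      refine ⟨c' + Pi.single l c, fun x => ?_⟩
      · have h1 := hsum x
        rw [LinearMap.sub_apply, LinearMap.smul_apply, sub_eq_iff_eq_add] at h1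
        simp only [Pi.add_apply, add_smul, Finset.sum_add_distrib]
        rw [h1]
        congr 1
        rw [Finset.sum_eq_single l]
        · rw [Pi.single_eq_same]
        · intro j _ hj
          rw [Pi.single_eq_of_ne hj, zero_smul]
        · simp

theorem IsProjectiveCover.res_finite (hp : IsProjectiveCover p) :
    Module.Finite (Hecke k n) (Res (heckeTower k n) P) := by
  obtain ⟨v, hv⟩ := hp.exists_val_eq_one
  have h := Res.span_coset_smul (n := n) (hp.span_eq_top (v := v) fun h => by simp [h] at hv)
  exact ⟨Submodule.fg_def.2 ⟨_, Set.finite_range _, h⟩⟩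

variable {Q : Composition n → Type*} [∀ β, AddCommGroup (Q β)] [∀ β, Module (Hecke k n) (Q β)]

/-- The branching rule for the indecomposable projective modules of the 0-Hecke algebra. -/
theorem IsProjectiveCover.exists_res_equiv (hp : IsProjectiveCover p)
    {q : ∀ β, Q β →ₗ[Hecke k n] SimpleMod k β} (hq : ∀ β, IsProjectiveCover (q β)) :
    Nonempty (Res (heckeTower k n) P ≃ₗ[Hecke k n] ⨁ b : Branch α, Q b.comp) := by
  classical
  have := hp.1
  have := hp.res_finite
  have := Res.projective (k := k) (n := n) (P := P)
  have := Fintype.ofFinite (Branch α)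
  choose G hG using fun b : Branch α => hp.exists_lift (l := ⟨b.pos, b.pos_lt⟩) b.isInsertion
  refine exists_equiv_directSum_covers hq Branch.comp (fun b => CoInd.uncurry (G b)) ?_ ?_
  · intro γ f x hx
    obtain ⟨x, rfl⟩ := (Res.mk (heckeTower k n) P).surjective x
    -- Insertion positions belong to branches and use their lifts, whose last value at x vanishes by
    -- `hx`; elsewhere no lift is required and 0 serves.
    have hex : ∀ l : Fin (n + 1), ∃ g : P →ₗ[Hecke k (n + 1)] CoInd k n (SimpleMod k γ),
        (IsInsertion α γ l.1 → (∀ x, ∀ j < l, CoInd.ev j (g x) = 0) ∧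
          ∀ x, SimpleMod.val γ (CoInd.ev l (g x)) = SimpleMod.val α (p x)) ∧
        CoInd.last (g x) = 0 := by
      intro l
      by_cases h : IsInsertion α γ l.1
      · obtain ⟨b, rfl, hb⟩ := h.exists_branch l.2
        obtain rfl : l = ⟨b.pos, b.pos_lt⟩ := Fin.ext hb.symm
        exact ⟨G b, fun _ => hG b, hx b⟩
      · exact ⟨0, fun h' => absurd h' h, by rw [LinearMap.zero_apply, map_zero]⟩
    choose g hg hgx using hex
    obtain ⟨c, hsum⟩ := hp.eq_sum_lifts g hg (CoInd.curry f)
    rw [← CoInd.last_curry, hsum, map_sum]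
    refine Finset.sum_eq_zero fun l _ => ?_
    rw [map_smul, hgx, smul_zero]
  · intro γ c hc hsum
    by_contra hne
    obtain ⟨b₁, hb₁⟩ := Function.ne_iff.1 hne
    -- Triangularity: evaluation at T_{n-1} ⋯ T_l, with l the least position that has a nonzero
    -- coefficient, kills the lifts with later positions. Two branches with equal position and
    -- composition coincide, so only b₀ survives.
    obtain ⟨b₀, hb₀, hmin⟩ := (Finset.univ.filter fun b : Branch α => c b ≠ 0).exists_min_image
      Branch.pos ⟨b₁, by simpa using hb₁⟩
    simp only [Finset.mem_filter, Finset.mem_univ, true_and] at hb₀ hmin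
    obtain ⟨v, hv⟩ := hp.exists_val_eq_one
    let l : Fin (n + 1) := ⟨b₀.pos, b₀.pos_lt⟩
    have hπ : ∀ b, CoInd.uncurry (G b) (Res.mk _ P (Hecke.coset k n l • v)) = CoInd.ev l (G b v) :=
        fun b => by
      rw [CoInd.uncurry_apply, (G b).map_smul, CoInd.coset_smul]
    have h1 := hsum (Res.mk _ P (Hecke.coset k n l • v))
    apply hb₀
    rw [Finset.sum_eq_single b₀] at h1
    · rw [hπ] at h1
      rw [(hG b₀).2 v, hv, mul_one] at h1
      exact h1
    · intro b _ hb
      by_cases hcb : c b = 0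
      · rw [hcb, zero_mul]
      · rw [hπ, (hG b).1 v l,
          map_zero, mul_zero]
        have hle := hmin b hcb
        change b₀.pos < b.pos
        refine lt_of_le_of_ne hle fun heq => hb ?_
        exact Branch.ext_of_pos heq.symm ((hc b hcb).trans (hc b₀ hb₀).symm)
    · simp

end Branching

/-! ### Longest elements of parabolic submonoids -/

section Longest

open Classical in
/-- The first index of the run of consecutive elements of `J` that ends before `N`. -/
def runStart (J : Set ℕ) : ℕ → ℕ
  | 0 => 0
  | N + 1 => if N ∈ J then runStart J N else N + 1

theorem runStart_le (J : Set ℕ) (N : ℕ) : runStart J N ≤ N := by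
  induction N with
  | zero => exact le_rfl
  | succ N ih =>
    rw [runStart]
    split_ifs
    · omega
    · exact le_rfl

theorem mem_of_runStart_le {J : Set ℕ} {N i : ℕ} (h : runStart J N ≤ i) (hi : i < N) : i ∈ J := by
  induction N with
  | zero => omega
  | succ N ih =>
    rw [runStart] at h
    split_ifs at h with hN
    · rcases Nat.lt_succ_iff_lt_or_eq.1 hi with h1 | rfl
      · exact ih h h1
      · exact hN
    · omega

theorem not_mem_of_lt_runStart {J : Set ℕ} {N i : ℕ} (h : i + 1 = runStart J N) : i ∉ J := by
  induction N with
  | zero => simp [runStart] at h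
  | succ N ih =>
    rw [runStart] at h
    split_ifs at h with hN
    · exact ih h
    · obtain rfl : i = N := by omega
      exact hN

variable {R : Type*} [Monoid R] (a : ℕ → R) (J : Set ℕ)

open Classical in
/-- The longest element of the parabolic submonoid generated by the `a_i` with `i ∈ J` and
`i < N`. -/
def longest : ℕ → R
  | 0 => 1
  | N + 1 =>
    if N ∈ J then longest N * desc a (runStart J N) (N + 1 - runStart J N) else longest N

theorem longest_succ_of_mem {N : ℕ} (h : N ∈ J) :
    longest a J (N + 1) = longest a J N * desc a (runStart J N) (N + 1 - runStart J N) := by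
  rw [longest, if_pos h]

theorem longest_succ_of_not_mem {N : ℕ} (h : N ∉ J) : longest a J (N + 1) = longest a J N := by
  rw [longest, if_neg h]

theorem map_longest {S F : Type*} [Monoid S] [FunLike F R S] [MonoidHomClass F R S] (f : F)
    (N : ℕ) : f (longest a J N) = longest (fun i => f (a i)) J N := by
  induction N with
  | zero => simp [longest]
  | succ N ih =>
    by_cases h : N ∈ J
    · rw [longest_succ_of_mem _ _ h, longest_succ_of_mem _ _ h, map_mul, ih, map_desc]
    · rw [longest_succ_of_not_mem _ _ h, longest_succ_of_not_mem _ _ h, ih]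

variable {a J}

theorem desc_mem {M : Submonoid R} {j l : ℕ} (h : ∀ i, j ≤ i → i < j + l → a i ∈ M) :
    desc a j l ∈ M := by
  induction l with
  | zero => exact M.one_mem
  | succ l ih =>
    rw [desc_succ]
    exact M.mul_mem (h _ (by omega) (by omega)) (ih fun i h1 h2 => h i h1 (by omega))

theorem longest_mem {M : Submonoid R} {N : ℕ} (h : ∀ i ∈ J, i < N → a i ∈ M) :
    longest a J N ∈ M := by
  induction N with
  | zero => exact M.one_mem
  | succ N ih =>
    by_cases hN : N ∈ J
    · rw [longest_succ_of_mem _ _ hN]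
      refine M.mul_mem (ih fun i hi h1 => h i hi (by omega)) (desc_mem fun i h1 h2 => ?_)
      have hle := runStart_le J N
      refine h i ?_ (by omega)
      rcases Nat.lt_succ_iff_lt_or_eq.1 (show i < N + 1 by omega) with h3 | rfl
      · exact mem_of_runStart_le h1 h3
      · exact hN
    · rw [longest_succ_of_not_mem _ _ hN]
      exact ih fun i hi h1 => h i hi (by omega)

theorem commute_longest {x : R} {N : ℕ} (h : ∀ i < N, x * a i = a i * x) :
    x * longest a J N = longest a J N * x := by
  have : longest a J N ∈ Submonoid.centralizer {x} := longest_mem fun i _ hi => by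
    rw [Submonoid.mem_centralizer_iff]
    rintro _ rfl
    exact h i hi
  exact Submonoid.mem_centralizer_iff.1 this x rfl

/-- Moved from the right past the last descending run, a_i is absorbed if i starts the run, becomes
a_{i-1} if i lies further inside, and stays a_i if it belongs to an earlier run; i cannot be
adjacent to the run from below, as that index is not in J. Induction absorbs the outcome. -/
theorem IsBraid.longest_mul (ha : IsBraid a) (hsq : ∀ i, a i * a i = a i) {N i : ℕ} (hi : i ∈ J)
    (hN : i < N) : longest a J N * a i = longest a J N := by
  induction N generalizing i with
  | zero => omega
  | succ N ih =>
    by_cases h : N ∈ J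
    · rw [longest_succ_of_mem _ _ h, mul_assoc]
      have hle := runStart_le J N
      rcases lt_trichotomy i (runStart J N) with h1 | h1 | h1
      · have h2 : i + 1 ≠ runStart J N := fun h2 => not_mem_of_lt_runStart h2 hi
        rw [ha.desc_mul_of_lt (by omega), ← mul_assoc, ih hi (by omega)]
      · rw [h1, show N + 1 - runStart J N = N - runStart J N + 1 by omega, desc_succ_right,
          mul_assoc, hsq]
      · obtain ⟨m, rfl⟩ : ∃ m, i = m + 1 := ⟨i - 1, by omega⟩
        rw [ha.desc_mul (by omega) (by omega), ← mul_assoc,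
          ih (mem_of_runStart_le (N := N) (by omega) (by omega)) (by omega)]
    · rw [longest_succ_of_not_mem _ _ h]
      refine ih hi (lt_of_le_of_ne (by omega) ?_)
      rintro rfl
      exact h hi

theorem desc_mul_shift {c : ℕ → R} {j l : ℕ} (h : ∀ i, j ≤ i → i < j + l →
    a i * c i = c (i + 1) * a i) : desc a j l * c j = c (j + l) * desc a j l := by
  induction l with
  | zero => simp
  | succ l ih =>
    rw [desc_succ, mul_assoc, ih fun i h1 h2 => h i h1 (by omega), ← mul_assoc,
      h _ (by omega) (by omega), mul_assoc]
    rfl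

/-- The hypotheses only move a c upwards, so the lowest one is used. A descending product starting
at 0 carries c_0 to its upper end, where c commutes with all earlier factors; any other descending
product commutes with c_0. -/
theorem exists_longest_mul_eq {c : ℕ → R} {N : ℕ} (h : ∀ i < N, a i * c i = c (i + 1) * a i)
    (h' : ∀ i < N, ∀ j, j ≠ i → j ≠ i + 1 → a i * c j = c j * a i) :
    ∃ b ≤ N, longest a J N * c 0 = c b * longest a J N := by
  induction N with
  | zero => exact ⟨0, le_rfl, by simp [longest]⟩
  | succ N ih =>
    by_cases hN : N ∈ J
    · rw [longest_succ_of_mem _ _ hN]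
      have hle := runStart_le J N
      rcases Nat.eq_zero_or_pos (runStart J N) with h0 | h0
      · refine ⟨N + 1, le_rfl, ?_⟩
        rw [h0, Nat.sub_zero, mul_assoc, desc_mul_shift fun i _ h2 => h i (by omega), ← mul_assoc,
          ← commute_longest (x := c (0 + (N + 1))) fun i hi =>
            (h' i (by omega) _ (by omega) (by omega)).symm, mul_assoc, zero_add]
      · obtain ⟨b, hb, e⟩ := ih (fun i hi => h i (by omega)) fun i hi => h' i (by omega)
        refine ⟨b, by omega, ?_⟩
        rw [mul_assoc, ← commute_desc (x := c 0) fun i h1 h2 =>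
          (h' i (by omega) 0 (by omega) (by omega)).symm, ← mul_assoc, e, mul_assoc]
    · rw [longest_succ_of_not_mem _ _ hN]
      obtain ⟨b, hb, e⟩ := ih (fun i hi => h i (by omega)) fun i hi => h' i (by omega)
      exact ⟨b, by omega, e⟩

end Longest

/-! ### The 0-Hecke monoid and Norton's generators -/

section Norton

variable {k : Type u} [Field k] {n : ℕ}

variable (k n) in
/-- The idempotent `-T_i`. -/
def Hecke.idem (i : ℕ) : Hecke k n := -Hecke.T k n i

theorem Hecke.idem_mul_self (i : ℕ) : idem k n i * idem k n i = idem k n i := by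
  simp [idem, T_mul_self]

theorem Hecke.isBraid_idem : IsBraid (idem k n) where
  comm i j h := by simp only [idem, neg_mul_neg, isBraid.comm i j h]
  braid i := by simp only [idem, neg_mul, mul_neg, isBraid.braid i]

theorem heckeTower_idem {i : ℕ} (h : i + 1 < n) :
    heckeTower k n (Hecke.idem k n i) = Hecke.idem k (n + 1) i := by
  rw [Hecke.idem, map_neg, heckeTower_T h, Hecke.idem]

theorem Hecke.coidem_mul_self (i : ℕ) :
    (1 + T k n i) * (1 + T k n i) = 1 + T k n i := by
  rw [mul_add, add_mul, add_mul, T_mul_self]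
  noncomm_ring

theorem Hecke.isBraid_coidem : IsBraid (fun i => 1 + T k n i) where
  comm i j h := by
    have := isBraid.comm (a := T k n) i j h
    simp only [mul_add, add_mul, this]
    noncomm_ring
  braid i := by
    have h1 := isBraid.braid (a := T k n) i
    have h2 := T_mul_self (k := k) (n := n) i
    have h3 := T_mul_self (k := k) (n := n) (i + 1)
    simp only [mul_add, add_mul, mul_one, one_mul, h1, h2, h3]
    noncomm_ring

variable (k n) in
/-- The 0-Hecke monoid. -/
def heckeMonoid : Submonoid (Hecke k n) :=
  Submonoid.closure {x | ∃ i, i + 1 < n ∧ Hecke.idem k n i = x}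

theorem idem_mem_heckeMonoid {i : ℕ} (h : i + 1 < n) : Hecke.idem k n i ∈ heckeMonoid k n :=
  Submonoid.subset_closure ⟨i, h, rfl⟩

theorem span_heckeMonoid : Submodule.span k (heckeMonoid k n : Set (Hecke k n)) = ⊤ := by
  rw [heckeMonoid, ← Algebra.adjoin_eq_span, ← Algebra.top_toSubmodule]
  congr 1
  rw [eq_top_iff, ← Hecke.adjoin_T, Algebra.adjoin_le_iff]
  rintro _ ⟨i, hi, rfl⟩
  have : -Hecke.idem k n i ∈ Algebra.adjoin k {x | ∃ i, i + 1 < n ∧ Hecke.idem k n i = x} :=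
    Subalgebra.neg_mem _ (Algebra.subset_adjoin ⟨i, hi, rfl⟩)
  rwa [Hecke.idem, neg_neg] at this

/-- Coset normal form: products of this shape are stable under right multiplication by generators.
Hence the order of the monoid grows at most by the factor n + 1. -/
theorem heckeMonoid_succ_subset : (heckeMonoid k (n + 1) : Set (Hecke k (n + 1))) ⊆
    (fun s : Hecke k n × Fin (n + 1) =>
      heckeTower k n s.1 * desc (Hecke.idem k (n + 1)) s.2 (n - s.2)) ''
        ((heckeMonoid k n : Set (Hecke k n)) ×ˢ Set.univ) := by
  intro x hx
  have hex : ∃ y ∈ heckeMonoid k n, ∃ j ≤ n,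
      x = heckeTower k n y * desc (Hecke.idem k (n + 1)) j (n - j) := by
    refine Submonoid.closure_induction_right (motive := fun x _ => ∃ y ∈ heckeMonoid k n, ∃ j ≤ n,
      x = heckeTower k n y * desc (Hecke.idem k (n + 1)) j (n - j)) ?_ ?_ hx
    · exact ⟨1, Submonoid.one_mem _, n, le_rfl, by simp⟩
    · rintro _ - _ ⟨i, hi, rfl⟩ ⟨y, hy, j, hj, rfl⟩
      rcases lt_trichotomy j i with h | h | h
      · obtain ⟨m, rfl⟩ : ∃ m, i = m + 1 := ⟨i - 1, by omega⟩
        refine ⟨y * Hecke.idem k n m, Submonoid.mul_mem _ hy (idem_mem_heckeMonoid (by omega)), j,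
          hj, ?_⟩
        rw [map_mul, heckeTower_idem (by omega), mul_assoc, mul_assoc,
          Hecke.isBraid_idem.desc_mul (by omega) (by omega)]
      · subst h
        refine ⟨y, hy, j, hj, ?_⟩
        rw [show n - j = n - j - 1 + 1 by omega, desc_succ_right, mul_assoc, mul_assoc,
          Hecke.idem_mul_self]
      · rcases Nat.eq_or_lt_of_le (Nat.succ_le_of_lt h) with h' | h'
        · subst h'
          refine ⟨y, hy, i, by omega, ?_⟩
          rw [mul_assoc, show n - i = n - (i + 1) + 1 by omega, desc_succ_right]
        · refine ⟨y * Hecke.idem k n i, Submonoid.mul_mem _ hy (idem_mem_heckeMonoid (by omega)), j,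
            hj, ?_⟩
          rw [map_mul, heckeTower_idem (by omega), mul_assoc, mul_assoc,
            Hecke.isBraid_idem.desc_mul_of_lt (by omega)]
  obtain ⟨y, hy, j, hj, rfl⟩ := hex
  exact ⟨(y, ⟨j, by omega⟩), ⟨hy, trivial⟩, rfl⟩

theorem heckeMonoid_zero : heckeMonoid k 0 = ⊥ := by
  rw [heckeMonoid, eq_bot_iff, Submonoid.closure_le]
  rintro _ ⟨i, hi, -⟩
  omega

theorem finite_heckeMonoid : (heckeMonoid k n : Set (Hecke k n)).Finite := by
  induction n with
  | zero =>
    rw [heckeMonoid_zero]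
    exact Set.finite_singleton 1
  | succ n ih => exact ((ih.prod Set.finite_univ).image _).subset heckeMonoid_succ_subset

instance : Module.Finite k (Hecke k n) :=
  ⟨Submodule.fg_def.2 ⟨_, finite_heckeMonoid, span_heckeMonoid⟩⟩

/-- The coefficient at l is recovered by acting on the element of the coinduced regular module that
is supported at l. Hence the dimension grows at least by the factor n + 1. -/
theorem coset_combination_injective : Function.Injective (fun x : Fin (n + 1) → Hecke k n =>
    ∑ j, heckeTower k n (x j) * Hecke.coset k n j) := by
  classical
  have key : ∀ (x : Fin (n + 1) → Hecke k n) (l : Fin (n + 1)),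
      CoInd.last ((∑ j, heckeTower k n (x j) * Hecke.coset k n j) •
        CoInd.ofValues k (Pi.single l (1 : Hecke k n))) = x l := by
    intro x l
    rw [Finset.sum_smul, map_sum, Finset.sum_eq_single l]
    · rw [mul_smul, CoInd.last_tower_smul, CoInd.coset_smul, CoInd.ev_ofValues, Pi.single_eq_same,
        smul_eq_mul, mul_one]
    · intro j _ hj
      rw [mul_smul, CoInd.last_tower_smul, CoInd.coset_smul, CoInd.ev_ofValues,
        Pi.single_eq_of_ne hj, smul_zero]
    · simp
  intro x y h
  funext l
  rw [← key x l, ← key y l]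
  exact congrArg (fun s => CoInd.last (s • CoInd.ofValues k (Pi.single l (1 : Hecke k n)))) h

theorem Hecke.mul_finrank_le :
    (n + 1) * Module.finrank k (Hecke k n) ≤ Module.finrank k (Hecke k (n + 1)) := by
  let f : (Fin (n + 1) → Hecke k n) →ₗ[k] Hecke k (n + 1) :=
    ∑ j : Fin (n + 1), LinearMap.mulRight k (Hecke.coset k n j) ∘ₗ (heckeTower k n).toLinearMap ∘ₗ
      LinearMap.proj j
  have hf : ∀ x, f x = ∑ j, heckeTower k n (x j) * Hecke.coset k n j := fun x => by
    simp [f, LinearMap.sum_apply]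
  have hinj : Function.Injective f := by
    intro x y h
    rw [hf, hf] at h
    exact coset_combination_injective h
  have := LinearMap.finrank_le_finrank_of_injective hinj
  rwa [Module.finrank_pi_fintype, Finset.sum_const, Finset.card_univ, Fintype.card_fin,
    smul_eq_mul] at this

/-- The upper bound for the growth of the monoid meets the lower bound for the growth of the
dimension. -/
theorem ncard_heckeMonoid_le : (heckeMonoid k n : Set (Hecke k n)).ncard ≤
    Module.finrank k (Hecke k n) := by
  induction n with
  | zero =>
    have : Nontrivial (Hecke k 0) :=
      (simpleChar k (default : Composition 0)).toRingHom.domain_nontrivial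
    rw [heckeMonoid_zero, Submonoid.coe_bot, Set.ncard_singleton]
    exact Module.finrank_pos
  | succ n ih =>
    have hfin : ((heckeMonoid k n : Set (Hecke k n)) ×ˢ (Set.univ : Set (Fin (n + 1)))).Finite :=
      finite_heckeMonoid.prod Set.finite_univ
    calc _ ≤ _ := Set.ncard_le_ncard heckeMonoid_succ_subset (hfin.image _)
      _ ≤ _ := Set.ncard_image_le hfin
      _ = (heckeMonoid k n : Set (Hecke k n)).ncard * (n + 1) := by
        rw [Set.ncard_prod, Set.ncard_univ, Nat.card_fin]
      _ ≤ Module.finrank k (Hecke k n) * (n + 1) := Nat.mul_le_mul_right _ ih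
      _ ≤ _ := by rw [mul_comm]; exact Hecke.mul_finrank_le

/-- The longest element of the parabolic submonoid that belongs to the descents of `β`. -/
def nortonLeft (k : Type u) [Field k] (β : Composition n) : Hecke k n :=
  longest (Hecke.idem k n) {i | i + 1 ∈ descentSet β} (n - 1)

/-- The antisymmetric counterpart of `nortonLeft` for the complement of the descents of `β`. -/
def nortonRight (k : Type u) [Field k] (β : Composition n) : Hecke k n :=
  (longest (fun i => MulOpposite.op (1 + Hecke.T k n i)) {i | i + 1 ∉ descentSet β} (n - 1)).unop

/-- Norton's generator of the projective cover of `S_β`. -/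
def norton (k : Type u) [Field k] (β : Composition n) : Hecke k n :=
  nortonLeft k β * nortonRight k β

theorem nortonLeft_mul_idem {β : Composition n} {i : ℕ} (hi : i + 1 < n)
    (h : i + 1 ∈ descentSet β) : nortonLeft k β * Hecke.idem k n i = nortonLeft k β :=
  Hecke.isBraid_idem.longest_mul Hecke.idem_mul_self h (by omega)

/-- `nortonRight` is a longest element in the opposite algebra, so it absorbs 1 + T_i from the left.
-/
theorem idem_mul_nortonRight {β : Composition n} {i : ℕ} (hi : i + 1 < n)
    (h : i + 1 ∉ descentSet β) : Hecke.idem k n i * nortonRight k β = 0 := by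
  have h1 := congrArg MulOpposite.unop
    ((Hecke.isBraid_coidem (k := k) (n := n)).op.longest_mul (J := {i | i + 1 ∉ descentSet β})
      (fun i => by rw [← MulOpposite.op_mul, Hecke.coidem_mul_self]) h
      (show i < n - 1 by omega))
  rw [MulOpposite.unop_mul, MulOpposite.unop_op] at h1
  change (1 + Hecke.T k n i) * nortonRight k β = nortonRight k β at h1
  rw [add_mul, one_mul, add_eq_left] at h1
  rw [Hecke.idem, neg_mul, h1, neg_zero]

theorem nortonLeft_mem (β : Composition n) : nortonLeft k β ∈ heckeMonoid k n :=
  longest_mem fun _ _ hi => idem_mem_heckeMonoid (by omega)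

/-- Each factor -T_i with i a descent, and each 1 + T_i with i a non-descent, acts by 1 on S_β. So
Norton's element carries a generator of the projective cover to a generator. -/
theorem simpleChar_norton (β : Composition n) : simpleChar k β (norton k β) = 1 := by
  have h1 : simpleChar k β (nortonLeft k β) = 1 := by
    rw [nortonLeft, map_longest]
    have : longest (fun i => simpleChar k β (Hecke.idem k n i)) {i | i + 1 ∈ descentSet β} (n - 1) ∈
        (⊥ : Submonoid k) := longest_mem fun i hi hN => by
      rw [Submonoid.mem_bot, Hecke.idem, map_neg, simpleChar_T_mem (by omega) hi, neg_neg]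
    exact Submonoid.mem_bot.1 this
  have h2 : simpleChar k β (nortonRight k β) = 1 := by
    have : longest (fun i => MulOpposite.op (1 + Hecke.T k n i)) {i | i + 1 ∉ descentSet β} (n - 1)
        ∈ (MonoidHom.mker (simpleChar k β).toRingHom.toMonoidHom).op := longest_mem fun i hi hN => by
      change simpleChar k β (1 + Hecke.T k n i) = 1
      rw [map_add, map_one, simpleChar_T_not_mem hi, add_zero]
    exact this
  rw [norton, map_mul, h1, h2, one_mul]

/-- The elements of the 0-Hecke monoid with a given right descent set. -/
def heckeMonoidOfDescents (k : Type u) [Field k] (β : Composition n) : Set (Hecke k n) :=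
  {y | y ∈ heckeMonoid k n ∧ ∀ i, i + 1 < n → (y * Hecke.idem k n i = y ↔ i + 1 ∈ descentSet β)}

/-- The left ideal is spanned by the elements y · `nortonRight` with y in the monoid and y a left
multiple of `nortonLeft`. Such a y has all descents of β; if it has another one, the product
vanishes. -/
theorem finrank_span_norton_le (β : Composition n) :
    Module.finrank k ((Submodule.span (Hecke k n) {norton k β}).restrictScalars k) ≤
      (heckeMonoidOfDescents k β).ncard := by
  have hfin : (heckeMonoidOfDescents k β).Finite := finite_heckeMonoid.subset fun y hy => hy.1
  let S : Set (Hecke k n) := (fun y => y * nortonRight k β) '' heckeMonoidOfDescents k β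
  have hS : S.Finite := hfin.image _
  have hle : (Submodule.span (Hecke k n) {norton k β}).restrictScalars k ≤ Submodule.span k S := by
    intro x hx
    rw [Submodule.restrictScalars_mem, Submodule.mem_span_singleton] at hx
    obtain ⟨h, rfl⟩ := hx
    have hh : h ∈ Submodule.span k (heckeMonoid k n : Set (Hecke k n)) := by
      rw [span_heckeMonoid]; trivial
    refine Submodule.span_induction (p := fun h _ => h • norton k β ∈ Submodule.span k S)
      ?_ ?_ ?_ ?_ hh
    · intro x hx
      have hy : x * nortonLeft k β ∈ heckeMonoid k n := Submonoid.mul_mem _ hx (nortonLeft_mem β)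
      rw [smul_eq_mul, norton, ← mul_assoc]
      by_cases hd : ∃ i, i + 1 < n ∧ i + 1 ∉ descentSet β ∧
          x * nortonLeft k β * Hecke.idem k n i = x * nortonLeft k β
      · obtain ⟨i, hi, hid, he⟩ := hd
        rw [← he, mul_assoc _ (Hecke.idem k n i), idem_mul_nortonRight hi hid, mul_zero]
        exact Submodule.zero_mem _
      · push Not at hd
        refine Submodule.subset_span ⟨x * nortonLeft k β, ⟨hy, fun i hi => ?_⟩, rfl⟩
        by_cases hid : i + 1 ∈ descentSet β
        · exact iff_of_true (by rw [mul_assoc, nortonLeft_mul_idem hi hid]) hid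
        · exact iff_of_false (hd i hi hid) hid
    · rw [zero_smul]; exact Submodule.zero_mem _
    · intro x y _ _ hx hy
      rw [add_smul]; exact Submodule.add_mem _ hx hy
    · intro c x _ hx
      rw [smul_assoc]; exact Submodule.smul_mem _ c hx
  calc _ ≤ Module.finrank k (Submodule.span k S) := Submodule.finrank_mono hle
    _ ≤ S.ncard := by
      have := hS.fintype
      rw [Set.ncard_eq_toFinset_card']
      exact finrank_span_le_card S
    _ ≤ _ := Set.ncard_image_le hfin

theorem sum_ncard_heckeMonoidOfDescents_le :
    ∑ β : Composition n, (heckeMonoidOfDescents k β).ncard ≤ Module.finrank k (Hecke k n) := by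
  classical
  have hfin : ∀ β : Composition n, (heckeMonoidOfDescents k β).Finite := fun β =>
    finite_heckeMonoid.subset fun y hy => hy.1
  calc ∑ β : Composition n, (heckeMonoidOfDescents k β).ncard
      = ∑ β : Composition n, (hfin β).toFinset.card := by
        refine Finset.sum_congr rfl fun β _ => ?_
        rw [Set.ncard_eq_toFinset_card _ (hfin β)]
    _ = (Finset.univ.biUnion fun β => (hfin β).toFinset).card := by
        rw [Finset.card_biUnion]
        intro β _ γ _ hne
        rw [Function.onFun_apply, Finset.disjoint_left]
        intro y hy hy'
        rw [Set.Finite.mem_toFinset] at hy hy'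
        apply hne
        apply composition_ext
        intro d h0 hd
        obtain ⟨i, rfl⟩ : ∃ i, d = i + 1 := ⟨d - 1, by omega⟩
        rw [← hy.2 i hd, hy'.2 i hd]
    _ ≤ (finite_heckeMonoid (k := k) (n := n)).toFinset.card := by
        apply Finset.card_le_card
        intro y hy
        simp only [Finset.mem_biUnion, Finset.mem_univ, true_and, Set.Finite.mem_toFinset] at hy ⊢
        obtain ⟨β, hβ⟩ := hy
        exact hβ.1
    _ = (heckeMonoid k n : Set (Hecke k n)).ncard := by
        rw [Set.ncard_eq_toFinset_card _ finite_heckeMonoid]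
    _ ≤ _ := ncard_heckeMonoid_le

variable {Q : Composition n → Type*} [∀ β, AddCommGroup (Q β)] [∀ β, Module (Hecke k n) (Q β)]

/-- The regular module is the direct sum of the projective covers of the simple modules. -/
theorem exists_regular_equiv {q : ∀ β, Q β →ₗ[Hecke k n] SimpleMod k β}
    (hq : ∀ β, IsProjectiveCover (q β)) :
    Nonempty (Hecke k n ≃ₗ[Hecke k n] ⨁ β, Q β) := by
  refine exists_equiv_directSum_covers hq (fun β => β)
    (fun β => LinearMap.toSpanSingleton (Hecke k n) (SimpleMod k β) ((SimpleMod.val β).symm 1))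
    ?_ ?_
  · intro γ f x hx
    have h1 := congrArg (SimpleMod.val γ) (hx γ)
    rw [LinearMap.toSpanSingleton_apply, SimpleMod.val_smul, LinearEquiv.apply_symm_apply, mul_one,
      map_zero] at h1
    rw [← mul_one x, ← smul_eq_mul, f.map_smul]
    apply (SimpleMod.val γ).injective
    rw [SimpleMod.val_smul, h1, zero_mul, map_zero]
  · intro γ c hc hsum
    have h1 := hsum 1
    simp only [LinearMap.toSpanSingleton_apply, one_smul, LinearEquiv.apply_symm_apply,
      mul_one] at h1
    rw [Finset.sum_eq_single γ (fun b _ hb => by_contra fun h => hb (hc b h)) (by simp)] at h1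
    funext b
    by_contra h
    have h2 := hc b h
    subst h2
    exact h h1

variable [∀ β, Module k (Q β)] [∀ β, IsScalarTower k (Hecke k n) (Q β)]

/-- Norton's generator generates a projective cover: the annihilator of its image in the projective
cover of `S_β` annihilates the generator itself. -/
theorem exists_norton_section {q : ∀ β, Q β →ₗ[Hecke k n] SimpleMod k β}
    (hq : ∀ β, IsProjectiveCover (q β)) (β : Composition n) {v : Q β} (hv : q β v ≠ 0) :
    ∃ g : Q β →ₗ[Hecke k n] Hecke k n, g (norton k β • v) = norton k β := by
  have hfin : ∀ β, Module.Finite k (Q β) := fun β => by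
    have := (hq β).finite
    exact Module.Finite.trans (Hecke k n) (Q β)
  let L : ∀ β : Composition n, Submodule (Hecke k n) (Hecke k n) := fun β =>
    Submodule.span (Hecke k n) {norton k β}
  let r : ∀ (β : Composition n) (v : Q β), L β →ₗ[Hecke k n] Q β := fun β v =>
    LinearMap.toSpanSingleton (Hecke k n) (Q β) v ∘ₗ (L β).subtype
  -- The image of Norton's element has nonzero image in S_β, so it generates the projective cover.
  have hr : ∀ (β : Composition n) (v : Q β), q β v ≠ 0 → Function.Surjective (r β v) := by
    intro β v hv y
    have h1 : q β (norton k β • v) ≠ 0 := by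
      rw [map_smul, SimpleMod.smul_eq, simpleChar_norton, one_smul]; exact hv
    have hy : y ∈ Submodule.span (Hecke k n) {norton k β • v} := by
      rw [(hq β).span_eq_top h1]; trivial
    obtain ⟨h, rfl⟩ := Submodule.mem_span_singleton.1 hy
    refine ⟨⟨h • norton k β, Submodule.smul_mem _ _ (Submodule.mem_span_singleton_self _)⟩, ?_⟩
    change (h • norton k β) • v = _
    rw [smul_assoc]
  have hle : ∀ β, Module.finrank k (Q β) ≤ Module.finrank k ((L β).restrictScalars k) := by
    intro β
    obtain ⟨w, hw⟩ := (hq β).exists_val_eq_one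
    exact LinearMap.finrank_le_finrank_of_surjective (f := (r β w).restrictScalars k)
      (hr β w fun h => by simp [h] at hw)
  obtain ⟨e⟩ := exists_regular_equiv hq
  have hsum : Module.finrank k (Hecke k n) = ∑ β, Module.finrank k (Q β) := by
    rw [← Module.finrank_directSum]
    exact (e.restrictScalars k).finrank_eq
  -- Sandwich: dim H = ∑ dim Q β ≤ ∑ dim L β ≤ ∑ (number of monoid elements with descents β) ≤ dim
  -- H, so equality holds in each summand.
  have heq : Module.finrank k (Q β) = Module.finrank k ((L β).restrictScalars k) := by
    have h2 : ∑ β, Module.finrank k (Q β) = ∑ β, Module.finrank k ((L β).restrictScalars k) := by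
      apply le_antisymm (Finset.sum_le_sum fun β _ => hle β)
      rw [← hsum]
      exact (Finset.sum_le_sum fun β _ => finrank_span_norton_le β).trans
        sum_ncard_heckeMonoidOfDescents_le
    exact (Finset.sum_eq_sum_iff_of_le fun β _ => hle β).1 h2 β (Finset.mem_univ β)
  have hbij : Function.Bijective (r β v) := by
    refine ⟨?_, hr β v hv⟩
    exact (LinearMap.injective_iff_surjective_of_finrank_eq_finrank
      (f := ((r β v).restrictScalars k : (L β).restrictScalars k →ₗ[k] Q β)) heq.symm).2 (hr β v hv)
  let E := LinearEquiv.ofBijective (r β v) hbij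
  refine ⟨(L β).subtype ∘ₗ E.symm.toLinearMap, ?_⟩
  have : norton k β • v = E ⟨norton k β, Submodule.mem_span_singleton_self _⟩ := rfl
  rw [this, LinearMap.comp_apply, LinearEquiv.coe_coe, LinearEquiv.symm_apply_apply]
  rfl

end Norton

/-! ### Induced modules -/

section Induced

variable {k : Type u} [Field k] {B A : Type u} [Ring B] [Ring A] [Algebra k B] [Algebra k A]
variable (f : B →ₐ[k] A)
variable {P : Type v} [AddCommGroup P] [Module k P] [Module B P]

instance : IsScalarTower k A (Ind f P) :=
  inferInstanceAs (IsScalarTower k A ((A ⊗[k] P) ⧸ indRel f P))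

variable (P) in
/-- The quotient map `A ⊗_k P → A ⊗_B P`. -/
def Ind.mk : A ⊗[k] P →ₗ[A] Ind f P := (indRel f P).mkQ

theorem Ind.mk_surjective : Function.Surjective (Ind.mk f P) := (indRel f P).mkQ_surjective

theorem Ind.mk_tmul (a : A) (p : P) : Ind.mk f P (a ⊗ₜ[k] p) = Ind.tmul f a p := rfl

theorem Ind.smul_tmul (a x : A) (p : P) : a • Ind.tmul f x p = Ind.tmul f (a * x) p := by
  rw [← mk_tmul, ← map_smul, TensorProduct.smul_tmul', smul_eq_mul, mk_tmul]

theorem Ind.tmul_eq_smul (x : A) (p : P) : Ind.tmul f x p = x • Ind.tmul f 1 p := by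
  rw [smul_tmul, mul_one]

theorem Ind.tmul_mul (x : A) (b : B) (p : P) :
    Ind.tmul f (x * f b) p = Ind.tmul f x (b • p) := by
  rw [← sub_eq_zero, ← mk_tmul, ← mk_tmul, ← map_sub]
  exact (Submodule.Quotient.mk_eq_zero _).2 (Submodule.subset_span ⟨x, b, p, rfl⟩)

variable (P) in
/-- The bilinear map `(x, p) ↦ x ⊗ p`. -/
def Ind.tmulₗ : A →ₗ[k] P →ₗ[k] Ind f P :=
  (TensorProduct.mk k A P).compr₂ ((Ind.mk f P).restrictScalars k)

theorem Ind.tmulₗ_apply (x : A) (p : P) : Ind.tmulₗ f P x p = Ind.tmul f x p := rfl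

variable {f}

@[elab_as_elim]
theorem Ind.induction_on {C : Ind f P → Prop} (z : Ind f P) (zero : C 0)
    (tmul : ∀ x p, C (Ind.tmul f x p)) (add : ∀ y z, C y → C z → C (y + z)) : C z := by
  obtain ⟨z, rfl⟩ := Ind.mk_surjective f z
  induction z using TensorProduct.induction_on with
  | zero => rw [map_zero]; exact zero
  | tmul x p => exact tmul x p
  | add y z hy hz => rw [map_add]; exact add _ _ hy hz

variable {N : Type w} [AddCommGroup N] [Module A N]

theorem Ind.hom_ext {g h : Ind f P →ₗ[A] N} (H : ∀ p, g (Ind.tmul f 1 p) = h (Ind.tmul f 1 p)) :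
    g = h := by
  refine LinearMap.ext fun z => ?_
  induction z using Ind.induction_on with
  | zero => rw [map_zero, map_zero]
  | tmul x p => rw [tmul_eq_smul, map_smul, map_smul, H]
  | add y z hy hz => rw [map_add, map_add, hy, hz]

variable [Module k N] [IsScalarTower k A N]

/-- The universal property of the induced module. -/
def Ind.lift (φ : P →ₗ[k] N) (hφ : ∀ b p, φ (b • p) = f b • φ p) : Ind f P →ₗ[A] N :=
  (indRel f P).liftQ (TensorProduct.AlgebraTensorModule.lift
    (LinearMap.toSpanSingleton A (P →ₗ[k] N) φ)) (by
      rw [indRel, Submodule.span_le]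
      rintro _ ⟨x, b, p, rfl⟩
      change TensorProduct.AlgebraTensorModule.lift _ _ = 0
      rw [map_sub, TensorProduct.AlgebraTensorModule.lift_tmul,
        TensorProduct.AlgebraTensorModule.lift_tmul]
      change (x * f b) • φ p - x • φ (b • p) = 0
      rw [hφ, mul_smul, sub_self])

theorem Ind.lift_tmul (φ : P →ₗ[k] N) (hφ : ∀ b p, φ (b • p) = f b • φ p) (x : A) (p : P) :
    Ind.lift φ hφ (Ind.tmul f x p) = x • φ p := rfl

variable {P' : Type*} [AddCommGroup P'] [Module k P'] [Module B P'] [IsScalarTower k B P]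
  [IsScalarTower k B P']

variable (f) in
/-- Functoriality of induction. -/
def Ind.map (g : P →ₗ[B] P') : Ind f P →ₗ[A] Ind f P' :=
  Ind.lift ((Ind.tmulₗ f P' 1) ∘ₗ g.restrictScalars k) fun b p => by
    change Ind.tmul f 1 (g (b • p)) = f b • Ind.tmul f 1 (g p)
    rw [map_smul, smul_tmul, mul_one, ← tmul_mul, one_mul]

theorem Ind.map_tmul (g : P →ₗ[B] P') (x : A) (p : P) :
    Ind.map f g (Ind.tmul f x p) = Ind.tmul f x (g p) := by
  rw [map, lift_tmul]
  exact (tmul_eq_smul f x (g p)).symm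

end Induced

/-! ### The generators of the 0-Hecke-Clifford algebra -/

section HCAlgebra

variable {k : Type u} [Field k] {n : ℕ}

/-- The position of the first strand on which `T_i` acts. -/
def TIdx.fst (i : TIdx n) : Fin n := ⟨i.1, Nat.lt_of_succ_lt i.2⟩

/-- The position of the second strand on which `T_i` acts. -/
def TIdx.snd (i : TIdx n) : Fin n := ⟨i.1 + 1, i.2⟩

theorem TIdx.fst_ne_snd (i : TIdx n) : i.fst ≠ i.snd := by
  simp [fst, snd]

theorem HC.T_mul_self (i : TIdx n) : HC.T k i * HC.T k i = -HC.T k i := by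
  simpa using HC.rel k (HCRel.sq i)

theorem HC.c_mul_self (j : Fin n) : HC.c k j * HC.c k j = -1 := by
  simpa using HC.rel k (HCRel.cliffSq j)

theorem HC.c_anticomm {i j : Fin n} (h : i ≠ j) : HC.c k i * HC.c k j = -(HC.c k j * HC.c k i) := by
  simpa using HC.rel k (HCRel.cliffAnti i j h)

theorem HC.T_mul_c {i : TIdx n} {j : Fin n} (h : j ≠ i.fst) (h' : j ≠ i.snd) :
    HC.T k i * HC.c k j = HC.c k j * HC.T k i := by
  simpa using HC.rel k (HCRel.crossComm i j (fun e => h (Fin.ext e)) (fun e => h' (Fin.ext e)))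

theorem HC.T_mul_c_fst (i : TIdx n) :
    HC.T k i * HC.c k i.fst = HC.c k i.snd * HC.T k i := by
  simpa [TIdx.fst, TIdx.snd] using HC.rel k (HCRel.crossUp i)

theorem HC.T_add_one_mul_c_snd (i : TIdx n) :
    (HC.T k i + 1) * HC.c k i.snd = HC.c k i.fst * (HC.T k i + 1) := by
  simpa [TIdx.fst, TIdx.snd] using HC.rel k (HCRel.crossDown i)

theorem HC.T_mul_c_snd (i : TIdx n) : HC.T k i * HC.c k i.snd =
    HC.c k i.fst * HC.T k i + HC.c k i.fst - HC.c k i.snd := by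
  have h := HC.T_add_one_mul_c_snd (k := k) i
  rw [add_mul, mul_add, one_mul, mul_one] at h
  rw [← h]; abel

/-- The universal property of the 0-Hecke-Clifford algebra. -/
def HC.lift {A : Type*} [Ring A] [Algebra k A] (g : HCGen n → A)
    (h : ∀ x y, HCRel k n x y → FreeAlgebra.lift k g x = FreeAlgebra.lift k g y) :
    HC k n →ₐ[k] A :=
  RingQuot.liftAlgHom k ⟨FreeAlgebra.lift k g, fun _ _ hxy => h _ _ hxy⟩

theorem HC.lift_gen {A : Type*} [Ring A] [Algebra k A] {g : HCGen n → A} {h} (x : HCGen n) :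
    HC.lift (k := k) g h (HC.gen k x) = g x :=
  (RingQuot.liftAlgHom_mkAlgHom_apply k _ _ _).trans (FreeAlgebra.lift_ι_apply _ _)

theorem HC.adjoin_gen : Algebra.adjoin k (Set.range (HC.gen k (n := n))) = ⊤ := by
  rw [eq_top_iff]
  rintro x -
  obtain ⟨y, rfl⟩ := RingQuot.mkAlgHom_surjective k (HCRel k n) x
  induction y using FreeAlgebra.induction with
  | grade0 r => rw [AlgHom.commutes]; exact Subalgebra.algebraMap_mem _ r
  | grade1 i => exact Algebra.subset_adjoin ⟨i, rfl⟩
  | mul a b ha hb => rw [map_mul]; exact Subalgebra.mul_mem _ ha hb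
  | add a b ha hb => rw [map_add]; exact Subalgebra.add_mem _ ha hb

/-- A `k`-linear map that commutes with the generators is linear. -/
theorem HC.map_smul_of_gen {V W : Type*} [AddCommGroup V] [Module k V] [Module (HC k n) V]
    [IsScalarTower k (HC k n) V] [AddCommGroup W] [Module k W] [Module (HC k n) W]
    [IsScalarTower k (HC k n) W] (f : V →ₗ[k] W)
    (h : ∀ (g : HCGen n) x, f (HC.gen k g • x) = HC.gen k g • f x) (a : HC k n) (x : V) :
    f (a • x) = a • f x := by
  have ha : a ∈ Algebra.adjoin k (Set.range (HC.gen k (n := n))) := by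
    rw [adjoin_gen]; trivial
  induction ha using Algebra.adjoin_induction generalizing x with
  | mem a ha => obtain ⟨g, rfl⟩ := ha; exact h g x
  | algebraMap r => rw [algebraMap_smul, algebraMap_smul, map_smul]
  | add a b _ _ ha hb => rw [add_smul, add_smul, map_add, ha, hb]
  | mul a b _ _ ha hb => rw [mul_smul, mul_smul, ha, hb]

theorem towerMap_gen (x : HCGen n) : towerMap k n (HC.gen k x) =
    Sum.elim (fun i : TIdx n => HC.T k (⟨i.1, Nat.lt_succ_of_lt i.2⟩ : TIdx (n + 1)))
        (fun j : Fin n => HC.c k j.castSucc) x :=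
  (RingQuot.liftAlgHom_mkAlgHom_apply k _ _ _).trans (FreeAlgebra.lift_ι_apply _ _)

theorem towerMap_heckeToHC (h : Hecke k n) :
    towerMap k n (heckeToHC k n h) = heckeToHC k (n + 1) (heckeTower k n h) := by
  have : (towerMap k n).comp (heckeToHC k n) = (heckeToHC k (n + 1)).comp (heckeTower k n) := by
    apply Hecke.algHom_ext
    intro i hi
    rw [AlgHom.comp_apply, AlgHom.comp_apply, heckeToHC_T hi, heckeTower_T hi,
      heckeToHC_T (by omega), towerMap_gen]
    rfl
  exact congrArg (fun f => f h) this

end HCAlgebra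

/-! ### The Clifford algebra -/

section Clifford

variable (k : Type u) [Field k] (n : ℕ)

/-- The defining relations of the Clifford algebra. -/
inductive CliffRel : FreeAlgebra k (Fin n) → FreeAlgebra k (Fin n) → Prop
  | sq (j : Fin n) : CliffRel (FreeAlgebra.ι k j * FreeAlgebra.ι k j) (-1)
  | anti (i j : Fin n) (h : i ≠ j) :
      CliffRel (FreeAlgebra.ι k i * FreeAlgebra.ι k j) (-(FreeAlgebra.ι k j * FreeAlgebra.ι k i))

/-- The Clifford algebra with generators `c_1, …, c_n` that anticommute and square to `-1`. -/
def Cliff : Type u := RingQuot (CliffRel k n)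

instance : Ring (Cliff k n) := inferInstanceAs (Ring (RingQuot (CliffRel k n)))
instance : Algebra k (Cliff k n) := inferInstanceAs (Algebra k (RingQuot (CliffRel k n)))

variable {n}

/-- The generators of the Clifford algebra. -/
def Cliff.c (j : Fin n) : Cliff k n := RingQuot.mkAlgHom k (CliffRel k n) (FreeAlgebra.ι k j)

variable {k}

theorem Cliff.c_mul_self (j : Fin n) : c k j * c k j = -1 := by
  have := RingQuot.mkAlgHom_rel k (CliffRel.sq (k := k) j)
  rw [map_mul, map_neg, map_one] at this
  exact this

theorem Cliff.c_anticomm {i j : Fin n} (h : i ≠ j) : c k i * c k j = -(c k j * c k i) := by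
  have := RingQuot.mkAlgHom_rel k (CliffRel.anti (k := k) i j h)
  rw [map_mul, map_neg, map_mul] at this
  exact this

/-- The universal property of the Clifford algebra. -/
def Cliff.lift {A : Type*} [Ring A] [Algebra k A] (g : Fin n → A) (sq : ∀ j, g j * g j = -1)
    (anti : ∀ i j, i ≠ j → g i * g j = -(g j * g i)) : Cliff k n →ₐ[k] A :=
  RingQuot.liftAlgHom k ⟨FreeAlgebra.lift k g, by
    intro x y h
    cases h with
    | sq j => simpa using sq j
    | anti i j h => simpa using anti i j h⟩

theorem Cliff.lift_c {A : Type*} [Ring A] [Algebra k A] {g : Fin n → A} {sq anti} (j : Fin n) :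
    Cliff.lift (k := k) g sq anti (c k j) = g j :=
  (RingQuot.liftAlgHom_mkAlgHom_apply k _ _ _).trans (FreeAlgebra.lift_ι_apply _ _)

theorem Cliff.adjoin_c : Algebra.adjoin k (Set.range (c k (n := n))) = ⊤ := by
  rw [eq_top_iff]
  rintro x -
  obtain ⟨y, rfl⟩ := RingQuot.mkAlgHom_surjective k (CliffRel k n) x
  induction y using FreeAlgebra.induction with
  | grade0 r => rw [AlgHom.commutes]; exact Subalgebra.algebraMap_mem _ r
  | grade1 i => exact Algebra.subset_adjoin ⟨i, rfl⟩
  | mul a b ha hb => rw [map_mul]; exact Subalgebra.mul_mem _ ha hb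
  | add a b ha hb => rw [map_add]; exact Subalgebra.add_mem _ ha hb

theorem Cliff.algHom_ext {A : Type*} [Ring A] [Algebra k A] {f g : Cliff k n →ₐ[k] A}
    (h : ∀ j, f (c k j) = g (c k j)) : f = g := by
  apply AlgHom.ext_of_adjoin_eq_top Cliff.adjoin_c
  rintro _ ⟨x, rfl⟩
  exact h x

/-- A subspace that contains `1` and is stable under left multiplication by the generators is the
whole Clifford algebra. -/
theorem Cliff.eq_top {S : Submodule k (Cliff k n)} (one : 1 ∈ S)
    (mul : ∀ j, ∀ x ∈ S, c k j * x ∈ S) : S = ⊤ := by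
  rw [eq_top_iff]
  rintro a -
  have ha : a ∈ Algebra.adjoin k (Set.range (c k (n := n))) := by rw [adjoin_c]; trivial
  suffices H : ∀ x ∈ S, a * x ∈ S by simpa using H 1 one
  induction ha using Algebra.adjoin_induction with
  | mem a ha => obtain ⟨j, rfl⟩ := ha; exact mul j
  | algebraMap r => intro x hx; rw [← Algebra.smul_def]; exact S.smul_mem r hx
  | add a b _ _ ha hb => intro x hx; rw [add_mul]; exact S.add_mem (ha x hx) (hb x hx)
  | mul a b _ _ ha hb => intro x hx; rw [mul_assoc]; exact ha _ (hb x hx)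

variable (k n) in
/-- The inclusion of the Clifford algebra into the 0-Hecke-Clifford algebra. -/
def cliffToHC : Cliff k n →ₐ[k] HC k n :=
  Cliff.lift (HC.c k) HC.c_mul_self fun _ _ h => HC.c_anticomm h

theorem cliffToHC_c (j : Fin n) : cliffToHC k n (Cliff.c k j) = HC.c k j := Cliff.lift_c j

variable (k n) in
/-- The embedding of the Clifford algebra of rank `n` into that of rank `n + 1`. -/
def Cliff.tower : Cliff k n →ₐ[k] Cliff k (n + 1) :=
  Cliff.lift (fun j => c k j.castSucc) (fun _ => c_mul_self _)
    fun _ _ h => c_anticomm fun e => h (Fin.castSucc_injective n e)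

theorem Cliff.tower_c (j : Fin n) : tower k n (c k j) = c k j.castSucc := lift_c j

/-- The parity automorphism of the Clifford algebra. -/
def Cliff.parity : Cliff k n →ₐ[k] Cliff k n :=
  Cliff.lift (fun j => -c k j) (fun j => by rw [neg_mul_neg, c_mul_self])
    fun _ _ h => by rw [neg_mul_neg, neg_mul_neg, c_anticomm h]

theorem Cliff.parity_c (j : Fin n) : parity (c k j) = -c k j := lift_c j

theorem Cliff.parity_parity (x : Cliff k n) : parity (parity x) = x := by
  have : (parity (k := k) (n := n)).comp parity = AlgHom.id k _ :=
    algHom_ext fun j => by simp [parity_c]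
  exact congrArg (fun f => f x) this

theorem Cliff.c_last_mul_tower (x : Cliff k n) :
    c k (Fin.last n) * tower k n x = tower k n (parity x) * c k (Fin.last n) := by
  let S : Submodule k (Cliff k n) := LinearMap.eqLocus
    (LinearMap.mulLeft k (c k (Fin.last n)) ∘ₗ (tower k n).toLinearMap)
    (LinearMap.mulRight k (c k (Fin.last n)) ∘ₗ (tower k n).toLinearMap ∘ₗ parity.toLinearMap)
  have hS : ∀ x, x ∈ S ↔ c k (Fin.last n) * tower k n x =
    tower k n (parity x) * c k (Fin.last n) := fun x => Iff.rfl
  have : S = ⊤ := by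
    apply Cliff.eq_top
    · rw [hS]; simp
    · intro j x hx
      rw [hS] at hx ⊢
      rw [map_mul, map_mul, map_mul, parity_c, map_neg, ← mul_assoc, tower_c,
        c_anticomm (Fin.castSucc_lt_last j).ne', neg_mul, mul_assoc, hx, neg_mul, neg_mul, mul_assoc]
  rw [← hS, this]; trivial

/-- The decomposition of the Clifford algebra of rank `n + 1`. -/
def Cliff.split : (Cliff k n × Cliff k n) →ₗ[k] Cliff k (n + 1) :=
  LinearMap.coprod (tower k n).toLinearMap
    (LinearMap.mulRight k (c k (Fin.last n)) ∘ₗ (tower k n).toLinearMap)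

theorem Cliff.split_apply (x y : Cliff k n) :
    split (x, y) = tower k n x + tower k n y * c k (Fin.last n) := rfl

/-- The last generator as an operator on pairs. -/
def Cliff.lastOp : Module.End k (Cliff k n × Cliff k n) :=
  -- With c the last generator and a bar for parity, c(x + yc) = -ȳ + x̄c.
  LinearMap.prod (-(parity.toLinearMap ∘ₗ LinearMap.snd k _ _))
    (parity.toLinearMap ∘ₗ LinearMap.fst k _ _)

theorem Cliff.lastOp_apply (s : Cliff k n × Cliff k n) :
    lastOp s = (-parity s.2, parity s.1) := rfl

/-- The left regular action on pairs. -/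
def Cliff.diagOp : Cliff k n →ₐ[k] Module.End k (Cliff k n × Cliff k n) :=
  Algebra.lsmul k k _

theorem Cliff.diagOp_apply (x : Cliff k n) (s : Cliff k n × Cliff k n) :
    diagOp x s = (x * s.1, x * s.2) := rfl

theorem Cliff.lastOp_mul_diagOp (j : Fin n) :
    lastOp * diagOp (c k j) = -(diagOp (c k j) * lastOp) := by
  refine LinearMap.ext fun s => ?_
  simp [Module.End.mul_apply, lastOp_apply, diagOp_apply, parity_c]

/-- The action of the Clifford algebra of rank `n + 1` on pairs. -/
def Cliff.pairAction : Cliff k (n + 1) →ₐ[k] Module.End k (Cliff k n × Cliff k n) :=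
  Cliff.lift (Fin.lastCases lastOp fun j => diagOp (c k j)) (by
    intro j
    cases j using Fin.lastCases with
    | last =>
      rw [Fin.lastCases_last]
      refine LinearMap.ext fun s => ?_
      simp [Module.End.mul_apply, lastOp_apply, parity_parity, Prod.ext_iff]
    | cast j => rw [Fin.lastCases_castSucc, ← map_mul, c_mul_self, map_neg, map_one]) (by
    intro i j h
    cases i using Fin.lastCases with
    | last =>
      cases j using Fin.lastCases with
      | last => exact absurd rfl h
      | cast j => rw [Fin.lastCases_castSucc, Fin.lastCases_last, lastOp_mul_diagOp]
    | cast i =>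
      cases j using Fin.lastCases with
      | last => rw [Fin.lastCases_castSucc, Fin.lastCases_last, lastOp_mul_diagOp, neg_neg]
      | cast j =>
        rw [Fin.lastCases_castSucc, Fin.lastCases_castSucc, ← map_mul,
          c_anticomm fun e => h (congrArg _ e), map_neg, map_mul])

/-- Injectivity: acting on the pair (1, 0) recovers (x, y). Surjectivity: the range contains 1 and
is stable under the generators. -/
theorem Cliff.split_bijective : Function.Bijective (split (k := k) (n := n)) := by
  constructor
  · have h1 : ∀ x : Cliff k n, pairAction (tower k n x) = diagOp x := fun x => by
      have : pairAction.comp (tower k n) = diagOp (k := k) := algHom_ext fun j => by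
        rw [AlgHom.comp_apply, tower_c, pairAction, lift_c, Fin.lastCases_castSucc]
      exact congrArg (fun f => f x) this
    have h2 : pairAction (c k (Fin.last n)) = lastOp := by
      rw [pairAction, lift_c, Fin.lastCases_last]
    apply Function.LeftInverse.injective (g := fun z => pairAction z (1, 0))
    rintro ⟨x, y⟩
    simp [split_apply, h1, h2, Module.End.mul_apply, lastOp_apply, diagOp_apply]
  · rw [← LinearMap.range_eq_top]
    apply Cliff.eq_top
    · exact ⟨(1, 0), by simp [split_apply]⟩
    · rintro j _ ⟨⟨x, y⟩, rfl⟩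
      cases j using Fin.lastCases with
      | last =>
        refine ⟨(-parity y, parity x), ?_⟩
        rw [split_apply, split_apply, mul_add, ← mul_assoc, c_last_mul_tower, c_last_mul_tower,
          mul_assoc, c_mul_self, map_neg, mul_neg, mul_one]
        exact add_comm _ _
      | cast j =>
        refine ⟨(c k j * x, c k j * y), ?_⟩
        rw [split_apply, split_apply, map_mul, map_mul, tower_c, mul_add, mul_assoc]

end Clifford

/-! ### The underlying space of an induced supermodule -/

section Operators

variable {E : Type*} [Ring E]

/-- These ring identities say that the defect of a Hecke relation moves past the Clifford generators
by the cross relations. A defect that kills 1 ⊗ P then kills all of Cl ⊗ P. -/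
theorem quadratic_mul_fst {T a b : E} (h1 : T * a = b * T) (h2 : T * b = a * T + a - b) :
    (T * T + T) * a = a * (T * T + T) := by
  rw [add_mul, mul_assoc, h1, ← mul_assoc, h2]
  noncomm_ring

theorem quadratic_mul_snd {T a b : E} (h1 : T * a = b * T) (h2 : T * b = a * T + a - b) :
    (T * T + T) * b = b * (T * T + T) := by
  rw [add_mul, mul_assoc, h2, mul_sub, mul_add, ← mul_assoc, h1, h2]
  noncomm_ring

theorem commutator_mul {T U x y z : E} (h1 : T * x = y * T + z) (h2 : U * x = x * U)
    (h3 : U * y = y * U) (h4 : U * z = z * U) : (T * U - U * T) * x = y * (T * U - U * T) := by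
  rw [sub_mul, mul_assoc, h2, ← mul_assoc, h1, mul_assoc, h1, mul_add, ← mul_assoc U y, h3, h4]
  noncomm_ring

/-! ### The braid defect and the three Clifford generators involved -/

section BraidOperators

variable {T U a b c : E}

theorem braid_mul_first (h1 : T * a = b * T) (h3 : T * c = c * T) (h4 : U * a = a * U)
    (h5 : U * b = c * U) : (T * U * T - U * T * U) * a = c * (T * U * T - U * T * U) := by
  have e1 : T * U * T * a = c * (T * U * T) := by
    rw [mul_assoc, h1, mul_assoc, ← mul_assoc U, h5, mul_assoc, ← mul_assoc T, h3]
    noncomm_ring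
  have e2 : U * T * U * a = c * (U * T * U) := by
    rw [mul_assoc, h4, mul_assoc, ← mul_assoc T, h1, mul_assoc, ← mul_assoc U, h5]
    noncomm_ring
  rw [sub_mul, e1, e2, mul_sub]

theorem braid_mul_second (h1 : T * a = b * T) (h2 : T * b = a * T + a - b) (h3 : T * c = c * T)
    (h4 : U * a = a * U) (h5 : U * b = c * U) (h6 : U * c = b * U + b - c) :
    (T * U * T - U * T * U) * b = b * (T * U * T - U * T * U) := by
  have e1 : T * U * T * b = b * (T * U * T) + b * T * U - c * T * U := by
    calc T * U * T * b = T * U * (T * b) := by noncomm_ring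
      _ = T * (U * a) * T + T * (U * a) - T * (U * b) := by rw [h2]; noncomm_ring
      _ = T * a * U * T + T * a * U - T * c * U := by rw [h4, h5]; noncomm_ring
      _ = _ := by rw [h1, h3]; noncomm_ring
  have e2 : U * T * U * b = b * (U * T * U) + b * T * U - c * T * U := by
    calc U * T * U * b = U * T * (U * b) := by noncomm_ring
      _ = U * (T * c) * U := by rw [h5]; noncomm_ring
      _ = U * c * T * U := by rw [h3]; noncomm_ring
      _ = _ := by rw [h6]; noncomm_ring
  rw [sub_mul, e1, e2]
  noncomm_ring

/-- Here the correction terms of the cross relations accumulate and cancel only modulo the quadratic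
relations, which must therefore be known before the braid relation. -/
theorem braid_mul_third (h2 : T * b = a * T + a - b) (h3 : T * c = c * T)
    (h4 : U * a = a * U) (h5 : U * b = c * U) (h6 : U * c = b * U + b - c)
    (hT : T * T = -T) (hU : U * U = -U) :
    (T * U * T - U * T * U) * c = a * (T * U * T - U * T * U) := by
  have e1 : T * U * T * c = a * (T * U * T) + a * (U * T) - b * (U * T) + c * T - b * T := by
    calc T * U * T * c = T * U * (T * c) := by noncomm_ring
      _ = T * (U * c) * T := by rw [h3]; noncomm_ring
      _ = (T * b) * U * T + (T * b) * T - (T * c) * T := by rw [h6]; noncomm_ring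
      _ = a * (T * U * T) + a * (U * T) - b * (U * T) + a * (T * T) + a * T - b * T
          - c * (T * T) := by rw [h2, h3]; noncomm_ring
      _ = _ := by rw [hT]; noncomm_ring
  have e2 : U * T * U * c = a * (U * T * U) + a * (U * T) - b * (U * T) + c * T - b * T := by
    calc U * T * U * c = U * T * (U * c) := by noncomm_ring
      _ = U * (T * b) * U + U * (T * b) - U * (T * c) := by rw [h6]; noncomm_ring
      _ = (U * a) * T * U + (U * a) * U - (U * b) * U + (U * a) * T + U * a - U * b
          - (U * c) * T := by rw [h2, h3]; noncomm_ring
      _ = a * (U * T * U) + a * (U * U) - c * (U * U) + a * (U * T) + a * U - c * U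
          - (b * (U * T) + b * T - c * T) := by rw [h4, h5, h6]; noncomm_ring
      _ = _ := by rw [hU]; noncomm_ring
  rw [sub_mul, e1, e2]
  noncomm_ring

end BraidOperators

end Operators

/-! ### Intertwining elements in the Clifford algebra -/

section Model

variable {k : Type u} [Field k] {n : ℕ}

/-- The automorphism of the Clifford algebra that exchanges two neighbouring generators. -/
def Cliff.swap (i : TIdx n) : Cliff k n →ₐ[k] Cliff k n :=
  Cliff.lift (fun j => c k (Equiv.swap i.fst i.snd j)) (fun _ => c_mul_self _)
    fun _ _ h => c_anticomm fun e => h ((Equiv.swap i.fst i.snd).injective e)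

theorem Cliff.swap_c_fst (i : TIdx n) : swap i (c k i.fst) = c k i.snd := by
  rw [swap, lift_c, Equiv.swap_apply_left]

theorem Cliff.swap_c_snd (i : TIdx n) : swap i (c k i.snd) = c k i.fst := by
  rw [swap, lift_c, Equiv.swap_apply_right]

theorem Cliff.swap_c {i : TIdx n} {j : Fin n} (h : j ≠ i.fst) (h' : j ≠ i.snd) :
    swap i (c k j) = c k j := by
  rw [swap, lift_c, Equiv.swap_apply_of_ne_of_ne h h']

/-- The element `m` such that `T_i + m` intertwines the action of the Clifford algebra with its
twist by the exchange of `c_i` and `c_{i+1}`. -/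
def Cliff.shift (k : Type u) [Field k] (i : TIdx n) : Cliff k n :=
  (2 : k)⁻¹ • (1 + c k i.fst * c k i.snd)

theorem Cliff.shift_mul_c_fst (i : TIdx n) :
    shift k i * c k i.fst = c k i.snd * shift k i := by
  have h : c k i.fst * c k i.snd = -(c k i.snd * c k i.fst) := c_anticomm i.fst_ne_snd
  have h1 : c k i.fst * c k i.snd * c k i.fst = c k i.snd := by
    rw [h, neg_mul, mul_assoc, c_mul_self, mul_neg, mul_one, neg_neg]
  have h2 : c k i.snd * (c k i.fst * c k i.snd) = c k i.fst := by
    rw [h, mul_neg, ← mul_assoc, c_mul_self, neg_mul, one_mul, neg_neg]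
  rw [shift, smul_mul_assoc, mul_smul_comm, add_mul, mul_add, h1, h2, one_mul, mul_one, add_comm]

theorem Cliff.shift_mul_c {i : TIdx n} {j : Fin n} (h : j ≠ i.fst) (h' : j ≠ i.snd) :
    shift k i * c k j = c k j * shift k i := by
  rw [shift, smul_mul_assoc, mul_smul_comm, add_mul, mul_add, one_mul, mul_one, mul_assoc,
    c_anticomm h'.symm, mul_neg, ← mul_assoc, c_anticomm h.symm, neg_mul, neg_neg, mul_assoc]

/-- The corrections are opposite to those in T_i c_{i+1} = c_i T_i + c_i - c_{i+1}, so they cancel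
in T_i + m. Dividing by 2 normalizes them. -/
theorem Cliff.shift_mul_c_snd [NeZero (2 : k)] (i : TIdx n) :
    shift k i * c k i.snd = c k i.fst * shift k i - c k i.fst + c k i.snd := by
  have h2 : (2 : k) ≠ 0 := NeZero.ne 2
  have e : c k i.fst - c k i.snd = (2 : k)⁻¹ • ((c k i.fst - c k i.snd) + (c k i.fst - c k i.snd)) := by
    rw [← two_smul k, smul_smul, inv_mul_cancel₀ h2, one_smul]
  rw [sub_add, e, shift, smul_mul_assoc, mul_smul_comm, ← smul_sub, add_mul, mul_add, mul_assoc,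
    c_mul_self, ← mul_assoc, c_mul_self]
  congr 1
  noncomm_ring

end Model

/-! ### The space Cl_n ⊗ P with its Clifford action -/

section ModelSpace

variable (k : Type u) [Field k] (n : ℕ) (P : Type v) [AddCommGroup P] [Module k P]

/-- The space `Cl_n ⊗ P`, on which the 0-Hecke-Clifford algebra acts. -/
def Model : Type (max u v) := Cliff k n ⊗[k] P

instance : AddCommGroup (Model k n P) := inferInstanceAs (AddCommGroup (Cliff k n ⊗[k] P))
instance : Module k (Model k n P) := inferInstanceAs (Module k (Cliff k n ⊗[k] P))

variable {k n P}

/-- The pure tensors. -/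
def Model.tmul : Cliff k n →ₗ[k] P →ₗ[k] Model k n P := TensorProduct.mk k (Cliff k n) P

theorem Model.hom_ext {N : Type*} [AddCommGroup N] [Module k N] {g h : Model k n P →ₗ[k] N}
    (H : ∀ x p, g (tmul x p) = h (tmul x p)) : g = h :=
  TensorProduct.ext' H

variable (P) in
/-- Left multiplication by `c_j` on `Cl_n ⊗ P`. -/
def cliffordOp (j : Fin n) : Module.End k (Model k n P) :=
  LinearMap.rTensor P (LinearMap.mulLeft k (Cliff.c k j))

theorem cliffordOp_tmul (j : Fin n) (x : Cliff k n) (p : P) :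
    cliffordOp P j (Model.tmul x p) = Model.tmul (Cliff.c k j * x) p := rfl

theorem cliffordOp_mul_self (j : Fin n) : cliffordOp (k := k) P j * cliffordOp P j = -1 := by
  refine Model.hom_ext fun x p => ?_
  rw [Module.End.mul_apply, cliffordOp_tmul, cliffordOp_tmul, ← mul_assoc, Cliff.c_mul_self,
    LinearMap.neg_apply, Module.End.one_apply, neg_mul, one_mul, map_neg, LinearMap.neg_apply]

theorem cliffordOp_anticomm {i j : Fin n} (h : i ≠ j) :
    cliffordOp (k := k) P i * cliffordOp P j = -(cliffordOp P j * cliffordOp P i) := by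
  refine Model.hom_ext fun x p => ?_
  rw [Module.End.mul_apply, cliffordOp_tmul, cliffordOp_tmul, ← mul_assoc, Cliff.c_anticomm h,
    LinearMap.neg_apply, Module.End.mul_apply, cliffordOp_tmul, cliffordOp_tmul, neg_mul,
    map_neg, LinearMap.neg_apply, mul_assoc]

/-- An operator on `Cl_n ⊗ P` that kills `1 ⊗ P` and that can be moved past the generators of the
Clifford algebra is zero. -/
theorem eq_zero_of_mul_cliffordOp {X : Module.End k (Model k n P)}
    (h1 : ∀ p, X (Model.tmul 1 p) = 0) (h2 : ∀ j, ∃ j', X * cliffordOp P j = cliffordOp P j' * X) :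
    X = 0 := by
  let S : Submodule k (Cliff k n) := ⨅ p : P, LinearMap.ker (X ∘ₗ Model.tmul.flip p)
  have hS : ∀ x, x ∈ S ↔ ∀ p, X (Model.tmul x p) = 0 := fun x => by
    simp [S, Submodule.mem_iInf]
  have htop : S = ⊤ := by
    apply Cliff.eq_top
    · rw [hS]; exact h1
    · intro j x hx
      rw [hS] at hx ⊢
      intro p
      obtain ⟨j', hj'⟩ := h2 j
      rw [← cliffordOp_tmul, ← Module.End.mul_apply, hj', Module.End.mul_apply, hx, map_zero]
  refine Model.hom_ext fun x p => ?_
  exact (hS x).1 (htop ▸ trivial) p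

end ModelSpace

/-! ### The action of the 0-Hecke-Clifford algebra and the PBW property -/

section ModelAction

variable {k : Type u} [Field k] {n : ℕ} (P : Type v) [AddCommGroup P] [Module k P]
variable [Module (Hecke k n) P] [IsScalarTower k (Hecke k n) P]

/-- The action of `T_i` on `Cl_n ⊗ P`. -/
def heckeOp (i : TIdx n) : Module.End k (Model k n P) :=
  -- Let s exchange the two generators and let m be the shift. The formula solves (T_i + m)(x ⊗ p) =
  -- s(x)(T_i + m)(1 ⊗ p) for T_i(x ⊗ p), with T_i(1 ⊗ p) = 1 ⊗ T_i p.
  TensorProduct.map (Cliff.swap i).toLinearMap (Module.toModuleEnd k P (Hecke.T k n i.1)) +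
    LinearMap.rTensor P (LinearMap.mulRight k (Cliff.shift k i) ∘ₗ (Cliff.swap i).toLinearMap -
      LinearMap.mulLeft k (Cliff.shift k i))

variable {P}

theorem heckeOp_tmul (i : TIdx n) (x : Cliff k n) (p : P) :
    heckeOp P i (Model.tmul x p) = Model.tmul (Cliff.swap i x) (Hecke.T k n i.1 • p) +
      Model.tmul (Cliff.swap i x * Cliff.shift k i - Cliff.shift k i * x) p := rfl

theorem heckeOp_one_tmul (i : TIdx n) (p : P) :
    heckeOp P i (Model.tmul (k := k) 1 p) = Model.tmul 1 (Hecke.T k n i.1 • p) := by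
  rw [heckeOp_tmul, map_one, one_mul, mul_one, sub_self, map_zero, LinearMap.zero_apply, add_zero]

theorem heckeOp_mul_cliffordOp {i : TIdx n} {j : Fin n} (h : j ≠ i.fst) (h' : j ≠ i.snd) :
    heckeOp P i * cliffordOp (k := k) P j = cliffordOp P j * heckeOp P i := by
  refine Model.hom_ext fun x p => ?_
  rw [Module.End.mul_apply, cliffordOp_tmul, heckeOp_tmul, Module.End.mul_apply, heckeOp_tmul,
    map_add, cliffordOp_tmul, cliffordOp_tmul, map_mul, Cliff.swap_c h h', mul_sub,
    ← mul_assoc (Cliff.shift k i), Cliff.shift_mul_c h h', mul_assoc, mul_assoc]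

theorem heckeOp_mul_cliffordOp_fst (i : TIdx n) :
    heckeOp P i * cliffordOp (k := k) P i.fst = cliffordOp P i.snd * heckeOp P i := by
  refine Model.hom_ext fun x p => ?_
  rw [Module.End.mul_apply, cliffordOp_tmul, heckeOp_tmul, Module.End.mul_apply, heckeOp_tmul,
    map_add, cliffordOp_tmul, cliffordOp_tmul, map_mul, Cliff.swap_c_fst, mul_sub,
    ← mul_assoc (Cliff.shift k i), Cliff.shift_mul_c_fst, mul_assoc, mul_assoc]

variable [NeZero (2 : k)]

theorem heckeOp_mul_cliffordOp_snd (i : TIdx n) :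
    heckeOp P i * cliffordOp (k := k) P i.snd =
      cliffordOp P i.fst * heckeOp P i + cliffordOp P i.fst - cliffordOp P i.snd := by
  refine Model.hom_ext fun x p => ?_
  rw [Module.End.mul_apply, cliffordOp_tmul, heckeOp_tmul, LinearMap.sub_apply,
    LinearMap.add_apply, Module.End.mul_apply, heckeOp_tmul,
    map_add, cliffordOp_tmul, cliffordOp_tmul, cliffordOp_tmul, cliffordOp_tmul, map_mul,
    Cliff.swap_c_snd, ← mul_assoc (Cliff.shift k i), Cliff.shift_mul_c_snd, add_assoc, add_sub_assoc,
    ← LinearMap.add_apply, ← LinearMap.sub_apply, ← map_add, ← map_sub]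
  congr 3
  noncomm_ring

theorem heckeOp_sq (i : TIdx n) : heckeOp (k := k) P i * heckeOp P i = -heckeOp P i := by
  rw [← add_eq_zero_iff_eq_neg]
  apply eq_zero_of_mul_cliffordOp
  · intro p
    rw [LinearMap.add_apply, Module.End.mul_apply, heckeOp_one_tmul, heckeOp_one_tmul, ← mul_smul,
      Hecke.T_mul_self, neg_smul, map_neg, neg_add_cancel]
  · intro j
    refine ⟨j, ?_⟩
    by_cases h : j = i.fst
    · subst h
      exact quadratic_mul_fst (heckeOp_mul_cliffordOp_fst i) (heckeOp_mul_cliffordOp_snd i)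
    by_cases h' : j = i.snd
    · subst h'
      exact quadratic_mul_snd (heckeOp_mul_cliffordOp_fst i) (heckeOp_mul_cliffordOp_snd i)
    have hc := heckeOp_mul_cliffordOp (k := k) (P := P) h h'
    rw [add_mul, mul_add, mul_assoc, hc, ← mul_assoc, hc, mul_assoc]

theorem commutator_heckeOp_mul {i l : TIdx n} (h : i.1 + 1 < l.1 ∨ l.1 + 1 < i.1) {j : Fin n}
    (hj : j = i.fst ∨ j = i.snd) : ∃ j', (heckeOp (k := k) P i * heckeOp P l -
      heckeOp P l * heckeOp P i) * cliffordOp P j =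
        cliffordOp P j' * (heckeOp P i * heckeOp P l - heckeOp P l * heckeOp P i) := by
  have h1 : i.fst ≠ l.fst := fun e => by simp [TIdx.fst] at e; omega
  have h2 : i.fst ≠ l.snd := fun e => by simp [TIdx.fst, TIdx.snd] at e; omega
  have h3 : i.snd ≠ l.fst := fun e => by simp [TIdx.fst, TIdx.snd] at e; omega
  have h4 : i.snd ≠ l.snd := fun e => by simp [TIdx.snd] at e; omega
  have ha := heckeOp_mul_cliffordOp (k := k) (P := P) h1 h2
  have hb := heckeOp_mul_cliffordOp (k := k) (P := P) h3 h4
  rcases hj with rfl | rfl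
  · refine ⟨i.snd, commutator_mul (z := (0 : Module.End k (Model k n P))) ?_ ha hb (by simp)⟩
    rw [heckeOp_mul_cliffordOp_fst, add_zero]
  · refine ⟨i.fst, commutator_mul (z := cliffordOp P i.fst - cliffordOp P i.snd) ?_ hb ha ?_⟩
    · rw [heckeOp_mul_cliffordOp_snd, add_sub_assoc]
    · rw [mul_sub, sub_mul, ha, hb]

theorem heckeOp_comm {i l : TIdx n} (h : i.1 + 1 < l.1 ∨ l.1 + 1 < i.1) :
    heckeOp (k := k) P i * heckeOp P l = heckeOp P l * heckeOp P i := by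
  rw [← sub_eq_zero]
  apply eq_zero_of_mul_cliffordOp
  · intro p
    rw [LinearMap.sub_apply, Module.End.mul_apply, Module.End.mul_apply, heckeOp_one_tmul,
      heckeOp_one_tmul, heckeOp_one_tmul, heckeOp_one_tmul, ← mul_smul, ← mul_smul]
    rcases h with h | h
    · rw [Hecke.isBraid.comm _ _ h, sub_self]
    · rw [Hecke.isBraid.comm _ _ h, sub_self]
  · intro j
    by_cases hi : j = i.fst ∨ j = i.snd
    · exact commutator_heckeOp_mul h hi
    by_cases hl : j = l.fst ∨ j = l.snd
    · obtain ⟨j', hj'⟩ := commutator_heckeOp_mul (k := k) (P := P) h.symm hl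
      refine ⟨j', ?_⟩
      rw [← neg_sub, neg_mul, hj', mul_neg]
    push Not at hi hl
    have h1 := heckeOp_mul_cliffordOp (k := k) (P := P) hi.1 hi.2
    have h2 := heckeOp_mul_cliffordOp (k := k) (P := P) hl.1 hl.2
    exact ⟨j, commutator_mul (z := (0 : Module.End k (Model k n P))) (by rw [h1, add_zero]) h2 h2 (by simp)⟩

theorem heckeOp_braid {i l : TIdx n} (h : l.1 = i.1 + 1) :
    heckeOp (k := k) P i * heckeOp P l * heckeOp P i =
      heckeOp P l * heckeOp P i * heckeOp P l := by
  rw [← sub_eq_zero]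
  apply eq_zero_of_mul_cliffordOp
  · intro p
    simp only [LinearMap.sub_apply, Module.End.mul_apply, heckeOp_one_tmul, ← mul_smul]
    rw [h, ← mul_assoc, ← mul_assoc, Hecke.isBraid.braid, sub_self]
  -- The two operators share a strand: a, b, c of the ring identities are `i.fst`, `i.snd` = `l.fst`
  -- and `l.snd`.
  · have hfs : l.fst = i.snd := Fin.ext h
    have n1 : i.fst ≠ l.fst := fun e => by simp [TIdx.fst] at e; omega
    have n2 : i.fst ≠ l.snd := fun e => by simp [TIdx.fst, TIdx.snd] at e; omega
    have n3 : l.snd ≠ i.snd := fun e => by simp [TIdx.snd] at e; omega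
    have h1 := heckeOp_mul_cliffordOp_fst (k := k) (P := P) i
    have h2 := heckeOp_mul_cliffordOp_snd (k := k) (P := P) i
    have h3 := heckeOp_mul_cliffordOp (k := k) (P := P) n2.symm n3
    have h4 := heckeOp_mul_cliffordOp (k := k) (P := P) n1 n2
    have h5 := heckeOp_mul_cliffordOp_fst (k := k) (P := P) l
    have h6 := heckeOp_mul_cliffordOp_snd (k := k) (P := P) l
    rw [hfs] at h5 h6
    intro j
    by_cases e1 : j = i.fst
    · subst e1
      exact ⟨l.snd, braid_mul_first h1 h3 h4 h5⟩
    by_cases e2 : j = i.snd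
    · subst e2
      exact ⟨i.snd, braid_mul_second h1 h2 h3 h4 h5 h6⟩
    by_cases e3 : j = l.snd
    · subst e3
      exact ⟨i.fst, braid_mul_third h2 h3 h4 h5 h6 (heckeOp_sq i) (heckeOp_sq l)⟩
    refine ⟨j, ?_⟩
    have hi := heckeOp_mul_cliffordOp (k := k) (P := P) e1 e2
    have hl := heckeOp_mul_cliffordOp (k := k) (P := P) (i := l) (by rwa [hfs]) e3
    have hiz : Commute (cliffordOp P j) (heckeOp (k := k) P i) := hi.symm
    have hlz : Commute (cliffordOp P j) (heckeOp (k := k) P l) := hl.symm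
    exact ((((hiz.mul_right hlz).mul_right hiz).sub_right
      ((hlz.mul_right hiz).mul_right hlz))).eq.symm

variable (k n P) in
/-- The action of the 0-Hecke-Clifford algebra on `Cl_n ⊗ P`. -/
def modelAction : HC k n →ₐ[k] Module.End k (Model k n P) :=
  HC.lift (Sum.elim (heckeOp P) (cliffordOp P)) (by
    intro x y h
    cases h with
    | sq i => simpa using heckeOp_sq i
    | comm i j h => simpa using heckeOp_comm h
    | braid i j h => simpa using heckeOp_braid h
    | cliffSq j => simpa using cliffordOp_mul_self j
    | cliffAnti i j h => simpa using cliffordOp_anticomm h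
    | crossComm i j h h' =>
      simpa using heckeOp_mul_cliffordOp (i := i) (j := j) (fun e => h (congrArg Fin.val e))
        fun e => h' (congrArg Fin.val e)
    | crossUp i => simpa [TIdx.fst, TIdx.snd] using heckeOp_mul_cliffordOp_fst i
    | crossDown i =>
      have h1 := heckeOp_mul_cliffordOp_snd (k := k) (P := P) i
      have h2 : (heckeOp P i + 1) * cliffordOp (k := k) P i.snd =
          cliffordOp P i.fst * (heckeOp P i + 1) := by
        rw [add_mul, mul_add, h1]; noncomm_ring
      simpa [TIdx.fst, TIdx.snd] using h2)

instance : Module (HC k n) (Model k n P) :=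
  Module.compHom (Model k n P) (modelAction k n P).toRingHom

theorem Model.smul_def (a : HC k n) (z : Model k n P) : a • z = modelAction k n P a z := rfl

theorem Model.c_smul (j : Fin n) (z : Model k n P) : HC.c k j • z = cliffordOp P j z := by
  rw [smul_def, modelAction, HC.lift_gen]; rfl

theorem Model.T_smul (i : TIdx n) (z : Model k n P) : HC.T k i • z = heckeOp P i z := by
  rw [smul_def, modelAction, HC.lift_gen]; rfl

instance : IsScalarTower k (HC k n) (Model k n P) :=
  ⟨fun r a z => by rw [Model.smul_def, Model.smul_def, map_smul, LinearMap.smul_apply]⟩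

theorem Model.heckeToHC_smul_one_tmul (h : Hecke k n) (p : P) :
    heckeToHC k n h • tmul (k := k) (n := n) 1 p = tmul 1 (h • p) :=
  (Hecke.map_smul_of_T ((Res.mk (heckeToHC k n) (Model k n P)).toLinearMap ∘ₗ tmul 1)
    (fun i hi p => by
      change Model.tmul (k := k) (n := n) 1 _ = heckeToHC k n _ • Model.tmul (k := k) (n := n) 1 p
      rw [heckeToHC_T hi, T_smul, heckeOp_one_tmul]) h p).symm

variable (k n P) in
/-- The comparison map from the induced module to `Cl_n ⊗ P`. -/
def toModel : IndHC k n P →ₗ[HC k n] Model k n P :=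
  Ind.lift (Model.tmul 1) fun h p => (Model.heckeToHC_smul_one_tmul h p).symm

theorem toModel_tmul (x : HC k n) (p : P) :
    toModel k n P (Ind.tmul _ x p) = x • Model.tmul 1 p := Ind.lift_tmul _ _ _ _

variable (k n P) in
/-- The comparison map from `Cl_n ⊗ P` to the induced module. -/
def ofModel : Model k n P →ₗ[k] IndHC k n P :=
  TensorProduct.lift (Ind.tmulₗ (heckeToHC k n) P ∘ₗ (cliffToHC k n).toLinearMap)

theorem ofModel_tmul (x : Cliff k n) (p : P) :
    ofModel k n P (Model.tmul x p) = Ind.tmul _ (cliffToHC k n x) p := rfl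

theorem ofModel_c_smul (j : Fin n) (z : Model k n P) :
    ofModel k n P (HC.c k j • z) = HC.c k j • ofModel k n P z := by
  have : ofModel k n P ∘ₗ cliffordOp P j =
      (Algebra.lsmul k k (IndHC k n P) (HC.c k j)) ∘ₗ ofModel k n P := by
    refine Model.hom_ext fun x p => ?_
    rw [LinearMap.comp_apply, LinearMap.comp_apply, cliffordOp_tmul, ofModel_tmul, ofModel_tmul,
      map_mul, cliffToHC_c, ← Ind.smul_tmul]
    rfl
  rw [Model.c_smul]
  exact congrArg (fun f => f z) this

/-- The identity holds on 1 ⊗ P and passes from x to c_j x, because both sides obey the same cross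
relations. -/
theorem ofModel_T_smul (i : TIdx n) (z : Model k n P) :
    ofModel k n P (HC.T k i • z) = HC.T k i • ofModel k n P z := by
  let g : Model k n P →ₗ[k] IndHC k n P := ofModel k n P ∘ₗ heckeOp P i -
    (Algebra.lsmul k k (IndHC k n P) (HC.T k i)) ∘ₗ ofModel k n P
  have hg : ∀ z, g z = ofModel k n P (HC.T k i • z) - HC.T k i • ofModel k n P z := fun z => by
    rw [Model.T_smul]; rfl
  let S : Submodule k (Cliff k n) := ⨅ p : P, LinearMap.ker (g ∘ₗ Model.tmul.flip p)
  have hS : ∀ x, x ∈ S ↔ ∀ p, ofModel k n P (HC.T k i • Model.tmul x p) =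
      HC.T k i • ofModel k n P (Model.tmul x p) := fun x => by
    simp [S, Submodule.mem_iInf, hg, sub_eq_zero]
  have htop : S = ⊤ := by
    apply Cliff.eq_top
    · rw [hS]
      intro p
      rw [Model.T_smul, heckeOp_one_tmul, ofModel_tmul, ofModel_tmul, map_one, Ind.smul_tmul,
        ← Ind.tmul_mul, heckeToHC_T i.2, one_mul, mul_one]
    · intro j x hx
      rw [hS] at hx ⊢
      intro p
      rw [← cliffordOp_tmul, ← Model.c_smul, ← mul_smul, ofModel_c_smul, ← mul_smul]
      by_cases h : j = i.fst
      · subst h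
        rw [HC.T_mul_c_fst, mul_smul, ofModel_c_smul, hx, mul_smul]
      by_cases h' : j = i.snd
      · subst h'
        rw [HC.T_mul_c_snd, sub_smul, add_smul, mul_smul, map_sub, map_add, ofModel_c_smul,
          ofModel_c_smul, ofModel_c_smul, hx, sub_smul, add_smul, mul_smul]
      rw [HC.T_mul_c h h', mul_smul, ofModel_c_smul, hx, mul_smul]
  have : g = 0 := Model.hom_ext fun x p => by
    rw [hg, (hS x).1 (htop ▸ trivial) p, sub_self]; rfl
  rw [← sub_eq_zero, ← hg, this]; rfl

theorem ofModel_smul (a : HC k n) (z : Model k n P) :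
    ofModel k n P (a • z) = a • ofModel k n P z := by
  refine HC.map_smul_of_gen _ (fun g z => ?_) a z
  cases g with
  | inl i => exact ofModel_T_smul i z
  | inr j => exact ofModel_c_smul j z

theorem Model.cliffToHC_smul_one_tmul (x : Cliff k n) (p : P) :
    cliffToHC k n x • tmul 1 p = tmul x p := by
  let S : Submodule k (Cliff k n) := LinearMap.eqLocus
    ((LinearMap.toSpanSingleton (HC k n) (Model k n P) (tmul 1 p)).restrictScalars k ∘ₗ
      (cliffToHC k n).toLinearMap) (tmul.flip p)
  have hS : ∀ x, x ∈ S ↔ cliffToHC k n x • tmul 1 p = tmul x p := fun x => Iff.rfl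
  have htop : S = ⊤ := by
    apply Cliff.eq_top
    · rw [hS, map_one, one_smul]
    · intro j x hx
      rw [hS] at hx ⊢
      rw [map_mul, mul_smul, hx, cliffToHC_c, c_smul, cliffordOp_tmul]
  exact (hS x).1 (htop ▸ trivial)

variable (k n P) in
/-- The Poincaré–Birkhoff–Witt property: `Cl_n ⊗ P` is the underlying space of the induced
module. -/
theorem ofModel_bijective : Function.Bijective (ofModel k n P) := by
  constructor
  · have : (toModel k n P).restrictScalars k ∘ₗ ofModel k n P = LinearMap.id :=
      Model.hom_ext fun x p => by
        rw [LinearMap.comp_apply, ofModel_tmul]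
        exact (toModel_tmul _ _).trans (Model.cliffToHC_smul_one_tmul x p)
    exact Function.LeftInverse.injective fun z => congrArg (fun f => f z) this
  · intro y
    induction y using Ind.induction_on with
    | zero => exact ⟨0, map_zero _⟩
    | tmul x p =>
      refine ⟨x • Model.tmul 1 p, ?_⟩
      rw [ofModel_smul, ofModel_tmul, map_one, Ind.smul_tmul, mul_one]
    | add y z hy hz =>
      obtain ⟨y, rfl⟩ := hy
      obtain ⟨z, rfl⟩ := hz
      exact ⟨y + z, map_add _ _ _⟩

end ModelAction

/-! ### Gradings -/

section Gradings

variable {k : Type u} [Field k] {n : ℕ}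

theorem HC.prod_mem_grading (l : List (HCGen n)) :
    (l.map (HC.gen k)).prod ∈ HC.grading k n ((l.countP Sum.isRight : ℕ) : ZMod 2) :=
  Submodule.subset_span ⟨l, rfl, rfl⟩

theorem HC.mul_mem_grading {d e f : ZMod 2} (h : d + e = f) {x y : HC k n}
    (hx : x ∈ HC.grading k n d) (hy : y ∈ HC.grading k n e) : x * y ∈ HC.grading k n f := by
  subst h
  have h := Submodule.mul_mem_mul hx hy
  rw [grading, grading, Submodule.span_mul_span] at h
  refine Submodule.span_mono ?_ h
  rintro _ ⟨_, ⟨l, rfl, rfl⟩, _, ⟨l', rfl, rfl⟩, rfl⟩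
  exact ⟨l ++ l', by simp, by simp⟩

theorem HC.one_mem_grading : (1 : HC k n) ∈ HC.grading k n 0 := prod_mem_grading []

theorem HC.T_mem_grading (i : TIdx n) : HC.T k i ∈ HC.grading k n 0 := by
  simpa using prod_mem_grading (k := k) [Sum.inl i]

theorem HC.c_mem_grading (j : Fin n) : HC.c k j ∈ HC.grading k n 1 := by
  simpa using prod_mem_grading (k := k) [Sum.inr j]

theorem HC.grading_sup : HC.grading k n 0 ⊔ HC.grading k n 1 = ⊤ := by
  rw [eq_top_iff]
  rintro x -
  have hx : x ∈ Algebra.adjoin k (Set.range (HC.gen k (n := n))) := by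
    rw [adjoin_gen]; trivial
  induction hx using Algebra.adjoin_induction with
  | mem x hx =>
    obtain ⟨i | j, rfl⟩ := hx
    · exact Submodule.mem_sup_left (T_mem_grading i)
    · exact Submodule.mem_sup_right (c_mem_grading j)
  | algebraMap r =>
    rw [Algebra.algebraMap_eq_smul_one]
    exact Submodule.mem_sup_left (Submodule.smul_mem _ _ one_mem_grading)
  | add x y _ _ hx hy => exact Submodule.add_mem _ hx hy
  | mul x y _ _ hx hy =>
    obtain ⟨x₀, hx₀, x₁, hx₁, rfl⟩ := Submodule.mem_sup.1 hx
    obtain ⟨y₀, hy₀, y₁, hy₁, rfl⟩ := Submodule.mem_sup.1 hy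
    rw [add_mul, mul_add, mul_add]
    exact Submodule.add_mem _
      (Submodule.add_mem _ (Submodule.mem_sup_left (mul_mem_grading (by decide) hx₀ hy₀))
        (Submodule.mem_sup_right (mul_mem_grading (by decide) hx₀ hy₁)))
      (Submodule.add_mem _ (Submodule.mem_sup_right (mul_mem_grading (by decide) hx₁ hy₀))
        (Submodule.mem_sup_left (mul_mem_grading (by decide) hx₁ hy₁)))

theorem HC.grading_one_eq_bot : HC.grading k 0 1 = ⊥ := by
  rw [grading, Submodule.span_eq_bot]
  rintro _ ⟨l | ⟨g, l⟩, rfl, h⟩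
  · simp at h
  · exact (g.elim (fun i => absurd i.2 (by omega)) fun j => j.elim0)

theorem heckeToHC_mem_grading (h : Hecke k n) : heckeToHC k n h ∈ HC.grading k n 0 := by
  have hh : h ∈ Algebra.adjoin k {x | ∃ i, i + 1 < n ∧ Hecke.T k n i = x} := by
    rw [Hecke.adjoin_T]; trivial
  induction hh using Algebra.adjoin_induction with
  | mem a ha => obtain ⟨i, hi, rfl⟩ := ha; rw [heckeToHC_T hi]; exact HC.T_mem_grading _
  | algebraMap r =>
    rw [AlgHom.commutes, Algebra.algebraMap_eq_smul_one]
    exact Submodule.smul_mem _ _ HC.one_mem_grading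
  | add a b _ _ ha hb => rw [map_add]; exact Submodule.add_mem _ ha hb
  | mul a b _ _ ha hb => rw [map_mul]; exact HC.mul_mem_grading (zero_add 0) ha hb

theorem towerMap_mem_grading {d : ZMod 2} {x : HC k n} (hx : x ∈ HC.grading k n d) :
    towerMap k n x ∈ HC.grading k (n + 1) d := by
  suffices H : HC.grading k n d ≤
      (HC.grading k (n + 1) d).comap (towerMap k n).toLinearMap from H hx
  rw [HC.grading, Submodule.span_le]
  rintro _ ⟨l, rfl, rfl⟩
  change towerMap k n _ ∈ HC.grading k (n + 1) _
  clear hx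
  induction l with
  | nil => simpa using HC.one_mem_grading
  | cons g l ih =>
    rw [List.map_cons, List.prod_cons, map_mul, towerMap_gen]
    cases g with
    | inl i => exact HC.mul_mem_grading (by simp) (HC.T_mem_grading _) ih
    | inr j =>
      rw [List.countP_cons_of_pos rfl, Nat.cast_succ]
      exact HC.mul_mem_grading (add_comm _ _) (HC.c_mem_grading _) ih

/-- The parity automorphism. -/
def HC.parity : HC k n →ₐ[k] HC k n :=
  HC.lift (Sum.elim (HC.T k) fun j => -HC.c k j) (by
    intro x y h
    cases h with
    | sq i => simpa using T_mul_self i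
    | comm i j h => simpa using HC.rel k (HCRel.comm i j h)
    | braid i j h => simpa using HC.rel k (HCRel.braid i j h)
    | cliffSq j => simpa using c_mul_self j
    | cliffAnti i j h => simpa using c_anticomm h
    | crossComm i j h h' => simpa using HC.rel k (HCRel.crossComm i j h h')
    | crossUp i => simpa using HC.rel k (HCRel.crossUp i)
    | crossDown i => simpa using congrArg Neg.neg (HC.rel k (HCRel.crossDown i)))

theorem HC.parity_eq {d : ZMod 2} {x : HC k n} (hx : x ∈ HC.grading k n d) :
    parity x = (-1 : k) ^ d.val • x := by
  suffices H : HC.grading k n d ≤ LinearMap.eqLocus parity.toLinearMap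
      ((-1 : k) ^ d.val • LinearMap.id) from H hx
  rw [HC.grading, Submodule.span_le]
  rintro _ ⟨l, rfl, rfl⟩
  change parity _ = (-1 : k) ^ _ • (l.map (HC.gen k)).prod
  have h2 : ∀ m : ℕ, (-1 : k) ^ (m : ZMod 2).val = (-1) ^ m := fun m => by
    rw [ZMod.val_natCast, ← neg_one_pow_eq_pow_mod_two]
  rw [h2]
  clear hx
  induction l with
  | nil => simp
  | cons g l ih =>
    rw [List.map_cons, List.prod_cons, map_mul, ih, parity, lift_gen]
    cases g with
    | inl i => simp
    | inr j =>
      rw [List.countP_cons_of_pos rfl, pow_succ]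
      simp

variable {P : Type v} [AddCommGroup P] [Module k P] [Module (Hecke k n) P]

theorem IndHC.tmul_mem_grading {d : ZMod 2} {x : HC k n} (hx : x ∈ HC.grading k n d) (p : P) :
    Ind.tmul _ x p ∈ IndHC.grading k n P d :=
  Submodule.subset_span ⟨x, hx, p, rfl⟩

theorem IndHC.grading_le {W : Type*} [AddCommGroup W] [Module k W] {d : ZMod 2}
    {S : Submodule k W} {g : IndHC k n P →ₗ[k] W}
    (h : ∀ x ∈ HC.grading k n d, ∀ p, g (Ind.tmul _ x p) ∈ S) {z : IndHC k n P}
    (hz : z ∈ IndHC.grading k n P d) : g z ∈ S := by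
  suffices H : IndHC.grading k n P d ≤ S.comap g from H hz
  rw [IndHC.grading, Ind.grading, Submodule.span_le]
  rintro _ ⟨x, hx, p, rfl⟩
  exact h x hx p

theorem IndHC.grading_sup : IndHC.grading k n P 0 ⊔ IndHC.grading k n P 1 = ⊤ := by
  rw [eq_top_iff]
  rintro z -
  induction z using Ind.induction_on with
  | zero => exact Submodule.zero_mem _
  | tmul x p =>
    obtain ⟨x₀, hx₀, x₁, hx₁, rfl⟩ := Submodule.mem_sup.1
      (HC.grading_sup (k := k) (n := n) ▸ Submodule.mem_top : x ∈ _)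
    rw [← Ind.tmulₗ_apply, map_add]
    exact Submodule.add_mem_sup (tmul_mem_grading hx₀ p) (tmul_mem_grading hx₁ p)
  | add y z hy hz => exact Submodule.add_mem _ hy hz

theorem IndHC.grading_one_eq_bot {P : Type v} [AddCommGroup P] [Module k P]
    [Module (Hecke k 0) P] : IndHC.grading k 0 P 1 = ⊥ := by
  rw [eq_bot_iff]
  intro z hz
  refine grading_le (g := LinearMap.id) (fun x hx p => ?_) hz
  rw [HC.grading_one_eq_bot, Submodule.mem_bot] at hx
  rw [hx, ← Ind.tmulₗ_apply, map_zero]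
  exact Submodule.zero_mem _

theorem IndHC.grading_zero_eq_top {P : Type v} [AddCommGroup P] [Module k P]
    [Module (Hecke k 0) P] : IndHC.grading k 0 P 0 = ⊤ := by
  rw [← grading_sup, grading_one_eq_bot, sup_bot_eq]

theorem HC.parity_heckeToHC (h : Hecke k n) : parity (heckeToHC k n h) = heckeToHC k n h := by
  rw [parity_eq (heckeToHC_mem_grading h)]; simp

variable (k n P) in
/-- The parity operator of the induced module. -/
def IndHC.parity : IndHC k n P →ₗ[HC k n] Res (HC.parity (k := k) (n := n)) (IndHC k n P) :=
  Ind.lift ((Res.mk _ _).toLinearMap ∘ₗ Ind.tmulₗ (heckeToHC k n) P 1) fun h p => by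
    change Res.mk HC.parity _ (Ind.tmul _ 1 (h • p)) =
      heckeToHC k n h • Res.mk HC.parity _ (Ind.tmul _ 1 p)
    rw [Res.smul_mk, HC.parity_heckeToHC, Ind.smul_tmul, mul_one, ← Ind.tmul_mul, one_mul]

theorem IndHC.parity_tmul (x : HC k n) (p : P) : parity k n P (Ind.tmul _ x p) =
    Res.mk _ _ (Ind.tmul _ (HC.parity x) p) :=
  (Ind.lift_tmul _ _ _ _).trans
    (congrArg (Res.mk HC.parity (IndHC k n P)) (Ind.tmul_eq_smul _ _ _).symm)

theorem IndHC.parity_eq {d : ZMod 2} {z : IndHC k n P} (hz : z ∈ IndHC.grading k n P d) :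
    parity k n P z = (-1 : k) ^ d.val • Res.mk _ _ z := by
  rw [← sub_eq_zero]
  refine grading_le (S := ⊥) (g := (parity k n P).restrictScalars k -
    (-1 : k) ^ d.val • (Res.mk HC.parity (IndHC k n P)).toLinearMap) (fun x hx p => ?_) hz
  change parity k n P (Ind.tmul _ x p) - (-1 : k) ^ d.val • Res.mk _ _ (Ind.tmul _ x p) = 0
  rw [parity_tmul, HC.parity_eq hx, ← Ind.tmulₗ_apply, map_smul, LinearMap.smul_apply, map_smul,
    Ind.tmulₗ_apply, sub_self]

/-- The components are defined as spans, so their independence needs an argument: the parity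
operator acts on them by 1 and by -1. -/
theorem IndHC.eq_zero_of_mem_grading [NeZero (2 : k)] {z : IndHC k n P}
    (h₀ : z ∈ IndHC.grading k n P 0) (h₁ : z ∈ IndHC.grading k n P 1) : z = 0 := by
  have e0 := parity_eq h₀
  rw [parity_eq h₁] at e0
  have e : (2 : k) • z = 0 := by
    rw [ZMod.val_one, ZMod.val_zero, pow_one, pow_zero, neg_smul, one_smul] at e0
    have : -z = z := e0
    rw [two_smul, ← neg_eq_iff_add_eq_zero, this]
  exact (smul_eq_zero.1 e).resolve_left (NeZero.ne 2)

end Gradings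

/-! ### The odd automorphism of an induced projective cover -/

section OddAutomorphism

variable {k : Type u} [Field k] {n : ℕ}

variable (k n) in
/-- The generators `c_j`, extended by zero to all natural numbers. -/
def HC.cNat (j : ℕ) : HC k n := if h : j < n then HC.c k ⟨j, h⟩ else 0

theorem HC.cNat_of_lt {j : ℕ} (h : j < n) : cNat k n j = HC.c k ⟨j, h⟩ := dif_pos h

theorem HC.T_mul_cNat {i : ℕ} (hi : i + 1 < n) {j : ℕ} (h : j ≠ i) (h' : j ≠ i + 1) :
    HC.T k ⟨i, hi⟩ * cNat k n j = cNat k n j * HC.T k ⟨i, hi⟩ := by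
  by_cases hj : j < n
  · rw [cNat_of_lt hj]
    exact T_mul_c (fun e => h (congrArg Fin.val e)) fun e => h' (congrArg Fin.val e)
  · rw [cNat, dif_neg hj, mul_zero, zero_mul]

theorem exists_nortonLeft_mul_c (hn : 0 < n) (β : Composition n) : ∃ a : Fin n,
    heckeToHC k n (nortonLeft k β) * HC.c k ⟨0, hn⟩ =
      HC.c k a * heckeToHC k n (nortonLeft k β) := by
  have hT : ∀ {i}, (hi : i < n - 1) → heckeToHC k n (Hecke.idem k n i) =
      -HC.T k ⟨i, Nat.add_lt_of_lt_sub hi⟩ := fun {i} hi => by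
    rw [Hecke.idem, map_neg, heckeToHC_T (Nat.add_lt_of_lt_sub hi)]
  rw [nortonLeft, map_longest]
  obtain ⟨b, hb, h⟩ := exists_longest_mul_eq (a := fun i => heckeToHC k n (Hecke.idem k n i))
    (J := {i | i + 1 ∈ descentSet β}) (c := HC.cNat k n) (N := n - 1)
    (fun i hi => by
      have hi' : i + 1 < n := by omega
      rw [hT hi, HC.cNat_of_lt hi', HC.cNat_of_lt (Nat.lt_of_succ_lt hi'), neg_mul, mul_neg]
      exact congrArg Neg.neg (HC.T_mul_c_fst ⟨i, hi'⟩))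
    (fun i hi j h h' => by rw [hT hi, neg_mul, mul_neg, HC.T_mul_cNat _ h h'])
  rw [HC.cNat_of_lt hn, HC.cNat_of_lt (by omega)] at h
  exact ⟨_, h⟩

/-- In the opposite algebra, (T_i + 1) c_{i+1} = c_i (T_i + 1) is the relation that moves a c
upwards past 1 + T_i. -/
theorem exists_c_mul_nortonRight (hn : 0 < n) (β : Composition n) : ∃ b : Fin n,
    HC.c k ⟨0, hn⟩ * heckeToHC k n (nortonRight k β) =
      heckeToHC k n (nortonRight k β) * HC.c k b := by
  have hT : ∀ {i}, (hi : i < n - 1) →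
      (heckeToHC k n).op (MulOpposite.op (1 + Hecke.T k n i)) =
        MulOpposite.op (1 + HC.T k ⟨i, Nat.add_lt_of_lt_sub hi⟩) := fun {i} hi => by
    rw [AlgHom.op_apply_apply, MulOpposite.unop_op, map_add, map_one,
      heckeToHC_T (Nat.add_lt_of_lt_sub hi)]
  have e : MulOpposite.op (heckeToHC k n (nortonRight k β)) =
      longest (fun i => (heckeToHC k n).op (MulOpposite.op (1 + Hecke.T k n i)))
        {i | i + 1 ∉ descentSet β} (n - 1) := by
    rw [← map_longest]; rfl
  obtain ⟨b, hb, h⟩ := exists_longest_mul_eq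
    (a := fun i => (heckeToHC k n).op (MulOpposite.op (1 + Hecke.T k n i)))
    (J := {i | i + 1 ∉ descentSet β}) (c := fun j => MulOpposite.op (HC.cNat k n j)) (N := n - 1)
    (fun i hi => by
      have hi' : i + 1 < n := by omega
      rw [hT hi, HC.cNat_of_lt hi', HC.cNat_of_lt (Nat.lt_of_succ_lt hi'), ← MulOpposite.op_mul,
        ← MulOpposite.op_mul, add_comm]
      exact congrArg MulOpposite.op (HC.T_add_one_mul_c_snd ⟨i, hi'⟩).symm)
    (fun i hi j h h' => by
      rw [hT hi, ← MulOpposite.op_mul, ← MulOpposite.op_mul, mul_add, add_mul,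
        HC.T_mul_cNat _ h h', mul_one, one_mul])
  rw [← e, ← MulOpposite.op_mul, ← MulOpposite.op_mul, HC.cNat_of_lt hn,
    HC.cNat_of_lt (by omega)] at h
  exact ⟨_, MulOpposite.op_injective h⟩

/-- The first Clifford generator, placed between the two longest elements, leaves to the left as c_a
and to the right as c_b. -/
theorem exists_norton_mul_c (hn : 0 < n) (β : Composition n) : ∃ a b : Fin n,
    heckeToHC k n (norton k β) * HC.c k b = HC.c k a * heckeToHC k n (norton k β) := by
  obtain ⟨a, ha⟩ := exists_nortonLeft_mul_c (k := k) hn β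
  obtain ⟨b, hb⟩ := exists_c_mul_nortonRight (k := k) hn β
  exact ⟨a, b, by rw [norton, map_mul, mul_assoc, ← hb, ← mul_assoc, ha, mul_assoc]⟩

variable {Q : Composition n → Type v} [∀ β, AddCommGroup (Q β)] [∀ β, Module k (Q β)]
  [∀ β, Module (Hecke k n) (Q β)] [∀ β, IsScalarTower k (Hecke k n) (Q β)]

/-- An induced projective cover has an odd automorphism. -/
theorem exists_odd_equiv {q : ∀ β, Q β →ₗ[Hecke k n] SimpleMod k β}
    (hq : ∀ β, IsProjectiveCover (q β)) (hn : 0 < n) (β : Composition n) :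
    ∃ θ : IndHC k n (Q β) ≃ₗ[HC k n] IndHC k n (Q β),
      ∀ d, ∀ z ∈ IndHC.grading k n (Q β) d, θ z ∈ IndHC.grading k n (Q β) (d + 1) := by
  obtain ⟨v, hv⟩ := (hq β).exists_val_eq_one
  have hv0 : q β v ≠ 0 := fun h => by
    rw [h, map_zero] at hv; exact zero_ne_one hv
  obtain ⟨g, hg⟩ := exists_norton_section hq β hv0
  obtain ⟨a, b, hab⟩ := exists_norton_mul_c (k := k) hn β
  let m : HC k n →ₗ[k] IndHC k n (Q β) :=
    (Ind.tmulₗ (heckeToHC k n) (Q β)).flip v ∘ₗ LinearMap.mulRight k (HC.c k b)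
  have hm : ∀ x, m x = Ind.tmul _ (x * HC.c k b) v := fun _ => rfl
  -- The map x ⊗ y ↦ x g(y) c_b ⊗ v is well defined since g is linear. Writing e for Norton's
  -- element, at y = ev it becomes x e c_b ⊗ v = x c_a e ⊗ v = x c_a ⊗ ev.
  let θ : IndHC k n (Q β) →ₗ[HC k n] IndHC k n (Q β) :=
    Ind.lift (m ∘ₗ (heckeToHC k n).toLinearMap ∘ₗ g.restrictScalars k) fun h y => by
      change m (heckeToHC k n (g (h • y))) = heckeToHC k n h • m (heckeToHC k n (g y))
      rw [map_smul, smul_eq_mul, map_mul, hm, hm, Ind.smul_tmul, mul_assoc]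
  have hθ : ∀ x y, θ (Ind.tmul _ x y) = Ind.tmul _ (x * (heckeToHC k n (g y) * HC.c k b)) v :=
    fun x y => (Ind.lift_tmul _ _ _ _).trans (Ind.smul_tmul _ _ _ _)
  have hθv : ∀ x, θ (Ind.tmul _ x (norton k β • v)) =
      Ind.tmul _ (x * HC.c k a) (norton k β • v) := fun x => by
    rw [hθ, hg, hab, ← mul_assoc, Ind.tmul_mul]
  have hspan : Submodule.span (Hecke k n) {norton k β • v} = ⊤ := by
    refine (hq β).span_eq_top fun h => one_ne_zero (α := k) ?_
    rw [← hv, ← one_mul (SimpleMod.val β (q β v)), ← simpleChar_norton (k := k) β,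
      ← SimpleMod.val_smul, ← map_smul, h, map_zero]
  -- On the generator ev the map θ is right multiplication by c_a, and c_a² = -1.
  have hsq : θ ∘ₗ θ = -LinearMap.id := by
    refine Ind.hom_ext fun y => ?_
    obtain ⟨h, rfl⟩ := Submodule.mem_span_singleton.1
      (hspan ▸ Submodule.mem_top : y ∈ Submodule.span (Hecke k n) {norton k β • v})
    rw [← Ind.tmul_mul, LinearMap.comp_apply, hθv, hθv, mul_assoc, HC.c_mul_self, mul_neg, mul_one,
      ← Ind.tmulₗ_apply, ← Ind.tmulₗ_apply, map_neg]
    rfl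
  refine ⟨LinearEquiv.ofLinearMap θ (-θ) (by rw [LinearMap.comp_neg, hsq, neg_neg])
    (by rw [LinearMap.neg_comp, hsq, neg_neg]), fun d z hz => ?_⟩
  refine IndHC.grading_le (g := θ.restrictScalars k) (fun x hx y => ?_) hz
  change θ (Ind.tmul _ x y) ∈ _
  rw [hθ]
  exact IndHC.tmul_mem_grading (HC.mul_mem_grading rfl hx
    (HC.mul_mem_grading (zero_add 1) (heckeToHC_mem_grading _) (HC.c_mem_grading _))) v

end OddAutomorphism

/-! ### Restriction of induced modules -/

section Restriction

variable {k : Type u} [Field k] {n : ℕ}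
variable {P : Type v} [AddCommGroup P] [Module k P] [Module (Hecke k (n + 1)) P]

/-- The generators of H_n do not involve the last strand. -/
theorem HC.c_last_mul_heckeToHC (h : Hecke k n) :
    HC.c k (Fin.last n) * heckeToHC k (n + 1) (heckeTower k n h) =
      heckeToHC k (n + 1) (heckeTower k n h) * HC.c k (Fin.last n) := by
  have hh : h ∈ Algebra.adjoin k {x | ∃ i, i + 1 < n ∧ Hecke.T k n i = x} := by
    rw [Hecke.adjoin_T]; trivial
  induction hh using Algebra.adjoin_induction with
  | mem a ha =>
    obtain ⟨i, hi, rfl⟩ := ha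
    rw [heckeTower_T hi, heckeToHC_T (by omega)]
    refine (T_mul_c (fun e => ?_) fun e => ?_).symm
    · have := congrArg Fin.val e
      simp [TIdx.fst] at this
      omega
    · have := congrArg Fin.val e
      simp [TIdx.snd] at this
      omega
  | algebraMap r =>
    rw [AlgHom.commutes, AlgHom.commutes]
    exact (Algebra.commutes _ _).symm
  | add a b _ _ ha hb => rw [map_add, map_add, mul_add, add_mul, ha, hb]
  | mul a b _ _ ha hb => rw [map_mul, map_mul, ← mul_assoc, ha, mul_assoc, hb, mul_assoc]

variable (P) in
/-- For `y` in the centralizer of `H_n`, the map `x ⊗ p ↦ x y ⊗ p` from the induction of the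
restriction to the restriction of the induction. -/
def indRes (y : HC k (n + 1)) (hy : ∀ h : Hecke k n,
    y * heckeToHC k (n + 1) (heckeTower k n h) = heckeToHC k (n + 1) (heckeTower k n h) * y) :
    IndHC k n (Res (heckeTower k n) P) →ₗ[HC k n] Res (towerMap k n) (IndHC k (n + 1) P) :=
  Ind.lift ((Res.mk (towerMap k n) (IndHC k (n + 1) P)).toLinearMap ∘ₗ
    Ind.tmulₗ (heckeToHC k (n + 1)) P y ∘ₗ (Res.mk (heckeTower k n) P).symm.toLinearMap)
    fun h p => by
      change Res.mk (towerMap k n) (IndHC k (n + 1) P)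
          (Ind.tmul _ y (heckeTower k n h • (Res.mk (heckeTower k n) P).symm p)) =
        Res.mk (towerMap k n) (IndHC k (n + 1) P) (towerMap k n (heckeToHC k n h) •
          Ind.tmul _ y ((Res.mk (heckeTower k n) P).symm p))
      rw [towerMap_heckeToHC, Ind.smul_tmul, ← Ind.tmul_mul, hy]

theorem indRes_tmul {y : HC k (n + 1)} {hy} (x : HC k n) (p : P) :
    indRes P y hy (Ind.tmul _ x (Res.mk (heckeTower k n) P p)) =
      Res.mk _ _ (Ind.tmul _ (towerMap k n x * y) p) :=
  (Ind.lift_tmul _ _ _ _).trans (congrArg (Res.mk (towerMap k n) (IndHC k (n + 1) P))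
    (Ind.smul_tmul _ (towerMap k n x) y p))

theorem indRes_mem_grading {y : HC k (n + 1)} {hy} {d e f : ZMod 2} (hf : d + e = f)
    (he : y ∈ HC.grading k (n + 1) e) {z : IndHC k n (Res (heckeTower k n) P)}
    (hz : z ∈ IndHC.grading k n (Res (heckeTower k n) P) d) :
    indRes P y hy z ∈ Res.grading (towerMap k n) (IndHC.grading k (n + 1) P) f := by
  refine IndHC.grading_le (g := (indRes P y hy).restrictScalars k) (fun x hx p => ?_) hz
  obtain ⟨p, rfl⟩ := (Res.mk (heckeTower k n) P).surjective p
  rw [LinearMap.restrictScalars_apply, indRes_tmul]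
  exact IndHC.tmul_mem_grading (HC.mul_mem_grading hf (towerMap_mem_grading hx) he) _

variable (P) in
/-- The restriction of an induced module as the sum of two copies of the induction of the
restriction. -/
def indResPair : (IndHC k n (Res (heckeTower k n) P) × IndHC k n (Res (heckeTower k n) P))
    →ₗ[HC k n] Res (towerMap k n) (IndHC k (n + 1) P) :=
  LinearMap.coprod (indRes P 1 fun _ => by rw [one_mul, mul_one])
    (indRes P (HC.c k (Fin.last n)) HC.c_last_mul_heckeToHC)

theorem towerMap_cliffToHC (x : Cliff k n) :
    towerMap k n (cliffToHC k n x) = cliffToHC k (n + 1) (Cliff.tower k n x) := by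
  have : (towerMap k n).comp (cliffToHC k n) = (cliffToHC k (n + 1)).comp (Cliff.tower k n) := by
    apply Cliff.algHom_ext
    intro j
    rw [AlgHom.comp_apply, AlgHom.comp_apply, cliffToHC_c, Cliff.tower_c, cliffToHC_c,
      towerMap_gen]
    rfl
  exact congrArg (fun f => f x) this

variable [IsScalarTower k (Hecke k (n + 1)) P] [NeZero (2 : k)]

-- After identifying induced modules with Cl ⊗ P, the map becomes the decomposition Cl_{n+1} = Cl_n
-- ⊕ Cl_n c tensored with P.
variable (P) in
theorem indResPair_bijective : Function.Bijective (indResPair (k := k) (n := n) P) := by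
  let P' := Res (heckeTower k n) P
  let e₁ : (Model k n P' × Model k n P') ≃ₗ[k] (IndHC k n P' × IndHC k n P') :=
    LinearEquiv.prodCongr (LinearEquiv.ofBijective _ (ofModel_bijective k n P'))
      (LinearEquiv.ofBijective _ (ofModel_bijective k n P'))
  let e₂ : (Cliff k n × Cliff k n) ⊗[k] P' ≃ₗ[k] (Model k n P' × Model k n P') :=
    TensorProduct.prodLeft k k (Cliff k n) (Cliff k n) P'
  let e₃ : (Cliff k n × Cliff k n) ⊗[k] P' ≃ₗ[k] Model k (n + 1) P :=
    TensorProduct.congr (LinearEquiv.ofBijective _ Cliff.split_bijective)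
      (Res.mk (heckeTower k n) P).symm
  let e₄ : Model k (n + 1) P ≃ₗ[k] IndHC k (n + 1) P :=
    LinearEquiv.ofBijective _ (ofModel_bijective k (n + 1) P)
  have key : (indResPair (k := k) (n := n) P).restrictScalars k ∘ₗ (e₂ ≪≫ₗ e₁).toLinearMap =
      (e₃ ≪≫ₗ e₄ ≪≫ₗ Res.mk (towerMap k n) _).toLinearMap := by
    refine TensorProduct.ext' fun x p => ?_
    obtain ⟨p, rfl⟩ := (Res.mk (heckeTower k n) P).surjective p
    obtain ⟨x, y⟩ := x
    change indResPair P (ofModel k n P' (Model.tmul x (Res.mk _ P p)),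
        ofModel k n P' (Model.tmul y (Res.mk _ P p))) =
      Res.mk (towerMap k n) _ (ofModel k (n + 1) P (Model.tmul (Cliff.split (x, y)) p))
    rw [ofModel_tmul, ofModel_tmul, ofModel_tmul, indResPair, LinearMap.coprod_apply, indRes_tmul,
      indRes_tmul, towerMap_cliffToHC, towerMap_cliffToHC, Cliff.split_apply, map_add, map_mul,
      cliffToHC_c, mul_one, ← Ind.tmulₗ_apply, ← Ind.tmulₗ_apply, ← Ind.tmulₗ_apply,
      (Ind.tmulₗ (heckeToHC k (n + 1)) P).map_add, LinearMap.add_apply, map_add]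
  have h : ⇑(indResPair (k := k) (n := n) P) =
      (e₃ ≪≫ₗ e₄ ≪≫ₗ Res.mk (towerMap k n) _) ∘ (e₂ ≪≫ₗ e₁).symm := by
    funext z
    obtain ⟨w, rfl⟩ := (e₂ ≪≫ₗ e₁).surjective z
    rw [Function.comp_apply, LinearEquiv.symm_apply_apply]
    exact congrArg (fun f => f w) key
  rw [h]
  exact (LinearEquiv.bijective _).comp (LinearEquiv.bijective _)

end Restriction

/-! ### Isomorphisms of supermodules -/

section SuperIso

theorem eq_zero_or_one_of_zmod_two : ∀ d : ZMod 2, d = 0 ∨ d = 1 := by decide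

variable {k : Type u} [Field k] {A : Type u} [Ring A] [Algebra k A] {𝓐 : ZMod 2 → Submodule k A}
variable {M : Type v} [AddCommGroup M] [Module k M] [Module A M] {𝓜 : ZMod 2 → Submodule k M}
variable {N : Type w} [AddCommGroup N] [Module k N] [Module A N] {𝓝 : ZMod 2 → Submodule k N}

theorem isHomogeneousHom_zero (d : ZMod 2) :
    IsHomogeneousHom 𝓐 𝓜 𝓝 d (0 : M →ₗ[k] N) :=
  ⟨fun _ _ _ => Submodule.zero_mem _, fun _ _ _ _ => by
    rw [LinearMap.zero_apply, LinearMap.zero_apply, smul_zero, smul_zero]⟩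

theorem IsHomogeneousHom.isSuperHom {f : M →ₗ[k] N} (h : IsHomogeneousHom 𝓐 𝓜 𝓝 0 f) :
    IsSuperHom 𝓐 𝓜 𝓝 f :=
  ⟨f, 0, h, isHomogeneousHom_zero 1, (add_zero f).symm⟩

theorem IsEvenIso.isSuperIso {e : M ≃ₗ[k] N} (h : IsEvenIso 𝓐 𝓜 𝓝 e) : IsSuperIso 𝓐 𝓜 𝓝 e :=
  ⟨h.1.isSuperHom, h.2.isSuperHom⟩

theorem isHomogeneousHom_zero_of_linear {f : M →ₗ[k] N}
    (h : ∀ d, ∀ m ∈ 𝓜 d, f m ∈ 𝓝 d) (hf : ∀ (a : A) m, f (a • m) = a • f m) :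
    IsHomogeneousHom 𝓐 𝓜 𝓝 0 f :=
  ⟨fun d m hm => by rw [zero_add]; exact h d m hm, fun j a _ m => by
    rw [zero_mul, ZMod.val_zero, pow_zero, one_smul, hf]⟩

/-- A bijective linear map that preserves degrees is an even isomorphism. -/
theorem isEvenIso_of_linear {e : M ≃ₗ[k] N} (he : ∀ (a : A) x, e.symm (a • x) = a • e.symm x)
    (hdeg : ∀ d, ∀ x ∈ 𝓝 d, e.symm x ∈ 𝓜 d) (hN : 𝓝 0 ⊔ 𝓝 1 = ⊤)
    (hM : ∀ m ∈ 𝓜 0, m ∈ 𝓜 1 → m = 0) : IsEvenIso 𝓐 𝓜 𝓝 e := by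
  refine ⟨isHomogeneousHom_zero_of_linear (fun d m hm => ?_) fun a m => ?_,
    isHomogeneousHom_zero_of_linear hdeg he⟩
  · obtain ⟨x, rfl⟩ := e.symm.surjective m
    rw [LinearEquiv.coe_coe, LinearEquiv.apply_symm_apply]
    -- The image of the component of the wrong degree lies in both degrees, hence vanishes.
    obtain ⟨x₀, h₀, x₁, h₁, rfl⟩ := Submodule.mem_sup.1 (hN ▸ Submodule.mem_top : x ∈ _)
    rw [map_add] at hm
    rcases eq_zero_or_one_of_zmod_two d with rfl | rfl
    · have h := hM (e.symm x₁) (by simpa using (𝓜 0).sub_mem hm (hdeg 0 _ h₀)) (hdeg 1 _ h₁)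
      rw [LinearEquiv.map_eq_zero_iff] at h
      rwa [h, add_zero]
    · have h := hM (e.symm x₀) (hdeg 0 _ h₀) (by simpa using (𝓜 1).sub_mem hm (hdeg 1 _ h₁))
      rw [LinearEquiv.map_eq_zero_iff] at h
      rwa [h, zero_add]
  · obtain ⟨x, rfl⟩ := e.symm.surjective m
    rw [← he, LinearEquiv.coe_coe, LinearEquiv.apply_symm_apply, LinearEquiv.apply_symm_apply]

theorem isHomogeneousHom_of_purely_even (hA : 𝓐 1 = ⊥) {d : ZMod 2} {f : M →ₗ[k] N}
    (h : ∀ j, ∀ m ∈ 𝓜 j, f m ∈ 𝓝 (d + j)) (hf : ∀ (a : A) m, f (a • m) = a • f m) :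
    IsHomogeneousHom 𝓐 𝓜 𝓝 d f := by
  refine ⟨h, fun j a ha m => ?_⟩
  rcases eq_zero_or_one_of_zmod_two j with rfl | rfl
  · rw [mul_zero, ZMod.val_zero, pow_zero, one_smul, hf]
  · rw [hA, Submodule.mem_bot] at ha
    rw [ha, zero_smul, zero_smul, map_zero, smul_zero]

/-- Over a purely even algebra, a linear bijection from a purely even module whose inverse is the
sum of an even and an odd map is an isomorphism of supermodules. -/
theorem isSuperIso_of_purely_even {e : M ≃ₗ[k] N} {Φ : ZMod 2 → N →ₗ[k] M} (hA : 𝓐 1 = ⊥)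
    (hN₀ : 𝓝 0 = ⊤) (hN₁ : 𝓝 1 = ⊥) (hM : ∀ m ∈ 𝓜 0, m ∈ 𝓜 1 → m = 0)
    (hΦ : ∀ d (a : A) x, Φ d (a • x) = a • Φ d x) (hdeg : ∀ d x, Φ d x ∈ 𝓜 d)
    (he : e.symm.toLinearMap = Φ 0 + Φ 1) : IsSuperIso 𝓐 𝓜 𝓝 e := by
  have hΦe : ∀ m, Φ 0 (e m) + Φ 1 (e m) = m := fun m => by
    rw [← LinearMap.add_apply, ← he, LinearEquiv.coe_coe, LinearEquiv.symm_apply_apply]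
  have hsymm : ∀ (a : A) x, e.symm (a • x) = a • e.symm x := fun a x => by
    rw [← LinearEquiv.coe_coe, he, LinearMap.add_apply, LinearMap.add_apply, hΦ, hΦ, smul_add]
  have hlin : ∀ (a : A) m, e (a • m) = a • e m := fun a m => by
    obtain ⟨x, rfl⟩ := e.symm.surjective m
    rw [← hsymm, LinearEquiv.apply_symm_apply, LinearEquiv.apply_symm_apply]
  have hvan : ∀ d, ∀ m ∈ 𝓜 (d + 1), Φ d (e m) = 0 := fun d m hm => by
    have h := hΦe m
    rcases eq_zero_or_one_of_zmod_two d with rfl | rfl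
    · exact hM _ (hdeg 0 _) (by
        rw [eq_sub_of_add_eq h]; exact (𝓜 1).sub_mem hm (hdeg 1 _))
    · exact hM _ (by
        rw [eq_sub_of_add_eq' h]; exact (𝓜 0).sub_mem hm (hdeg 0 _)) (hdeg 1 _)
  -- The operators Φ_d e sum to the identity and are the projections of M to its degrees, so e Φ_d e
  -- is the part of e that lives on degree d. It has degree d since N is purely even.
  have h1 : ∀ d, IsHomogeneousHom 𝓐 𝓜 𝓝 d (e.toLinearMap ∘ₗ Φ d ∘ₗ e.toLinearMap) := fun d =>
    isHomogeneousHom_of_purely_even hA (fun j m hm => by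
      by_cases hj : d + j = 0
      · rw [hj, hN₀]; trivial
      · have hj' : j = d + 1 :=
          (by decide : ∀ d j : ZMod 2, d + j ≠ 0 → j = d + 1) d j hj
        subst hj'
        change e (Φ d (e m)) ∈ _
        rw [hvan d m hm, map_zero]
        exact Submodule.zero_mem _) fun a m => by
      change e (Φ d (e (a • m))) = a • e (Φ d (e m))
      rw [hlin, hΦ, hlin]
  have h2 : ∀ d, IsHomogeneousHom 𝓐 𝓝 𝓜 d (Φ d) := fun d =>
    isHomogeneousHom_of_purely_even hA (fun j x hx => by
      rcases eq_zero_or_one_of_zmod_two j with rfl | rfl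
      · rw [add_zero]; exact hdeg d x
      · rw [hN₁, Submodule.mem_bot] at hx
        rw [hx, map_zero]
        exact Submodule.zero_mem _) (hΦ d)
  refine ⟨⟨_, _, h1 0, h1 1, ?_⟩, ⟨_, _, h2 0, h2 1, he⟩⟩
  refine LinearMap.ext fun m => ?_
  change e m = e (Φ 0 (e m)) + e (Φ 1 (e m))
  rw [← map_add, hΦe]

end SuperIso

/-! ### Direct sums -/

section DirectSums

/-- The maps E and R satisfy the identities of the injections and projections of a finite biproduct.
-/
theorem toModule_bijective {A ι : Type*} [Ring A] [Fintype ι] [DecidableEq ι] {N : ι → Type*}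
    [∀ s, AddCommGroup (N s)] [∀ s, Module A (N s)] {M : Type*} [AddCommGroup M] [Module A M]
    (E : ∀ s, N s →ₗ[A] M) (R : ∀ s, M →ₗ[A] N s) (h : ∀ s x, R s (E s x) = x)
    (h' : ∀ s t, s ≠ t → ∀ x, R t (E s x) = 0) (hs : ∀ m, ∑ s, E s (R s m) = m) :
    Function.Bijective (DirectSum.toModule A ι M E) := by
  constructor
  · rw [injective_iff_map_eq_zero]
    have key : ∀ t x, R t (DirectSum.toModule A ι M E x) = x t := fun t x => by
      induction x using DirectSum.induction_on with
      | zero => rw [map_zero, map_zero, DirectSum.zero_apply]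
      | of s x =>
        rw [← DirectSum.lof_eq_of A, DirectSum.toModule_lof, DirectSum.lof_eq_of]
        by_cases hst : s = t
        · subst hst; rw [h, DirectSum.of_eq_same]
        · rw [h' s t hst, DirectSum.of_eq_of_ne _ _ _ (Ne.symm hst)]
      | add x y hx hy => rw [map_add, map_add, hx, hy, DirectSum.add_apply]
    intro x hx
    refine DFinsupp.ext fun t => ?_
    have := key t x
    rw [hx, map_zero] at this
    exact this.symm
  · intro m
    refine ⟨∑ s, DirectSum.lof A ι N s (R s m), ?_⟩
    rw [map_sum]
    simp_rw [DirectSum.toModule_lof]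
    exact hs m

variable {k : Type u} [Field k] {ι : Type*} {N : ι → Type v} [∀ i, AddCommGroup (N i)]
  [∀ i, Module k (N i)] {𝓝 : ∀ i, ZMod 2 → Submodule k (N i)}

theorem directSumGrading_sup [Fintype ι] [DecidableEq ι] (h : ∀ i, 𝓝 i 0 ⊔ 𝓝 i 1 = ⊤) :
    directSumGrading 𝓝 0 ⊔ directSumGrading 𝓝 1 = ⊤ := by
  have hof : ∀ d i, ∀ x ∈ 𝓝 i d, DirectSum.of N i x ∈ directSumGrading 𝓝 d := by
    intro d i x hx j
    by_cases hij : i = j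
    · subst hij; rwa [DirectSum.of_eq_same]
    · rw [DirectSum.of_eq_of_ne _ _ _ (Ne.symm hij)]; exact Submodule.zero_mem _
  rw [eq_top_iff]
  rintro x -
  induction x using DirectSum.induction_on with
  | zero => exact Submodule.zero_mem _
  | of i x =>
    obtain ⟨x₀, h₀, x₁, h₁, rfl⟩ := Submodule.mem_sup.1 (h i ▸ Submodule.mem_top : x ∈ _)
    rw [map_add]
    exact Submodule.add_mem_sup (hof 0 i _ h₀) (hof 1 i _ h₁)
  | add x y hx hy => exact Submodule.add_mem _ hx hy

theorem directSumGrading_eq_top {d : ZMod 2} (h : ∀ i, 𝓝 i d = ⊤) :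
    directSumGrading 𝓝 d = ⊤ :=
  eq_top_iff.2 fun _ _ i => by rw [h i]; trivial

theorem directSumGrading_eq_bot {d : ZMod 2} (h : ∀ i, 𝓝 i d = ⊥) :
    directSumGrading 𝓝 d = ⊥ :=
  eq_bot_iff.2 fun x hx => DFinsupp.ext fun i => by
    have := hx i
    rwa [h i, Submodule.mem_bot] at this

theorem toModule_mem {A : Type*} [Ring A] [∀ i, Module A (N i)] [Fintype ι] [DecidableEq ι]
    {M : Type*} [AddCommGroup M] [Module k M] [Module A M] {S : Submodule k M} {d : ZMod 2}
    {E : ∀ s, N s →ₗ[A] M} (h : ∀ s, ∀ x ∈ 𝓝 s d, E s x ∈ S) {x : ⨁ s, N s}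
    (hx : x ∈ directSumGrading 𝓝 d) : DirectSum.toModule A ι M E x ∈ S := by
  have e : x = ∑ s, DirectSum.lof A ι N s (x s) := by
    simp_rw [DirectSum.lof_eq_of]
    exact (DirectSum.sum_univ_of x).symm
  rw [e, map_sum]
  refine Submodule.sum_mem _ fun s _ => ?_
  rw [DirectSum.toModule_lof]
  exact h s _ (hx s)

end DirectSums

/-! ### The branching rule -/

section Branching

variable {k : Type u} [Field k] {n : ℕ}

theorem IndHC.map_mem_grading {P : Type v} [AddCommGroup P] [Module k P] [Module (Hecke k n) P]
    [IsScalarTower k (Hecke k n) P] {P' : Type w} [AddCommGroup P'] [Module k P']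
    [Module (Hecke k n) P'] [IsScalarTower k (Hecke k n) P'] (g : P →ₗ[Hecke k n] P') {d : ZMod 2}
    {z : IndHC k n P} (hz : z ∈ IndHC.grading k n P d) :
    Ind.map (heckeToHC k n) g z ∈ IndHC.grading k n P' d := by
  refine IndHC.grading_le (g := (Ind.map (heckeToHC k n) g).restrictScalars k)
    (fun x hx p => ?_) hz
  rw [LinearMap.restrictScalars_apply, Ind.map_tmul]
  exact IndHC.tmul_mem_grading hx _

variable {α : Composition (n + 1)}
  {P : Type v} [AddCommGroup P] [Module k P] [Module (Hecke k (n + 1)) P]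
  [IsScalarTower k (Hecke k (n + 1)) P]
  {p : P →ₗ[Hecke k (n + 1)] SimpleMod k α}
  {Q : Composition n → Type w} [∀ β, AddCommGroup (Q β)] [∀ β, Module k (Q β)]
  [∀ β, Module (Hecke k n) (Q β)] [∀ β, IsScalarTower k (Hecke k n) (Q β)]
  {q : ∀ β, Q β →ₗ[Hecke k n] SimpleMod k β}

open Classical in
/-- The branching rule without gradings; the summands may be twisted by automorphisms. -/
theorem exists_toModule_bijective [IsAlgClosed k] [CharZero k] (hp : IsProjectiveCover p)
    (hq : ∀ β, IsProjectiveCover (q β))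
    (τ : ∀ s : Branch α × Fin 2, IndHC k n (Q s.1.comp) ≃ₗ[HC k n] IndHC k n (Q s.1.comp)) :
    ∃ E : ∀ s : Branch α × Fin 2,
        IndHC k n (Q s.1.comp) →ₗ[HC k n] Res (towerMap k n) (IndHC k (n + 1) P),
      Function.Bijective (DirectSum.toModule (HC k n) _ _ E) ∧
      ∀ (s : Branch α × Fin 2) (d f : ZMod 2), d + (s.2.val : ZMod 2) = f → ∀ z,
        τ s z ∈ IndHC.grading k n (Q s.1.comp) d →
          E s z ∈ Res.grading (towerMap k n) (IndHC.grading k (n + 1) P) f := by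
  obtain ⟨ψ⟩ := hp.exists_res_equiv hq
  have := Fintype.ofFinite (Branch α)
  let φ := LinearEquiv.ofBijective _ (indResPair_bijective (k := k) (n := n) P)
  let I := IndHC k n (Res (heckeTower k n) P)
  let inj : Fin 2 → I →ₗ[HC k n] I × I := ![LinearMap.inl _ _ _, LinearMap.inr _ _ _]
  let pr : Fin 2 → I × I →ₗ[HC k n] I := ![LinearMap.fst _ _ _, LinearMap.snd _ _ _]
  have pr_inj : ∀ t x, pr t (inj t x) = x := by
    rw [Fin.forall_fin_two]; exact ⟨fun _ => rfl, fun _ => rfl⟩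
  have pr_inj_ne : ∀ t t', t ≠ t' → ∀ x, pr t' (inj t x) = 0 := by
    rw [Fin.forall_fin_two, Fin.forall_fin_two, Fin.forall_fin_two]
    exact ⟨⟨fun h => absurd rfl h, fun _ _ => rfl⟩, ⟨fun _ _ => rfl, fun h => absurd rfl h⟩⟩
  have sum_inj : ∀ z, ∑ t, inj t (pr t z) = z := fun z => by
    rw [Fin.sum_univ_two]
    exact Prod.ext (add_zero _) (zero_add _)
  let ι : ∀ b : Branch α, Q b.comp →ₗ[Hecke k n] Res (heckeTower k n) P := fun b =>
    ψ.symm.toLinearMap ∘ₗ DirectSum.lof (Hecke k n) (Branch α) (fun b => Q b.comp) b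
  let π : ∀ b : Branch α, Res (heckeTower k n) P →ₗ[Hecke k n] Q b.comp := fun b =>
    DirectSum.component (Hecke k n) (Branch α) (fun b => Q b.comp) b ∘ₗ ψ.toLinearMap
  have hι : ∀ b x, ι b x = ψ.symm (DirectSum.of (fun b : Branch α => Q b.comp) b x) :=
    fun _ _ => rfl
  have hπ : ∀ b y, π b y = ψ y b := fun _ _ => rfl
  have π_ι : ∀ b x, π b (ι b x) = x := fun b x => by
    rw [hπ, hι, LinearEquiv.apply_symm_apply, DirectSum.of_eq_same]
  have π_ι_ne : ∀ b b', b ≠ b' → ∀ x, π b' (ι b x) = 0 := fun b b' h x => by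
    rw [hπ, hι, LinearEquiv.apply_symm_apply, DirectSum.of_eq_of_ne _ _ _ h.symm]
  have sum_ι : ∀ y, ∑ b, ι b (π b y) = y := fun y => by
    simp_rw [hι, hπ]
    rw [← map_sum, LinearEquiv.symm_apply_eq]
    exact DirectSum.sum_univ_of (ψ y)
  have map_π_ι : ∀ b z, Ind.map (heckeToHC k n) (π b) (Ind.map (heckeToHC k n) (ι b) z) = z := by
    intro b z
    induction z using Ind.induction_on with
    | zero => rw [map_zero, map_zero]
    | tmul x y => rw [Ind.map_tmul, Ind.map_tmul, π_ι]
    | add y z hy hz => rw [map_add, map_add, hy, hz]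
  have map_π_ι_ne : ∀ b b', b ≠ b' → ∀ z,
      Ind.map (heckeToHC k n) (π b') (Ind.map (heckeToHC k n) (ι b) z) = 0 := by
    intro b b' h z
    induction z using Ind.induction_on with
    | zero => rw [map_zero, map_zero]
    | tmul x y => rw [Ind.map_tmul, Ind.map_tmul, π_ι_ne b b' h, ← Ind.tmulₗ_apply, map_zero]
    | add y z hy hz => rw [map_add, map_add, hy, hz, add_zero]
  have sum_map : ∀ z : I,
      ∑ b, Ind.map (heckeToHC k n) (ι b) (Ind.map (heckeToHC k n) (π b) z) = z := by
    intro z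
    induction z using Ind.induction_on with
    | zero => simp only [map_zero, Finset.sum_const_zero]
    | tmul x y =>
      simp_rw [Ind.map_tmul, ← Ind.tmulₗ_apply]
      rw [← map_sum, sum_ι]
    | add y z hy hz => simp only [map_add, Finset.sum_add_distrib, hy, hz]
  -- Injections: twist by τ, induce the inclusion of the summand b into Res P, and put the result
  -- into copy t. Copy 1 multiplies by the last Clifford generator, which shifts the degree by t.
  let E : ∀ s : Branch α × Fin 2,
      IndHC k n (Q s.1.comp) →ₗ[HC k n] Res (towerMap k n) (IndHC k (n + 1) P) := fun s =>
    φ.toLinearMap ∘ₗ inj s.2 ∘ₗ Ind.map (heckeToHC k n) (ι s.1) ∘ₗ (τ s).toLinearMap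
  let R : ∀ s : Branch α × Fin 2,
      Res (towerMap k n) (IndHC k (n + 1) P) →ₗ[HC k n] IndHC k n (Q s.1.comp) := fun s =>
    (τ s).symm.toLinearMap ∘ₗ Ind.map (heckeToHC k n) (π s.1) ∘ₗ pr s.2 ∘ₗ φ.symm.toLinearMap
  have hE : ∀ s z, E s z = φ (inj s.2 (Ind.map (heckeToHC k n) (ι s.1) (τ s z))) :=
    fun _ _ => rfl
  have hR : ∀ s m, R s m = (τ s).symm (Ind.map (heckeToHC k n) (π s.1) (pr s.2 (φ.symm m))) :=
    fun _ _ => rfl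
  refine ⟨E, toModule_bijective E R (fun s x => ?_) (fun s t hst x => ?_) fun m => ?_,
    fun s d f hf z hz => ?_⟩
  · rw [hR, hE, LinearEquiv.symm_apply_apply, pr_inj, map_π_ι, LinearEquiv.symm_apply_apply]
  · rw [hR, hE, LinearEquiv.symm_apply_apply]
    by_cases h : s.2 = t.2
    · rw [h, pr_inj, map_π_ι_ne _ _ (fun h1 => hst (Prod.ext h1 h)), map_zero]
    · rw [pr_inj_ne _ _ h, map_zero, map_zero]
  · simp_rw [hE, hR, LinearEquiv.apply_symm_apply]
    rw [Fintype.sum_prod_type_right]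
    have h : ∀ t, ∑ b, φ (inj t (Ind.map (heckeToHC k n) (ι b)
        (Ind.map (heckeToHC k n) (π b) (pr t (φ.symm m))))) = φ (inj t (pr t (φ.symm m))) := by
      intro t
      rw [← map_sum, ← map_sum, sum_map]
    rw [Finset.sum_congr rfl fun t _ => h t, ← map_sum, sum_inj, LinearEquiv.apply_symm_apply]
  · rw [hE]
    have h := IndHC.map_mem_grading (ι s.1) hz
    obtain ⟨b, t⟩ := s
    revert t
    rw [Fin.forall_fin_two]
    refine ⟨fun hf z hz h => ?_, fun hf z hz h => ?_⟩
    · change indResPair P (Ind.map (heckeToHC k n) (ι b) (τ (b, 0) z), 0) ∈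
        Res.grading (towerMap k n) (IndHC.grading k (n + 1) P) f
      rw [indResPair, LinearMap.coprod_apply, map_zero, add_zero]
      exact indRes_mem_grading (by simpa using hf) HC.one_mem_grading h
    · change indResPair P (0, Ind.map (heckeToHC k n) (ι b) (τ (b, 1) z)) ∈
        Res.grading (towerMap k n) (IndHC.grading k (n + 1) P) f
      rw [indResPair, LinearMap.coprod_apply, map_zero, zero_add]
      exact indRes_mem_grading (by simpa using hf) (HC.c_mem_grading _) h

end Branching

end HeckeClifford

end

/-! ### The branching rule with gradings -/

open HeckeClifford in
theorem theorem4p1p5 {k : Type*} [Field k] [IsAlgClosed k] [CharZero k] {n : ℕ}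
    (α : Composition (n + 1))
    -- `P` is a projective cover of the simple module `S_α`
    {P : Type*} [AddCommGroup P] [Module k P] [Module (Hecke k (n + 1)) P]
    [IsScalarTower k (Hecke k (n + 1)) P]
    (p : P →ₗ[Hecke k (n + 1)] SimpleMod k α) (hp : IsProjectiveCover p)
    -- `Q β` is a projective cover of the simple module `S_β`, for each composition `β` of `n`
    {Q : Composition n → Type*} [∀ β, AddCommGroup (Q β)] [∀ β, Module k (Q β)]
    [∀ β, Module (Hecke k n) (Q β)] [∀ β, IsScalarTower k (Hecke k n) (Q β)]
    (q : ∀ β, Q β →ₗ[Hecke k n] SimpleMod k β) (hq : ∀ β, IsProjectiveCover (q β)) :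
    ∃ e : Res (towerMap k n) (IndHC k (n + 1) P) ≃ₗ[k]
        ⨁ s : Branch α × Fin 2, IndHC k n (Q s.1.comp),
      IsSuperIso (HC.grading k n)
        (Res.grading (towerMap k n) (IndHC.grading k (n + 1) P))
        (directSumGrading fun s : Branch α × Fin 2 => IndHC.grading k n (Q s.1.comp)) e ∧
      (1 ≤ n → IsEvenIso (HC.grading k n)
        (Res.grading (towerMap k n) (IndHC.grading k (n + 1) P))
        (directSumGrading fun s : Branch α × Fin 2 => IndHC.grading k n (Q s.1.comp)) e) := by
  classical
  have := Fintype.ofFinite (Branch α)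
  have hM : ∀ m ∈ Res.grading (towerMap k n) (IndHC.grading k (n + 1) P) 0,
      m ∈ Res.grading (towerMap k n) (IndHC.grading k (n + 1) P) 1 → m = 0 :=
    fun m h₀ h₁ => IndHC.eq_zero_of_mem_grading (k := k) (n := n + 1) (P := P) h₀ h₁
  rcases Nat.eq_zero_or_pos n with rfl | hn
  -- With no Clifford generator left the summands are purely even, while the second copies land in
  -- odd degree; no twist is made.
  · obtain ⟨E, hE, hdeg⟩ := exists_toModule_bijective hp hq fun s => LinearEquiv.refl _ _
    let e := (LinearEquiv.ofBijective _ hE).restrictScalars k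
    -- The part of degree d keeps exactly the copies with t = d.
    let E' : ZMod 2 → ∀ s : Branch α × Fin 2, IndHC k 0 (Q s.1.comp) →ₗ[HC k 0]
        Res (towerMap k 0) (IndHC k (0 + 1) P) :=
      fun d s => if (s.2.val : ZMod 2) = d then E s else 0
    refine ⟨e.symm, isSuperIso_of_purely_even
      (Φ := fun d => (DirectSum.toModule (HC k 0) _ _ (E' d)).restrictScalars k)
      HC.grading_one_eq_bot
      (directSumGrading_eq_top fun s => IndHC.grading_zero_eq_top)
      (directSumGrading_eq_bot fun s => IndHC.grading_one_eq_bot) hM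
      (fun d a x => map_smul (DirectSum.toModule (HC k 0) _ _ (E' d)) a x)
      (fun d x => ?_) ?_, fun h => absurd h (by omega)⟩
    · refine toModule_mem (𝓝 := fun s : Branch α × Fin 2 => IndHC.grading k 0 (Q s.1.comp))
        (d := 0) (fun s z _ => ?_) ?_
      · by_cases hs : (s.2.val : ZMod 2) = d
        · rw [show E' d s = E s from if_pos hs]
          refine hdeg s 0 d (by rw [zero_add, hs]) z ?_
          rw [IndHC.grading_zero_eq_top]; trivial
        · rw [show E' d s = 0 from if_neg hs]
          exact Submodule.zero_mem _
      · rw [directSumGrading_eq_top fun s => IndHC.grading_zero_eq_top]; trivial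
    · have h : DirectSum.toModule (HC k 0) _ _ E = DirectSum.toModule (HC k 0) _ _ (E' 0) +
          DirectSum.toModule (HC k 0) _ _ (E' 1) := by
        refine DirectSum.linearMap_ext _ fun s => LinearMap.ext fun z => ?_
        simp only [LinearMap.comp_apply, LinearMap.add_apply, DirectSum.toModule_lof]
        rcases eq_zero_or_one_of_zmod_two (s.2.val : ZMod 2) with hs | hs <;> simp [E', hs]
      exact congrArg (LinearMap.restrictScalars k) h
  · choose θ hθ using fun β => exists_odd_equiv hq hn β
    -- The odd automorphism on the second copies cancels the shift by the last Clifford generator,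
    -- as 1 + 1 = 0 in ℤ/2.
    obtain ⟨E, hE, hdeg⟩ := exists_toModule_bijective hp hq fun s : Branch α × Fin 2 =>
      if s.2 = 0 then LinearEquiv.refl _ _ else θ s.1.comp
    let e := (LinearEquiv.ofBijective _ hE).restrictScalars k
    have h : IsEvenIso (HC.grading k n)
        (Res.grading (towerMap k n) (IndHC.grading k (n + 1) P))
        (directSumGrading fun s : Branch α × Fin 2 => IndHC.grading k n (Q s.1.comp)) e.symm := by
      refine isEvenIso_of_linear (fun a x => map_smul (LinearEquiv.ofBijective _ hE) a x)
        (fun d x hx => toModule_mem (fun s z hz => ?_) hx)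
        (directSumGrading_sup fun s => IndHC.grading_sup) hM
      obtain ⟨b, t⟩ := s
      revert t
      rw [Fin.forall_fin_two]
      refine ⟨fun z hz => hdeg (b, 0) d d (by simp) z (by simpa using hz), fun z hz =>
        hdeg (b, 1) (d + 1) d ?_ z (by simpa using hθ _ d z hz)⟩
      simp only [Fin.val_one, Nat.cast_one]
      rw [add_assoc, show (1 + 1 : ZMod 2) = 0 by decide, add_zero]
    exact ⟨e.symm, h.isSuperIso, fun _ => h⟩
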